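/- Let $p,q\in\mathbb{C}$ with $|p|<1$ and $q\neq 0$, and let $n\ge 0$ be an integer. For $x\in\mathbb{C}\setminus\{0\}$ put $$\theta(x;p)=\prod_{j=0}^{\infty}(1-xp^j)\Big(1-\frac{p^{j+1}}{x}\Big),\qquad (x;q,p)_k=\prod_{j=0}^{k-1}\theta(xq^j;p)\quad(k=0,1,2,\dots),$$ and $(x_1,\dots,x_r;q,p)_k=(x_1;q,p)_k\cdots(x_r;q,p)_k$. For nonzero complex numbers $a,b,c,d$ define $$L_n(a,b,c,d)=\sum_{j=0}^n\frac{\theta(aq^{2j};p)\,(bq^n,q^{-n},c,d,aq^2/bc,q/d;q,p)_j\,(a^2;q^2,p)_j}{\theta(a;p)\,(aq^{1-n}/b,aq^{1+n},aq/c,ad,bc/q,aq/d;q,p)_j\,(q^2;q^2,p)_j}(-a)^j,$$ $$P_n(a,b,c)=\frac{(aq,b/q,q^2/c,bc/a;q,p)_n}{(q^2,b/a,bc/q,aq/c;q,p)_n},$$ $$R_n(a,b,c,d)=\sum_{k=0}^n\frac{\theta(q^{1+2k};p)\,(adq^{-k};q^2,p)_k}{\theta(q;p)\,(dq^{-k}/a;q^2,p)_k}\cdot\frac{(bq^n,q^{-n},c,aq^2/bc,d/a;q,p)_k}{(q^{2-n}/b,q^{2+n},q^2/c,bc/a,ad;q,p)_k}\Big(-\frac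 qa\Big)^k.$$ (i) Transformation. If no denominator in $L_n$, $P_n$, $R_n$ vanishes, that is, if $\theta(a;p)$, $\theta(q;p)$, $(aq^{1-n}/b,aq^{1+n},aq/c,ad,bc/q,aq/d;q,p)_n$, $(q^2;q^2,p)_n$, $(q^2,b/a,bc/q,aq/c;q,p)_n$, $(q^{2-n}/b,q^{2+n},q^2/c,bc/a,ad;q,p)_n$ and all $(dq^{-k}/a;q^2,p)_k$ with $0\le k\le n$ are nonzero, then $$L_n(a,b,c,d)=P_n(a,b,c)\,R_n(a,b,c,d).$$ For nonzero complex numbers $a,b$ define further $$S_n(a,b)=\sum_{k=0}^n\frac{\theta(q^{1+2k};p)\,(b^2q^{-k};q^2,p)_k}{\theta(q;p)\,(a^2q^{-k};q^2,p)_k}\cdot\frac{(bq^n/a,q^{-n},a^2;q,p)_k}{(aq^{2-n}/b,q^{2+n},b^2;q,p)_k}\Big(-\frac{aq}{b}\Big)^k,$$ $$T_n(a,b)=\frac{(q,q^2,ab,q/ab;q,p)_n\,(b^2/a^2;q^2,p)_n}{(b/a,b/aq,b^2,q/a^2;q,p)_n\,(q^2;q^2,p)_n}\Big(-\frac{b}{aq}\Big)^n.$$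 (ii) Limiting case. Let $a,b,c$ be nonzero, and suppose that $\theta(b/a;p)$, $\theta(q;p)$, $(bq^{1+n}/a,bq/ac,b^2,bc/aq,q/a^2;q,p)_n$, $(q^2;q^2,p)_n$, $(q^2,bq/a,b/aq,q^2/c,c;q,p)_n$, $(aq^{2-n}/b,q^{2+n};q,p)_n$ and all $(a^2q^{-k};q^2,p)_k$ with $0\le k\le n$ are nonzero. Then, as $t\to b/a$ with $t\ne b/a$, $$\frac{L_n(b/a,t,c,ab)}{P_n(b/a,t,c)}\to T_n(a,b),\qquad R_n(b/a,t,c,ab)\to S_n(a,b).$$ (iii) Summation. Let $a,b$ be nonzero. If no denominator in $S_n$, $T_n$ vanishes, that is, if $\theta(q;p)$, $(aq^{2-n}/b,q^{2+n},b^2;q,p)_n$, $(b/a,b/aq,b^2,q/a^2;q,p)_n$, $(q^2;q^2,p)_n$ and all $(a^2q^{-k};q^2,p)_k$ with $0\le k\le n$ are nonzero, then $$S_n(a,b)=T_n(a,b).$$ -/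

import Mathlib

open Filter Topology

namespace EllipticTransformation

/-- The infinite `q`-shifted factorial `(x; p)_∞ = ∏_{j ≥ 0} (1 - x p ^ j)`, for `|p| < 1`. -/
noncomputable def qInf (x p : ℂ) : ℂ := ∏' j : ℕ, (1 - x * p ^ j)

/-- The product defining `(x; p)_∞` converges when `|p| < 1`. -/
theorem multipliable_qInf (x : ℂ) {p : ℂ} (hp : ‖p‖ < 1) :
    Multipliable fun j : ℕ => 1 - x * p ^ j := by
  have h : Summable fun j : ℕ => ‖-(x * p ^ j)‖ := by
    simpa [norm_mul, norm_pow] using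
      (summable_geometric_of_lt_one (norm_nonneg p) hp).mul_left ‖x‖
  simpa [sub_eq_add_neg] using multipliable_one_add_of_summable h

/-- The modified Jacobi theta function `θ(x; p) = (x; p)_∞ (p / x; p)_∞`, for `x ≠ 0`. -/
noncomputable def theta (x p : ℂ) : ℂ := qInf x p * qInf (p / x) p

/-- The theta shifted factorial `(x; q, p)_k = ∏_{0 ≤ j < k} θ(x q ^ j; p)`. -/
noncomputable def thetaFac (x q p : ℂ) (k : ℕ) : ℂ :=
  ∏ j ∈ Finset.range k, theta (x * q ^ j) p

/-- The shorthand `(x₁, …, x_r; q, p)_k = (x₁; q, p)_k ⋯ (x_r; q, p)_k`. -/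
noncomputable def thetaFacs (l : List ℂ) (q p : ℂ) (k : ℕ) : ℂ :=
  (l.map fun x => thetaFac x q p k).prod

/-- The sum on the left-hand side of the transformation. -/
noncomputable def leftSum (n : ℕ) (a b c d q p : ℂ) : ℂ :=
  ∑ j ∈ Finset.range (n + 1),
    (theta (a * q ^ (2 * j)) p
        * thetaFacs [b * q ^ n, q ^ (-(n : ℤ)), c, d, a * q ^ 2 / (b * c), q / d] q p j
        * thetaFac (a ^ 2) (q ^ 2) p j)
      / (theta a p
        * thetaFacs [a * q ^ (1 - (n : ℤ)) / b, a * q ^ (1 + n), a * q / c, a * d,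
            b * c / q, a * q / d] q p j
        * thetaFac (q ^ 2) (q ^ 2) p j)
      * (-a) ^ j

/-- The product in front of the sum on the right-hand side of the transformation. -/
noncomputable def prefactor (n : ℕ) (a b c q p : ℂ) : ℂ :=
  thetaFacs [a * q, b / q, q ^ 2 / c, b * c / a] q p n
    / thetaFacs [q ^ 2, b / a, b * c / q, a * q / c] q p n

/-- The sum on the right-hand side of the transformation. -/
noncomputable def rightSum (n : ℕ) (a b c d q p : ℂ) : ℂ :=
  ∑ k ∈ Finset.range (n + 1),
    (theta (q ^ (1 + 2 * k)) p * thetaFac (a * d * q ^ (-(k : ℤ))) (q ^ 2) p k)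
      / (theta q p * thetaFac (d * q ^ (-(k : ℤ)) / a) (q ^ 2) p k)
      * (thetaFacs [b * q ^ n, q ^ (-(n : ℤ)), c, a * q ^ 2 / (b * c), d / a] q p k
        / thetaFacs [q ^ (2 - (n : ℤ)) / b, q ^ (2 + n), q ^ 2 / c, b * c / a, a * d] q p k)
      * (-(q / a)) ^ k

/-- The sum in the limiting summation, in the relabelled parameters. -/
noncomputable def limitSum (n : ℕ) (a b q p : ℂ) : ℂ :=
  ∑ k ∈ Finset.range (n + 1),
    (theta (q ^ (1 + 2 * k)) p * thetaFac (b ^ 2 * q ^ (-(k : ℤ))) (q ^ 2) p k)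
      / (theta q p * thetaFac (a ^ 2 * q ^ (-(k : ℤ))) (q ^ 2) p k)
      * (thetaFacs [b * q ^ n / a, q ^ (-(n : ℤ)), a ^ 2] q p k
        / thetaFacs [a * q ^ (2 - (n : ℤ)) / b, q ^ (2 + n), b ^ 2] q p k)
      * (-(a * q / b)) ^ k

/-- The product in the limiting summation, in the relabelled parameters. -/
noncomputable def limitProduct (n : ℕ) (a b q p : ℂ) : ℂ :=
  (thetaFacs [q, q ^ 2, a * b, q / (a * b)] q p n * thetaFac (b ^ 2 / a ^ 2) (q ^ 2) p n)
    / (thetaFacs [b / a, b / (a * q), b ^ 2, q / a ^ 2] q p n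
      * thetaFac (q ^ 2) (q ^ 2) p n)
    * (-(b / (a * q))) ^ n

end EllipticTransformation

/-!
The transformation compares two very-well-poised sums with base parameters `a` and `q`. It is a
change-of-base ("Bailey") transformation `baileyLeft_eq`, valid for any pair of sequences `u`, `v`
related by `IsBaileyPair`, applied to the pair that expresses a quadratic summation
`quadSum_eq_quadProd`.

Both of these identities are proved by interpolation. The Jacobi triple product
`theta_mul_qInf_eq_tsum`, with the resulting double series split by parity, shows that
`θ(x c) θ(x K / c)` is a bilinear form of rank two in functions of `x` and functions of `c`
(`exists_theta_mul_theta_eq`); this is Weierstrass' addition formula. Hence a product of `n` such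
functions of `c` is a product of `n` linear forms on a plane, and a combination of such products
that vanishes at `n + 1` points, distinct up to the symmetries, is identically zero
(`eq_zero_of_mem_thetaSpan`).

* In the quadratic summation the variable is `d`. At `d = q ^ (-m)` with `m < n` both sides
  are unchanged, up to the same factor, when `m` and `n` are interchanged, which reduces the claim
  to the smaller index `m`. The remaining point is `d = q ^ (1 - n) / a`, where the sum has a single
  nonzero term.
* In `baileyLeft_eq` the variable is `c`. At `c = q ^ (-m)` with `m < n`, interchanging `m` and `n`
  and replacing `b` by `a q² / b` again reduces the claim to a smaller index. At the remaining
  point `c = q ^ (n + 1)` the sum over `v` has a single nonzero term, and the identity is the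
  defining relation of the pair.

The argument divides by theta functions at `q`-shifts of `a`, `b` and `b / a`, so it first
applies to parameters that are generic in the sense of `Generic`. Each generic condition excludes a
countable set only, because `θ` has countably many zeros, and both sides are continuous where no
denominator vanishes; this gives the transformation in full.

As `b → a` the reciprocal of the prefactor tends to zero, and of all terms of the left-hand sum only
the last one, which contains the reversed factor `(a q ^ (1 - n) / b; q, p)_n` in its denominator,
compensates for this (`tendsto_leftSum_div_prefactor`). On the right-hand side the factors with `c`
cancel. For generic parameters the summation follows by comparing the two limits. It extends to all
`b`, and then to all `q`, by density; the last step is needed because the denominators of the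
summation do not force `θ(q ^ (n + 1))` to be nonzero.
-/


namespace EllipticTransformation

/-! ### The theta function -/

theorem tendsto_partialProd_qInf (x : ℂ) {p : ℂ} (hp : ‖p‖ < 1) :
    Tendsto (fun N => ∏ j ∈ Finset.range N, (1 - x * p ^ j)) atTop (𝓝 (qInf x p)) :=
  (multipliable_qInf x hp).hasProd.tendsto_prod_nat

theorem qInf_eq_one_sub_mul (x : ℂ) {p : ℂ} (hp : ‖p‖ < 1) :
    qInf x p = (1 - x) * qInf (p * x) p := by
  have h1 := (tendsto_partialProd_qInf x hp).comp (tendsto_add_atTop_nat 1)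
  have h2 := (tendsto_partialProd_qInf (p * x) hp).const_mul (1 - x)
  refine tendsto_nhds_unique h1 (h2.congr fun N => ?_)
  rw [Function.comp_apply, Finset.prod_range_succ', pow_zero, mul_one, mul_comm]
  congr 1
  exact Finset.prod_congr rfl fun j _ => by ring

theorem theta_inv {x p : ℂ} (hx : x ≠ 0) (hp : ‖p‖ < 1) :
    theta x⁻¹ p = -theta x p / x := by
  unfold theta
  rw [qInf_eq_one_sub_mul x⁻¹ hp, qInf_eq_one_sub_mul x hp,
    show p / x⁻¹ = p * x by field_simp, show p * x⁻¹ = p / x by field_simp]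
  field_simp
  ring

theorem theta_one {p : ℂ} (hp : ‖p‖ < 1) : theta 1 p = 0 := by
  unfold theta
  rw [qInf_eq_one_sub_mul 1 hp]
  simp

theorem theta_inv_ne_zero {x p : ℂ} (hx : x ≠ 0) (hp : ‖p‖ < 1) (h : theta x p ≠ 0) :
    theta x⁻¹ p ≠ 0 := by
  rw [theta_inv hx hp]
  exact div_ne_zero (neg_ne_zero.2 h) hx

theorem continuous_qInf {p : ℂ} (hp : ‖p‖ < 1) : Continuous fun x => qInf x p := by
  refine continuous_iff_continuousAt.2 fun x => ?_
  have hs : Summable fun j : ℕ => (‖x‖ + 1) * ‖p‖ ^ j :=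
    (summable_geometric_of_lt_one (norm_nonneg p) hp).mul_left _
  have h := Summable.hasProdUniformlyOn_nat_one_add (f := fun j (y : ℂ) => -(y * p ^ j))
    (isCompact_closedBall (0 : ℂ) (‖x‖ + 1)) hs
    (Eventually.of_forall fun j y hy => by
      rw [norm_neg, norm_mul, norm_pow]
      gcongr
      simpa using hy)
    (fun j => by fun_prop)
  have hc : ContinuousOn (fun y => ∏' j : ℕ, (1 + -(y * p ^ j)))
      (Metric.closedBall (0 : ℂ) (‖x‖ + 1)) := by
    refine (hasProdUniformlyOn_iff_tendstoUniformlyOn.1 h).continuousOn ?_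
    exact Frequently.of_forall fun s => by fun_prop
  have := hc.continuousAt (x := x) (Metric.closedBall_mem_nhds_of_mem (by simp))
  simpa only [qInf, sub_eq_add_neg] using this

theorem continuousAt_theta {x p : ℂ} (hx : x ≠ 0) (hp : ‖p‖ < 1) :
    ContinuousAt (fun x => theta x p) x := by
  unfold theta
  exact (continuous_qInf hp).continuousAt.mul
    ((continuous_qInf hp).continuousAt.comp (continuousAt_const.div continuousAt_id hx))

/-- The zero set of `θ(·; p)` on the punctured plane is `p ^ ℤ` (`{1}` if `p = 0`); all that matters
here is that it is countable, so that generic parameters are dense. -/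
theorem countable_setOf_theta_eq_zero {p : ℂ} (hp : ‖p‖ < 1) :
    {x : ℂ | x ≠ 0 ∧ theta x p = 0}.Countable := by
  have hq : ∀ x : ℂ, qInf x p = 0 → ∃ j : ℕ, 1 - x * p ^ j = 0 := by
    intro x hx
    by_contra! hne
    have hs : Summable fun j : ℕ => ‖-(x * p ^ j)‖ := by
      simpa [norm_mul, norm_pow] using
        (summable_geometric_of_lt_one (norm_nonneg p) hp).mul_left ‖x‖
    refine tprod_one_add_ne_zero_of_summable (f := fun j : ℕ => -(x * p ^ j)) (fun j => ?_) hs ?_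
    · simpa [sub_eq_add_neg] using hne j
    · simpa [qInf, sub_eq_add_neg] using hx
  refine ((Set.countable_range fun j : ℕ => (p ^ j)⁻¹).union
    (Set.countable_range fun j : ℕ => p * p ^ j)).mono ?_
  rintro x ⟨hx, h⟩
  rcases mul_eq_zero.1 h with h | h
  · obtain ⟨j, hj⟩ := hq _ h
    refine Or.inl ⟨j, ?_⟩
    exact (eq_inv_of_mul_eq_one_left (sub_eq_zero.1 hj).symm).symm
  · obtain ⟨j, hj⟩ := hq _ h
    refine Or.inr ⟨j, ?_⟩
    field_simp at hj
    linear_combination -hj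

/-! ### The Jacobi triple product -/

/-- The Gaussian binomial coefficient in base `p`, by its Pascal recursion. -/
noncomputable def gaussBinom (p : ℂ) : ℕ → ℕ → ℂ
  | _, 0 => 1
  | 0, _ + 1 => 0
  | M + 1, k + 1 => gaussBinom p M k + p ^ (k + 1) * gaussBinom p M (k + 1)

theorem gaussBinom_zero_right (p : ℂ) (M : ℕ) : gaussBinom p M 0 = 1 := by
  cases M <;> rfl

theorem gaussBinom_eq_zero (p : ℂ) {M k : ℕ} (h : M < k) : gaussBinom p M k = 0 := by
  induction M generalizing k with
  | zero => obtain ⟨k, rfl⟩ := Nat.exists_eq_succ_of_ne_zero h.ne'; rfl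
  | succ M ih =>
    obtain ⟨k, rfl⟩ := Nat.exists_eq_succ_of_ne_zero (Nat.ne_zero_of_lt h)
    simp [gaussBinom, ih (show M < k by omega), ih (show M < k + 1 by omega)]

theorem prod_one_sub_eq_sum_gaussBinom (p z : ℂ) (M : ℕ) :
    ∏ j ∈ Finset.range M, (1 - z * p ^ j) =
      ∑ k ∈ Finset.range (M + 1), gaussBinom p M k * p ^ (k.choose 2) * (-z) ^ k := by
  induction M generalizing z with
  | zero => simp [gaussBinom]
  | succ M ih =>
    have h1 : ∏ j ∈ Finset.range (M + 1), (1 - z * p ^ j) =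
        (∏ j ∈ Finset.range M, (1 - p * z * p ^ j)) * (1 - z) := by
      rw [Finset.prod_range_succ', pow_zero, mul_one]
      congr 1
      exact Finset.prod_congr rfl fun j _ => by ring
    have h2 : ∑ k ∈ Finset.range (M + 1), gaussBinom p M k * p ^ (k.choose 2) * (-(p * z)) ^ k =
        ∑ k ∈ Finset.range (M + 1),
          gaussBinom p M (k + 1) * p ^ ((k + 1).choose 2) * (-(p * z)) ^ (k + 1) + 1 := by
      have := Finset.sum_range_succ'
        (fun k => gaussBinom p M k * p ^ (k.choose 2) * (-(p * z)) ^ k) (M + 1)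
      rw [Finset.sum_range_succ, gaussBinom_eq_zero p (Nat.lt_succ_self M)] at this
      simpa [gaussBinom_zero_right] using this
    rw [h1, ih, mul_sub, mul_one, Finset.sum_range_succ' _ (M + 1)]
    nth_rewrite 1 [h2]
    simp only [gaussBinom, Nat.choose_zero_succ, pow_zero, mul_one]
    rw [Finset.sum_mul, add_sub_right_comm, ← Finset.sum_sub_distrib]
    congr 1
    refine Finset.sum_congr rfl fun k _ => ?_
    have : (k + 1).choose 2 = k + k.choose 2 := by
      rw [Nat.choose_succ_succ', Nat.choose_one_right]
    rw [this]
    ring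

/-- The finite product `(p; p)_m`. -/
noncomputable def pFac (p : ℂ) (m : ℕ) : ℂ := ∏ j ∈ Finset.range m, (1 - p * p ^ j)

theorem pFac_succ (p : ℂ) (m : ℕ) : pFac p (m + 1) = pFac p m * (1 - p * p ^ m) :=
  Finset.prod_range_succ _ _

theorem one_sub_mul_pow_ne_zero {p : ℂ} (hp : ‖p‖ < 1) (j : ℕ) : 1 - p * p ^ j ≠ 0 := by
  rw [← pow_succ', sub_ne_zero]
  intro h
  have := congrArg norm h
  rw [norm_one, norm_pow] at this
  exact (pow_lt_one₀ (norm_nonneg p) hp (by omega)).ne' this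

theorem pFac_ne_zero {p : ℂ} (hp : ‖p‖ < 1) (m : ℕ) : pFac p m ≠ 0 :=
  Finset.prod_ne_zero_iff.2 fun j _ => one_sub_mul_pow_ne_zero hp j

theorem qInf_self_ne_zero {p : ℂ} (hp : ‖p‖ < 1) : qInf p p ≠ 0 := by
  have hs : Summable fun j : ℕ => ‖-(p * p ^ j)‖ := by
    simpa [norm_mul, norm_pow] using
      (summable_geometric_of_lt_one (norm_nonneg p) hp).mul_left ‖p‖
  have := tprod_one_add_ne_zero_of_summable (f := fun j : ℕ => -(p * p ^ j))
    (fun j => by simpa [sub_eq_add_neg] using one_sub_mul_pow_ne_zero hp j) hs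
  simpa [qInf, sub_eq_add_neg] using this

theorem tendsto_pFac {p : ℂ} (hp : ‖p‖ < 1) : Tendsto (pFac p) atTop (𝓝 (qInf p p)) :=
  tendsto_partialProd_qInf p hp

theorem gaussBinom_mul_pFac (p : ℂ) {M k : ℕ} (h : k ≤ M) :
    gaussBinom p M k * pFac p k * pFac p (M - k) = pFac p M := by
  induction M generalizing k with
  | zero =>
    obtain rfl : k = 0 := by omega
    simp [gaussBinom, pFac]
  | succ M ih =>
    cases k with
    | zero => simp [gaussBinom, pFac]
    | succ k =>
      rw [Nat.succ_sub_succ]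
      rcases (Nat.lt_or_ge k M) with hk | hk
      · obtain ⟨r, rfl⟩ : ∃ r, M = k + 1 + r := ⟨M - (k + 1), by omega⟩
        have h1 := ih (k := k) (by omega)
        have h2 := ih (k := k + 1) (by omega)
        rw [show k + 1 + r - k = r + 1 by omega] at h1 ⊢
        rw [show k + 1 + r - (k + 1) = r by omega] at h2
        rw [gaussBinom, pFac_succ p (k + 1 + r)]
        rw [pFac_succ p r] at h1 ⊢
        rw [pFac_succ p k] at h2 ⊢
        have h3 : p * p ^ (k + 1 + r) = p ^ (k + 1) * (p * p ^ r) := by ring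
        have h4 : p ^ (k + 1) = p * p ^ k := by ring
        rw [h3, h4] at *
        linear_combination (1 - p * p ^ k) * h1 + p * p ^ k * (1 - p * p ^ r) * h2
      · obtain rfl : k = M := by omega
        have h1 := ih (k := k) le_rfl
        rw [gaussBinom, gaussBinom_eq_zero p (Nat.lt_succ_self k), pFac_succ]
        linear_combination (1 - p * p ^ k) * h1

/-- The exponent `m (m - 1) / 2` of the theta series. -/
def tri (m : ℤ) : ℤ := m * (m - 1) / 2

theorem two_mul_tri (m : ℤ) : 2 * tri m = m * (m - 1) :=
  Int.mul_ediv_cancel' (Int.even_mul_pred_self m).two_dvd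

theorem tri_add_one (m : ℤ) : tri (m + 1) = tri m + m := by
  have h1 := two_mul_tri m
  have h2 := two_mul_tri (m + 1)
  linarith

theorem summable_tri_nat {r y : ℝ} (hr : 0 < r) (hr1 : r < 1) (hy : 0 < y) :
    Summable fun m : ℕ => r ^ tri m * y ^ m := by
  refine summable_of_ratio_test_tendsto_lt_one (l := 0) one_pos
    (Eventually.of_forall fun n => by positivity) ?_
  have h := (tendsto_pow_atTop_nhds_zero_of_lt_one hr.le hr1).mul_const y
  rw [zero_mul] at h
  refine h.congr fun n => ?_
  rw [Real.norm_of_nonneg (by positivity), Real.norm_of_nonneg (by positivity)]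
  push_cast
  rw [tri_add_one, zpow_add₀ hr.ne', zpow_natCast]
  field_simp
  rw [pow_succ']

theorem summable_tri {r y : ℝ} (hr : 0 < r) (hr1 : r < 1) (hy : 0 < y) :
    Summable fun m : ℤ => r ^ tri m * y ^ m := by
  refine Summable.of_nat_of_neg (by simpa using summable_tri_nat hr hr1 hy) ?_
  have h := summable_tri_nat hr hr1 (y := r * y⁻¹) (by positivity)
  refine h.congr fun n => ?_
  have : tri (-(n : ℤ)) = tri n + n := by
    have h1 := two_mul_tri n
    have h2 := two_mul_tri (-n)
    linarith
  rw [this, zpow_add₀ hr.ne', zpow_neg, zpow_natCast, zpow_natCast, mul_pow, inv_pow]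
  ring

theorem summable_norm_thetaSeries {p : ℂ} (hp : ‖p‖ < 1) (hp0 : p ≠ 0) {x : ℂ} (hx : x ≠ 0) :
    Summable fun m : ℤ => ‖p ^ tri m * x ^ m‖ := by
  simpa [norm_mul, norm_zpow] using
    summable_tri (norm_pos_iff.2 hp0) hp (norm_pos_iff.2 hx)

/-- The finite form of the triple product, from the `q`-binomial theorem with `2 N` factors. -/
theorem prod_mul_prod_eq_sum_gaussBinom {p : ℂ} (hp0 : p ≠ 0) {x : ℂ} (hx : x ≠ 0) (N : ℕ) :
    (∏ j ∈ Finset.range N, (1 - x * p ^ j)) * ∏ j ∈ Finset.range N, (1 - p / x * p ^ j) =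
      ∑ k ∈ Finset.range (2 * N + 1),
        gaussBinom p (2 * N) k * (p ^ tri ((k : ℤ) - N) * (-x) ^ ((k : ℤ) - N)) := by
  have key : ∏ j ∈ Finset.range (2 * N), (1 - x * (p ^ N)⁻¹ * p ^ j) =
      ((-x) ^ N * p ^ (-tri (-N : ℤ)))
        * ((∏ j ∈ Finset.range N, (1 - x * p ^ j)) *
          ∏ j ∈ Finset.range N, (1 - p / x * p ^ j)) := by
    rw [two_mul, Finset.prod_range_add, mul_comm (∏ j ∈ Finset.range N, (1 - x * p ^ j)),
      ← mul_assoc]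
    congr 1
    · rw [← Finset.prod_range_reflect]
      induction N with
      | zero => simp [tri]
      | succ N ih =>
        have h1 : ∀ j ∈ Finset.range N,
            1 - x * (p ^ (N + 1))⁻¹ * p ^ (N + 1 - 1 - j) =
              1 - x * (p ^ N)⁻¹ * p ^ (N - 1 - j) := by
          intro j hj
          rw [Finset.mem_range] at hj
          obtain ⟨r, rfl⟩ : ∃ r, N = j + 1 + r := ⟨N - (j + 1), by omega⟩
          rw [show j + 1 + r + 1 - 1 - j = r + 1 by omega,
            show j + 1 + r - 1 - j = r by omega]
          field_simp
          ring
        have h2 : tri (-((N + 1 : ℕ) : ℤ)) = tri (-N) + (N + 1) := by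
          have h1 := two_mul_tri (-N)
          have h2 := two_mul_tri (-((N + 1 : ℕ) : ℤ))
          push_cast at h2 ⊢
          linarith
        rw [Finset.prod_range_succ, Finset.prod_congr rfl h1, ih, Finset.prod_range_succ, h2,
          neg_add, zpow_add₀ hp0, show (-((N : ℤ) + 1)) = -((N + 1 : ℕ) : ℤ) by push_cast; ring,
          zpow_neg p ((N + 1 : ℕ) : ℤ), zpow_natCast, show N + 1 - 1 - N = 0 by omega]
        field_simp
        ring
    · exact Finset.prod_congr rfl fun j _ => by rw [pow_add]; field_simp
  rw [prod_one_sub_eq_sum_gaussBinom] at key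
  have hne : (-x) ^ N * p ^ (-tri (-N : ℤ)) ≠ 0 :=
    mul_ne_zero (pow_ne_zero _ (neg_ne_zero.2 hx)) (zpow_ne_zero _ hp0)
  refine mul_left_cancel₀ hne (key.symm.trans ?_)
  rw [Finset.mul_sum]
  refine Finset.sum_congr rfl fun k _ => ?_
  have hx' : -x ≠ 0 := neg_ne_zero.2 hx
  have h3 : ((k.choose 2 : ℕ) : ℤ) = tri k := by
    clear * -
    induction k with
    | zero => simp [tri]
    | succ k ih =>
      rw [Nat.choose_succ_succ', Nat.choose_one_right]
      push_cast
      rw [ih, tri_add_one]; ring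
  have h4 : tri ((k : ℤ) - N) + -tri (-N : ℤ) = tri k - N * k := by
    have h1 := two_mul_tri (-N)
    have h2 := two_mul_tri ((k : ℤ) - N)
    have h3 := two_mul_tri k
    linarith
  have h5 : (-(x * (p ^ N)⁻¹)) ^ k = (-x) ^ k * p ^ (-((N : ℤ) * k)) := by
    rw [neg_mul_eq_neg_mul, mul_pow, zpow_neg, zpow_mul, zpow_natCast, zpow_natCast, inv_pow]
  have h6 : (-x) ^ N * (-x) ^ ((k : ℤ) - N) = (-x) ^ k := by
    rw [zpow_sub₀ hx', zpow_natCast, zpow_natCast]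
    field_simp
  calc gaussBinom p (2 * N) k * p ^ k.choose 2 * (-(x * (p ^ N)⁻¹)) ^ k
      = gaussBinom p (2 * N) k * (-x) ^ k * p ^ (tri k - N * k) := by
        rw [h5, ← zpow_natCast p (k.choose 2), h3, sub_eq_add_neg, zpow_add₀ hp0]; ring
    _ = _ := by rw [← h4, zpow_add₀ hp0, ← h6]; ring

/-- The Jacobi triple product identity. -/
theorem theta_mul_qInf_eq_tsum {p : ℂ} (hp : ‖p‖ < 1) (hp0 : p ≠ 0) {x : ℂ} (hx : x ≠ 0) :
    theta x p * qInf p p = ∑' m : ℤ, p ^ tri m * (-x) ^ m := by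
  have hQ := qInf_self_ne_zero hp
  have hlim := tendsto_pFac hp
  -- the coefficients of the finite products, extended by zero
  let f : ℕ → ℤ → ℂ := fun N m => if m < -N then 0 else
    gaussBinom p (2 * N) (m + N).toNat * (p ^ tri m * (-x) ^ m)
  have hf : ∀ N, ∑' m, f N m =
      (∏ j ∈ Finset.range N, (1 - x * p ^ j)) * ∏ j ∈ Finset.range N, (1 - p / x * p ^ j) := by
    intro N
    rw [prod_mul_prod_eq_sum_gaussBinom hp0 hx]
    let e : ℕ ↪ ℤ := ⟨fun k => (k : ℤ) - N, fun a b h => by simpa using h⟩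
    have he : ∀ k, e k = (k : ℤ) - N := fun _ => rfl
    rw [tsum_eq_sum (s := (Finset.range (2 * N + 1)).map e), Finset.sum_map]
    · refine Finset.sum_congr rfl fun k _ => ?_
      simp [f, he]
    · intro m hm
      simp only [f]
      split_ifs with h
      · rfl
      · rw [gaussBinom_eq_zero, zero_mul]
        by_contra hlt
        refine hm (Finset.mem_map.2 ⟨(m + N).toNat, Finset.mem_range.2 (by omega), ?_⟩)
        rw [he]
        omega
  have h1 : Tendsto (fun N => ∑' m, f N m) atTop (𝓝 (theta x p)) := by
    simp only [hf]
    exact (tendsto_partialProd_qInf x hp).mul (tendsto_partialProd_qInf (p / x) hp)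
  obtain ⟨C, hC⟩ : ∃ C, ∀ m, ‖pFac p m‖ ≤ C := by
    obtain ⟨C, hC⟩ := hlim.norm.bddAbove_range
    exact ⟨C, fun m => hC ⟨m, rfl⟩⟩
  obtain ⟨B, hB⟩ : ∃ B, ∀ m, ‖(pFac p m)⁻¹‖ ≤ B := by
    obtain ⟨B, hB⟩ := (hlim.inv₀ hQ).norm.bddAbove_range
    exact ⟨B, fun m => hB ⟨m, rfl⟩⟩
  have hC0 : 0 ≤ C := (norm_nonneg _).trans (hC 0)
  have hB0 : 0 ≤ B := (norm_nonneg _).trans (hB 0)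
  have hg : ∀ {M k : ℕ}, k ≤ M →
      gaussBinom p M k = pFac p M * (pFac p k)⁻¹ * (pFac p (M - k))⁻¹ := by
    intro M k h
    rw [← gaussBinom_mul_pFac p h]
    have := pFac_ne_zero hp k
    have := pFac_ne_zero hp (M - k)
    field_simp
  have hgb : ∀ M k : ℕ, ‖gaussBinom p M k‖ ≤ C * B * B := by
    intro M k
    rcases Nat.lt_or_ge M k with h | h
    · rw [gaussBinom_eq_zero p h, norm_zero]; positivity
    · rw [hg h, norm_mul, norm_mul]
      gcongr
      exacts [hC _, hB _, hB _]
  have h2 : Tendsto (fun N => ∑' m, f N m) atTop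
      (𝓝 (∑' m : ℤ, (qInf p p)⁻¹ * (p ^ tri m * (-x) ^ m))) := by
    refine tendsto_tsum_of_dominated_convergence
      (bound := fun m => C * B * B * ‖p ^ tri m * (-x) ^ m‖)
      ((summable_norm_thetaSeries hp hp0 (neg_ne_zero.2 hx)).mul_left _) ?_ ?_
    · intro m
      have ht : Tendsto (fun N : ℕ => pFac p (2 * N) * (pFac p (m + N).toNat)⁻¹
          * (pFac p (2 * N - (m + N).toNat))⁻¹) atTop
          (𝓝 (qInf p p * (qInf p p)⁻¹ * (qInf p p)⁻¹)) := by
        refine ((hlim.comp ?_).mul ((hlim.comp ?_).inv₀ hQ)).mul ((hlim.comp ?_).inv₀ hQ)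
        · exact tendsto_atTop_mono (fun N => (by omega : N ≤ 2 * N)) tendsto_id
        · refine tendsto_atTop_mono (fun N => (by omega : N - m.natAbs ≤ (m + N).toNat)) ?_
          exact tendsto_sub_atTop_nat _
        · refine tendsto_atTop_mono
            (fun N => (by omega : N - m.natAbs ≤ 2 * N - (m + N).toNat)) ?_
          exact tendsto_sub_atTop_nat _
      rw [mul_inv_cancel₀ hQ, one_mul] at ht
      refine (ht.mul_const (p ^ tri m * (-x) ^ m)).congr' ?_
      filter_upwards [eventually_ge_atTop m.natAbs] with N hN
      simp only [f]
      rw [if_neg (by omega), hg (by omega)]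
    · refine Eventually.of_forall fun N m => ?_
      simp only [f]
      split_ifs
      · rw [norm_zero]; positivity
      · rw [norm_mul]
        gcongr
        exact hgb _ _
  have := tendsto_nhds_unique h1 h2
  rw [this, tsum_mul_left]
  field_simp

/-! ### The addition formula as a rank-two decomposition -/

theorem exists_mul_theta_eq_add_of_ne_zero {p : ℂ} (hp : ‖p‖ < 1) (hp0 : p ≠ 0) :
    ∃ Θ : ℂ → ℂ, ∀ A B : ℂ, A ≠ 0 → B ≠ 0 →
      theta A p * theta B p = Θ (A * B) * Θ (p * A / B) - A * Θ (p * A * B) * Θ (p ^ 2 * A / B) := by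
  have hQ := qInf_self_ne_zero hp
  let S : ℂ → ℂ := fun y => ∑' m : ℤ, (p ^ 2) ^ tri m * y ^ m
  have hp2 : ‖p ^ 2‖ < 1 := by
    rw [norm_pow]
    exact pow_lt_one₀ (norm_nonneg p) hp two_ne_zero
  have hp20 : p ^ 2 ≠ 0 := pow_ne_zero 2 hp0
  have hS : ∀ {y z : ℂ}, y ≠ 0 → z ≠ 0 →
      HasSum (fun st : ℤ × ℤ => ((p ^ 2) ^ tri st.1 * y ^ st.1) * ((p ^ 2) ^ tri st.2 * z ^ st.2))
        (S y * S z) := by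
    intro y z hy hz
    have h1 := summable_norm_thetaSeries hp2 hp20 hy
    have h2 := summable_norm_thetaSeries hp2 hp20 hz
    have := (summable_mul_of_summable_norm h1 h2).hasSum
    rwa [← tsum_mul_tsum_of_summable_norm h1 h2] at this
  refine ⟨fun y => S y * (qInf p p)⁻¹, fun A B hA hB => ?_⟩
  have hA' : -A ≠ 0 := neg_ne_zero.2 hA
  have hB' : -B ≠ 0 := neg_ne_zero.2 hB
  have h1 := summable_norm_thetaSeries hp hp0 hA'
  have h2 := summable_norm_thetaSeries hp hp0 hB'
  let F : ℤ × ℤ → ℂ := fun mn =>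
    (p ^ tri mn.1 * (-A) ^ mn.1) * (p ^ tri mn.2 * (-B) ^ mn.2)
  have hF : HasSum F ((theta A p * qInf p p) * (theta B p * qInf p p)) := by
    have := (summable_mul_of_summable_norm h1 h2).hasSum
    rwa [← tsum_mul_tsum_of_summable_norm h1 h2, ← theta_mul_qInf_eq_tsum hp hp0 hA,
      ← theta_mul_qInf_eq_tsum hp hp0 hB] at this
  -- split the double series according to the parity of `m + n`
  let g₀ : ℤ × ℤ → ℤ × ℤ := fun st => (st.1 + st.2, st.1 - st.2)
  let g₁ : ℤ × ℤ → ℤ × ℤ := fun st => (st.1 + st.2 + 1, st.1 - st.2)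
  have hg₀ : Function.Injective g₀ := by
    rintro ⟨s, t⟩ ⟨s', t'⟩ h
    simp only [g₀, Prod.mk.injEq] at h ⊢
    omega
  have hg₁ : Function.Injective g₁ := by
    rintro ⟨s, t⟩ ⟨s', t'⟩ h
    simp only [g₁, Prod.mk.injEq] at h ⊢
    omega
  have hc : IsCompl (Set.range g₀) (Set.range g₁) := by
    constructor
    · rw [Set.disjoint_left]
      rintro _ ⟨⟨s, t⟩, rfl⟩ ⟨⟨s', t'⟩, h⟩
      simp only [g₀, g₁, Prod.mk.injEq] at h
      omega
    · rw [codisjoint_iff_le_sup]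
      rintro ⟨m, n⟩ -
      rcases Int.even_or_odd' (m + n) with ⟨k, hk | hk⟩
      · refine Or.inl ⟨(k, m - k), ?_⟩
        simp only [g₀, Prod.mk.injEq]
        omega
      · refine Or.inr ⟨(k, m - 1 - k), ?_⟩
        simp only [g₁, Prod.mk.injEq]
        omega
  have hzp : ∀ {z : ℂ} (m : ℤ), z ≠ 0 → (z ^ 2) ^ m = z ^ (2 * m) := fun m hz => by
    rw [zpow_mul]; norm_cast
  have hsq : ∀ m : ℤ, (-1 : ℂ) ^ (2 * m) = 1 := fun m => by rw [zpow_mul]; norm_num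
  have hsplit : ∀ (z : ℂ) (m : ℤ), (-z) ^ m = (-1) ^ m * z ^ m := fun z m => by
    rw [← mul_zpow, neg_one_mul]
  have e₀ : HasSum (F ∘ g₀) (S (A * B) * S (p * A / B)) := by
    refine (hS (mul_ne_zero hA hB) (div_ne_zero (mul_ne_zero hp0 hA) hB)).congr_fun ?_
    rintro ⟨s, t⟩
    have ht : tri (s + t) + tri (s - t) = 2 * tri s + (2 * tri t + t) := by
      have h1 := two_mul_tri s
      have h2 := two_mul_tri t
      have h3 := two_mul_tri (s + t)
      have h4 := two_mul_tri (s - t)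
      linarith
    have hA2 : A ^ (s + t) * B ^ (s - t) = (A * B) ^ s * (A / B) ^ t := by
      rw [mul_zpow, div_zpow, zpow_add₀ hA, zpow_sub₀ hB]; ring
    have hm : (-1 : ℂ) ^ (s + t) * (-1) ^ (s - t) = 1 := by
      rw [← zpow_add₀ (by norm_num), show s + t + (s - t) = 2 * s by ring, hsq]
    calc F (g₀ (s, t)) = (p ^ tri (s + t) * p ^ tri (s - t)) *
          ((-1) ^ (s + t) * (-1) ^ (s - t)) * (A ^ (s + t) * B ^ (s - t)) := by
          simp only [F, g₀, hsplit A, hsplit B]; ring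
      _ = _ := by
        rw [hm, hA2, ← zpow_add₀ hp0, ht, zpow_add₀ hp0, zpow_add₀ hp0, hzp _ hp0, hzp _ hp0,
          mul_div_assoc p, mul_zpow p]
        ring
  have e₁ : HasSum (F ∘ g₁) (-A * (S (p * A * B) * S (p ^ 2 * A / B))) := by
    refine ((hS (mul_ne_zero (mul_ne_zero hp0 hA) hB)
      (div_ne_zero (mul_ne_zero hp20 hA) hB)).mul_left (-A)).congr_fun ?_
    rintro ⟨s, t⟩
    have ht : tri (s + t + 1) + tri (s - t) = (2 * tri s + s) + (2 * tri t + 2 * t) := by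
      have h1 := two_mul_tri s
      have h2 := two_mul_tri t
      have h3 := two_mul_tri (s + t + 1)
      have h4 := two_mul_tri (s - t)
      linarith
    have hA2 : A ^ (s + t + 1) * B ^ (s - t) = A * ((A * B) ^ s * (A / B) ^ t) := by
      rw [mul_zpow, div_zpow, zpow_add₀ hA, zpow_add₀ hA, zpow_sub₀ hB, zpow_one]; ring
    have hm : (-1 : ℂ) ^ (s + t + 1) * (-1) ^ (s - t) = -1 := by
      rw [← zpow_add₀ (by norm_num), show s + t + 1 + (s - t) = 2 * s + 1 by ring,
        zpow_add₀ (by norm_num), hsq, zpow_one, one_mul]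
    calc F (g₁ (s, t)) = (p ^ tri (s + t + 1) * p ^ tri (s - t)) *
          ((-1) ^ (s + t + 1) * (-1) ^ (s - t)) * (A ^ (s + t + 1) * B ^ (s - t)) := by
          simp only [F, g₁, hsplit A, hsplit B]; ring
      _ = _ := by
        rw [hm, hA2, ← zpow_add₀ hp0, ht, zpow_add₀ hp0, zpow_add₀ hp0, zpow_add₀ hp0,
          hzp _ hp0, hzp _ hp0, mul_div_assoc, mul_zpow (p ^ 2), mul_assoc p, mul_zpow p,
          hzp _ hp0]
        ring
  have := hF.unique (HasSum.add_isCompl hc ((hg₀.hasSum_range_iff).2 e₀)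
    ((hg₁.hasSum_range_iff).2 e₁))
  have hq : qInf p p * (qInf p p)⁻¹ = 1 := mul_inv_cancel₀ hQ
  linear_combination ((qInf p p)⁻¹) ^ 2 * this -
    theta A p * theta B p * (qInf p p * (qInf p p)⁻¹ + 1) * hq

/-- For fixed `K`, the functions `x ↦ θ(x c; p) θ(x K / c; p)` span a two-dimensional space.
This is the form in which the addition formula for `θ` is used. -/
theorem exists_theta_mul_theta_eq {p : ℂ} (hp : ‖p‖ < 1) {K : ℂ} (hK : K ≠ 0) :
    ∃ E₀ E₁ F₀ F₁ : ℂ → ℂ, ∀ x c : ℂ, x ≠ 0 → c ≠ 0 →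
      theta (x * c) p * theta (x * K / c) p = E₀ x * F₀ c + E₁ x * F₁ c := by
  rcases eq_or_ne p 0 with rfl | hp0
  · have ht : ∀ x : ℂ, theta x 0 = 1 - x := by
      intro x
      have h : qInf 0 0 = 1 := by simp [qInf]
      unfold theta
      rw [qInf_eq_one_sub_mul x hp, zero_mul, zero_div, h, mul_one, mul_one]
    refine ⟨fun x => 1 + x ^ 2 * K, fun x => -x, fun _ => 1, fun c => c + K / c, ?_⟩
    intro x c hx hc
    rw [ht, ht]
    field_simp
    ring
  · obtain ⟨Θ, h⟩ := exists_mul_theta_eq_add_of_ne_zero hp hp0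
    refine ⟨fun x => Θ (x ^ 2 * K), fun x => -x * Θ (p * x ^ 2 * K), fun c => Θ (p * c ^ 2 / K),
      fun c => c * Θ (p ^ 2 * c ^ 2 / K), fun x c hx hc => ?_⟩
    rw [h _ _ (mul_ne_zero hx hc) (div_ne_zero (mul_ne_zero hx hK) hc),
      show x * c * (x * K / c) = x ^ 2 * K by field_simp,
      show p * (x * c) / (x * K / c) = p * c ^ 2 / K by field_simp,
      show p * (x * c) * (x * K / c) = p * x ^ 2 * K by field_simp,
      show p ^ 2 * (x * c) / (x * K / c) = p ^ 2 * c ^ 2 / K by field_simp]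
    ring

/-! ### Interpolation -/

/-- Lagrange interpolation for products of `n` linear forms `ℓ i` on the plane, in homogeneous
coordinates: `v` lists `n + 1` pairwise non-proportional vectors. -/
theorem lagrange_linearForms (n : ℕ) (e₀ e₁ : ℕ → ℂ) (s t : ℕ → ℂ)
    (h : ∀ i ≤ n, ∀ j ≤ n, i ≠ j → s i * t j - t i * s j ≠ 0) (x y : ℂ) :
    ∏ i ∈ Finset.range n, (e₀ i * x + e₁ i * y) =
      ∑ m ∈ Finset.range (n + 1), (∏ i ∈ Finset.range n, (e₀ i * s m + e₁ i * t m)) *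
        ∏ l ∈ (Finset.range (n + 1)).erase m,
          ((s l * y - t l * x) / (s l * t m - t l * s m)) := by
  induction n generalizing x y with
  | zero => simp
  | succ n ih =>
    have ih' := ih fun i hi j hj hij => h i (by omega) j (by omega) hij
    -- the factor at `v m` splits along `v (n + 1)` and the evaluation point
    have key : ∀ m ∈ Finset.range (n + 1), e₀ n * x + e₁ n * y =
        (e₀ n * s m + e₁ n * t m) *
            ((s (n + 1) * y - t (n + 1) * x) / (s (n + 1) * t m - t (n + 1) * s m)) +
          (e₀ n * s (n + 1) + e₁ n * t (n + 1)) *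
            ((s m * y - t m * x) / (s m * t (n + 1) - t m * s (n + 1))) := by
      intro m hm
      have hm' : m < n + 1 := Finset.mem_range.1 hm
      have h1 := h (n + 1) le_rfl m (by omega) (by omega)
      rw [show s m * t (n + 1) - t m * s (n + 1) = -(s (n + 1) * t m - t (n + 1) * s m) by ring]
      obtain ⟨D, hD⟩ : ∃ D, D = s (n + 1) * t m - t (n + 1) * s m := ⟨_, rfl⟩
      rw [← hD] at h1 ⊢
      field_simp
      rw [hD]
      ring
    have her : ∀ m ∈ Finset.range (n + 1), (Finset.range (n + 1 + 1)).erase m =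
        insert (n + 1) ((Finset.range (n + 1)).erase m) := by
      intro m hm
      rw [Finset.mem_range] at hm
      ext i
      simp only [Finset.mem_erase, Finset.mem_range, Finset.mem_insert]
      omega
    have hlast : (Finset.range (n + 1 + 1)).erase (n + 1) = Finset.range (n + 1) := by
      ext i
      simp only [Finset.mem_erase, Finset.mem_range]
      omega
    rw [Finset.prod_range_succ, ih' x y, Finset.sum_mul, Finset.sum_range_succ _ (n + 1), hlast,
      Finset.prod_range_succ (fun i => e₀ i * s (n + 1) + e₁ i * t (n + 1)) n,
      ih' (s (n + 1)) (t (n + 1)), Finset.sum_mul, Finset.sum_mul, ← Finset.sum_add_distrib]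
    refine Finset.sum_congr rfl fun m hm => ?_
    rw [her m hm, Finset.prod_insert (by simp), Finset.prod_range_succ _ n,
      ← Finset.mul_prod_erase (Finset.range (n + 1)) _ hm]
    have h3 : (∏ l ∈ (Finset.range (n + 1)).erase m,
          (s l * t (n + 1) - t l * s (n + 1)) / (s l * t m - t l * s m)) *
        ∏ l ∈ (Finset.range (n + 1)).erase m,
          ((s l * y - t l * x) / (s l * t (n + 1) - t l * s (n + 1))) =
        ∏ l ∈ (Finset.range (n + 1)).erase m,
          ((s l * y - t l * x) / (s l * t m - t l * s m)) := by
      rw [← Finset.prod_mul_distrib]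
      refine Finset.prod_congr rfl fun l hl => ?_
      rw [Finset.mem_erase, Finset.mem_range] at hl
      have := h l (by omega) (n + 1) le_rfl (by omega)
      field_simp
    rw [← h3]
    nth_rewrite 1 [key m hm]
    ring

/-- The span of the products of `n` functions `c ↦ θ(x c; p) θ(x K / c; p)`, each of which
is symmetric under `c ↦ K / c`. The values at `c = 0` are irrelevant. -/
def thetaSpan (p K : ℂ) (n : ℕ) : Submodule ℂ (ℂ → ℂ) :=
  Submodule.span ℂ {f | ∃ x : ℕ → ℂ, (∀ i, x i ≠ 0) ∧
    f = fun c => ∏ i ∈ Finset.range n, (theta (x i * c) p * theta (x i * K / c) p)}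

theorem mul_mem_thetaSpan {p K : ℂ} {m n : ℕ} {f g : ℂ → ℂ} (hf : f ∈ thetaSpan p K m)
    (hg : g ∈ thetaSpan p K n) : (fun c => f c * g c) ∈ thetaSpan p K (m + n) := by
  have := Submodule.mul_mem_mul hf hg
  rw [thetaSpan, thetaSpan, Submodule.span_mul_span] at this
  refine Submodule.span_mono ?_ this
  rintro _ ⟨_, ⟨x, hx, rfl⟩, _, ⟨y, hy, rfl⟩, rfl⟩
  refine ⟨fun i => if i < m then x i else y (i - m), fun i => ?_, ?_⟩
  · dsimp only
    split_ifs
    exacts [hx i, hy _]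
  · funext c
    simp only [Pi.mul_apply, Finset.prod_range_add]
    congr 1
    · refine Finset.prod_congr rfl fun i hi => ?_
      rw [if_pos (Finset.mem_range.1 hi)]
    · refine Finset.prod_congr rfl fun i _ => ?_
      rw [if_neg (by omega), Nat.add_sub_cancel_left]

/-- A function in `thetaSpan p K n` vanishing at `n + 1` points that are distinct modulo
`c ↦ K / c` and the zeros of `θ(·; p)` vanishes identically on the punctured plane. -/
theorem eq_zero_of_mem_thetaSpan {p : ℂ} (hp : ‖p‖ < 1) {K : ℂ} (hK : K ≠ 0) {n : ℕ} {f : ℂ → ℂ}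
    (hf : f ∈ thetaSpan p K n) (c : ℕ → ℂ) (hc : ∀ i ≤ n, c i ≠ 0)
    (hne : ∀ i ≤ n, ∀ j ≤ n, i ≠ j →
      theta (c i / c j) p ≠ 0 ∧ theta (K / (c i * c j)) p ≠ 0)
    (h0 : ∀ i ≤ n, f (c i) = 0) (z : ℂ) (hz : z ≠ 0) : f z = 0 := by
  obtain ⟨E₀, E₁, F₀, F₁, hE⟩ := exists_theta_mul_theta_eq hp hK
  have hdet : ∀ i ≤ n, ∀ j ≤ n, i ≠ j →
      F₀ (c i) * F₁ (c j) - F₁ (c i) * F₀ (c j) ≠ 0 := by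
    intro i hi j hj hij hD
    have hci := hc i hi
    have hcj := hc j hj
    -- the linear forms with parameters `1 / c i` and `1 / c j` vanish at `c i`, resp. `c j`, only
    have h1 := hE (c i)⁻¹ (c i) (inv_ne_zero hci) hci
    have h2 := hE (c i)⁻¹ (c j) (inv_ne_zero hci) hcj
    have h3 := hE (c j)⁻¹ (c i) (inv_ne_zero hcj) hci
    have h4 := hE (c j)⁻¹ (c j) (inv_ne_zero hcj) hcj
    rw [inv_mul_cancel₀ hci, theta_one hp, zero_mul] at h1
    rw [inv_mul_cancel₀ hcj, theta_one hp, zero_mul] at h4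
    have hl2 : theta ((c i)⁻¹ * c j) p * theta ((c i)⁻¹ * K / c j) p ≠ 0 := by
      rw [show (c i)⁻¹ * c j = c j / c i by field_simp,
        show (c i)⁻¹ * K / c j = K / (c j * c i) by field_simp]
      exact mul_ne_zero (hne j hj i hi hij.symm).1 (hne j hj i hi hij.symm).2
    have hl3 : theta ((c j)⁻¹ * c i) p * theta ((c j)⁻¹ * K / c i) p ≠ 0 := by
      rw [show (c j)⁻¹ * c i = c i / c j by field_simp,
        show (c j)⁻¹ * K / c i = K / (c i * c j) by field_simp]
      exact mul_ne_zero (hne i hi j hj hij).1 (hne i hi j hj hij).2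
    refine mul_ne_zero hl2 hl3 ?_
    rw [h2, h3]
    linear_combination -(E₀ (c j)⁻¹ * F₀ (c j) + E₁ (c j)⁻¹ * F₁ (c j)) * h1
      - (E₀ (c i)⁻¹ * E₁ (c j)⁻¹ - E₁ (c i)⁻¹ * E₀ (c j)⁻¹) * hD
  have key : ∀ g ∈ thetaSpan p K n, g z = ∑ m ∈ Finset.range (n + 1), g (c m) *
      ∏ l ∈ (Finset.range (n + 1)).erase m,
        ((F₀ (c l) * F₁ z - F₁ (c l) * F₀ z) /
          (F₀ (c l) * F₁ (c m) - F₁ (c l) * F₀ (c m))) := by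
    intro g hg
    induction hg using Submodule.span_induction with
    | mem g hg =>
      obtain ⟨x, hx, rfl⟩ := hg
      have h1 : ∀ c, c ≠ 0 →
          ∏ i ∈ Finset.range n, (theta (x i * c) p * theta (x i * K / c) p) =
            ∏ i ∈ Finset.range n, (E₀ (x i) * F₀ c + E₁ (x i) * F₁ c) := fun c hc =>
        Finset.prod_congr rfl fun i _ => hE _ _ (hx i) hc
      simp only
      rw [h1 z hz, lagrange_linearForms n _ _ (fun m => F₀ (c m)) (fun m => F₁ (c m)) hdet]
      refine Finset.sum_congr rfl fun m hm => ?_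
      rw [h1 _ (hc m (by have := Finset.mem_range.1 hm; omega))]
    | zero => simp
    | add f g _ _ hf hg => simp only [Pi.add_apply, add_mul, Finset.sum_add_distrib, hf, hg]
    | smul a f _ hf => simp only [Pi.smul_apply, smul_eq_mul, hf, Finset.mul_sum, mul_assoc]
  rw [key f hf]
  refine Finset.sum_eq_zero fun m hm => ?_
  rw [h0 m (by have := Finset.mem_range.1 hm; omega), zero_mul]

/-- `eq_zero_of_mem_thetaSpan` for `n` points listed by `c` together with one more point `e`. -/
theorem eq_zero_of_mem_thetaSpan_of_points {p : ℂ} (hp : ‖p‖ < 1) {K : ℂ} (hK : K ≠ 0) {n : ℕ}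
    {f : ℂ → ℂ} (hf : f ∈ thetaSpan p K n) (c : ℕ → ℂ) (e : ℂ) (hc : ∀ i < n, c i ≠ 0)
    (he : e ≠ 0)
    (hcc : ∀ j < n, ∀ i < j, theta (c i / c j) p ≠ 0 ∧ theta (K / (c i * c j)) p ≠ 0)
    (hce : ∀ i < n, theta (c i / e) p ≠ 0 ∧ theta (K / (c i * e)) p ≠ 0)
    (h0 : ∀ i < n, f (c i) = 0) (h1 : f e = 0) (z : ℂ) (hz : z ≠ 0) : f z = 0 := by
  let c' : ℕ → ℂ := fun i => if i < n then c i else e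
  have hlt : ∀ i < n, c' i = c i := fun i hi => if_pos hi
  have hn : c' n = e := if_neg (lt_irrefl n)
  have hc' : ∀ i ≤ n, c' i ≠ 0 := by
    intro i hi
    rcases hi.lt_or_eq with hi | rfl
    · rw [hlt i hi]; exact hc i hi
    · rw [hn]; exact he
  have hord : ∀ j ≤ n, ∀ i < j, theta (c' i / c' j) p ≠ 0 ∧ theta (K / (c' i * c' j)) p ≠ 0 := by
    intro j hj i hi
    rw [hlt i (by omega)]
    rcases hj.lt_or_eq with hj | rfl
    · rw [hlt j hj]; exact hcc j hj i hi
    · rw [hn]; exact hce i hi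
  refine eq_zero_of_mem_thetaSpan hp hK hf c' hc' (fun i hi j hj hij => ?_) (fun i hi => ?_) z hz
  · rcases lt_or_gt_of_ne hij with h | h
    · exact hord j hj i h
    · have := hord i hi j h
      refine ⟨?_, by rw [mul_comm]; exact this.2⟩
      rw [← inv_div]
      exact theta_inv_ne_zero (div_ne_zero (hc' j hj) (hc' i hi)) hp this.1
  · rcases hi.lt_or_eq with hi | rfl
    · rw [hlt i hi]; exact h0 i hi
    · rw [hn]; exact h1

theorem sum_mem_thetaSpan {p K : ℂ} {n : ℕ} {s : Finset ℕ} (A : ℕ → ℂ) (g : ℕ → ℂ → ℂ)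
    (hg : ∀ j ∈ s, g j ∈ thetaSpan p K n) :
    (fun c => ∑ j ∈ s, A j * g j c) ∈ thetaSpan p K n := by
  have : (fun c => ∑ j ∈ s, A j * g j c) = ∑ j ∈ s, A j • g j := by
    funext c
    simp [Finset.sum_apply]
  rw [this]
  exact Submodule.sum_mem _ fun j hj => Submodule.smul_mem _ _ (hg j hj)

theorem thetaFac_mul_thetaFac_mem_thetaSpan (p K : ℂ) {x Q : ℂ} (hx : x ≠ 0) (hQ : Q ≠ 0)
    (k : ℕ) : (fun c => thetaFac (x * c) Q p k * thetaFac (x * K / c) Q p k) ∈ thetaSpan p K k := by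
  refine Submodule.subset_span ⟨fun i => x * Q ^ i, fun i => mul_ne_zero hx (pow_ne_zero i hQ), ?_⟩
  funext c
  simp only [thetaFac, ← Finset.prod_mul_distrib]
  refine Finset.prod_congr rfl fun i _ => ?_
  rw [show x * c * Q ^ i = x * Q ^ i * c by ring, show x * K / c * Q ^ i = x * Q ^ i * K / c by ring]

/-! ### Theta shifted factorials -/

theorem thetaFac_zero (x q p : ℂ) : thetaFac x q p 0 = 1 := rfl

theorem thetaFac_succ (x q p : ℂ) (k : ℕ) :
    thetaFac x q p (k + 1) = thetaFac x q p k * theta (x * q ^ k) p :=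
  Finset.prod_range_succ _ _

theorem thetaFac_add (x q p : ℂ) (m n : ℕ) :
    thetaFac x q p (m + n) = thetaFac x q p m * thetaFac (x * q ^ m) q p n := by
  simp only [thetaFac, Finset.prod_range_add, pow_add, mul_assoc]

theorem thetaFac_succ' (x q p : ℂ) (k : ℕ) :
    thetaFac x q p (k + 1) = theta x p * thetaFac (x * q) q p k := by
  rw [add_comm, thetaFac_add, pow_one]
  simp [thetaFac]

theorem thetaFac_mul_shift {q : ℂ} (x p : ℂ) {k n : ℕ} (h : k ≤ n) :
    thetaFac x q p k * thetaFac (x * q ^ k) q p (n - k) = thetaFac x q p n := by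
  rw [← thetaFac_add, Nat.add_sub_cancel' h]

theorem thetaFac_mul_comm (x q p : ℂ) (m n : ℕ) :
    thetaFac x q p m * thetaFac (x * q ^ m) q p n =
      thetaFac x q p n * thetaFac (x * q ^ n) q p m := by
  rw [← thetaFac_add, ← thetaFac_add, add_comm]

theorem thetaFac_two_mul (x q p : ℂ) (n : ℕ) :
    thetaFac x q p (2 * n) = thetaFac x (q ^ 2) p n * thetaFac (x * q) (q ^ 2) p n := by
  induction n with
  | zero => simp [thetaFac]
  | succ n ih =>
    rw [mul_add, mul_one, thetaFac_succ, thetaFac_succ, ih, thetaFac_succ, thetaFac_succ,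
      show x * q ^ (2 * n + 1) = x * q * (q ^ 2) ^ n by ring,
      show x * q ^ (2 * n) = x * (q ^ 2) ^ n by ring]
    ring

/-- Reversing the order of the factors: `(q ^ (1 - n) / x)_n` in terms of `(x)_n`. -/
theorem thetaFac_reverse {p : ℂ} (hp : ‖p‖ < 1) {x y q : ℂ} (hx : x ≠ 0) (hq : q ≠ 0) {n : ℕ}
    (h : y * x * q ^ n = q) :
    thetaFac y q p n * ((-x) ^ n * q ^ n.choose 2) = thetaFac x q p n := by
  have h1 : (-x) ^ n * q ^ n.choose 2 = ∏ j ∈ Finset.range n, -(x * q ^ j) := by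
    clear h
    induction n with
    | zero => simp
    | succ n ih =>
      rw [Finset.prod_range_succ, ← ih, Nat.choose_succ_succ', Nat.choose_one_right]
      ring
  rw [h1, thetaFac, thetaFac, ← Finset.prod_range_reflect, ← Finset.prod_mul_distrib]
  refine Finset.prod_congr rfl fun j hj => ?_
  have hxj : x * q ^ j ≠ 0 := mul_ne_zero hx (pow_ne_zero j hq)
  rw [Finset.mem_range] at hj
  obtain ⟨r, rfl⟩ : ∃ r, n = j + 1 + r := ⟨n - (j + 1), by omega⟩
  have h2 : y * q ^ (j + 1 + r - 1 - j) = (x * q ^ j)⁻¹ := by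
    rw [show j + 1 + r - 1 - j = r by omega]
    refine eq_inv_of_mul_eq_one_left (mul_left_cancel₀ hq ?_)
    linear_combination h
  rw [h2, theta_inv hxj hp]
  field_simp

theorem thetaFac_eq_zero {p : ℂ} (hp : ‖p‖ < 1) {x q : ℂ} {i k : ℕ} (hi : i < k)
    (h : x * q ^ i = 1) : thetaFac x q p k = 0 :=
  Finset.prod_eq_zero (Finset.mem_range.2 hi) (by rw [h, theta_one hp])

theorem thetaFac_ne_zero_iff {x q p : ℂ} {k : ℕ} :
    thetaFac x q p k ≠ 0 ↔ ∀ i < k, theta (x * q ^ i) p ≠ 0 := by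
  simp [thetaFac, Finset.prod_ne_zero_iff]

theorem thetaFac_ne_zero_of_le {x q p : ℂ} {k n : ℕ} (hk : k ≤ n) (h : thetaFac x q p n ≠ 0) :
    thetaFac x q p k ≠ 0 :=
  thetaFac_ne_zero_iff.2 fun i hi => thetaFac_ne_zero_iff.1 h i (hi.trans_le hk)

/-! ### Generic parameters -/

/-- `x` is nonzero and no `q ^ i * x` with `i ∈ ℤ` is a zero of the theta function. -/
def Generic (q p x : ℂ) : Prop := x ≠ 0 ∧ ∀ i : ℤ, theta (x * q ^ i) p ≠ 0

theorem Generic.of_eq_mul_zpow {q p x y : ℂ} (hq : q ≠ 0) (h : Generic q p x) (i : ℤ)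
    (hy : y = x * q ^ i) : Generic q p y := by
  subst hy
  refine ⟨mul_ne_zero h.1 (zpow_ne_zero _ hq), fun j => ?_⟩
  rw [mul_assoc, ← zpow_add₀ hq]
  exact h.2 _

theorem Generic.inv {q p x : ℂ} (hp : ‖p‖ < 1) (hq : q ≠ 0) (h : Generic q p x) :
    Generic q p x⁻¹ := by
  refine ⟨inv_ne_zero h.1, fun j => ?_⟩
  have := theta_inv_ne_zero (mul_ne_zero h.1 (zpow_ne_zero (-j) hq)) hp (h.2 (-j))
  rwa [mul_inv, ← zpow_neg, neg_neg] at this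

theorem Generic.theta_ne_zero {q p x : ℂ} (h : Generic q p x) : theta x p ≠ 0 := by
  simpa using h.2 0

theorem Generic.thetaFac_ne_zero {q p x : ℂ} (h : Generic q p x) (k : ℕ) :
    thetaFac x q p k ≠ 0 :=
  thetaFac_ne_zero_iff.2 fun i _ => by simpa using h.2 i

/-- None of `q, q ^ 2, …, q ^ N` is a zero of the theta function. -/
def GenericBase (q p : ℂ) (N : ℕ) : Prop := ∀ i, 1 ≤ i → i ≤ N → theta (q ^ i) p ≠ 0

theorem GenericBase.mono {q p : ℂ} {M N : ℕ} (h : GenericBase q p N) (hM : M ≤ N) :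
    GenericBase q p M := fun i hi hi' => h i hi (hi'.trans hM)

theorem GenericBase.thetaFac_ne_zero {q p : ℂ} {N : ℕ} (h : GenericBase q p N) {m k : ℕ}
    (hm : 1 ≤ m) (hmk : m + k ≤ N + 1) : thetaFac (q ^ m) q p k ≠ 0 :=
  thetaFac_ne_zero_iff.2 fun i hi => by
    rw [← pow_add]
    exact h _ (by omega) (by omega)

theorem GenericBase.thetaFac_sq_ne_zero {q p : ℂ} {N : ℕ} (h : GenericBase q p N) {k : ℕ}
    (hk : 2 * k ≤ N) : thetaFac (q ^ 2) (q ^ 2) p k ≠ 0 :=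
  thetaFac_ne_zero_iff.2 fun i hi => by
    rw [← pow_mul, ← pow_add]
    exact h _ (by omega) (by omega)

theorem GenericBase.thetaFac_inv_ne_zero {p : ℂ} (hp : ‖p‖ < 1) {q : ℂ} (hq : q ≠ 0) {N : ℕ}
    (h : GenericBase q p N) {m k : ℕ} (hkm : k ≤ m) (hm : m ≤ N) :
    thetaFac (q ^ m)⁻¹ q p k ≠ 0 :=
  thetaFac_ne_zero_iff.2 fun i hi => by
    obtain ⟨r, rfl⟩ : ∃ r, m = i + (r + 1) := ⟨m - i - 1, by omega⟩
    rw [show (q ^ (i + (r + 1)))⁻¹ * q ^ i = (q ^ (r + 1))⁻¹ by rw [pow_add]; field_simp]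
    exact theta_inv_ne_zero (pow_ne_zero _ hq) hp (h _ (by omega) (by omega))

/-! ### A quadratic summation -/

/-- The weight `θ(a q ^ 2j) (a²; q²)_j (-a)^j / (θ(a) (q²; q²)_j)`. -/
noncomputable def quadWeight (a q p : ℂ) (j : ℕ) : ℂ :=
  theta (a * q ^ (2 * j)) p / theta a p *
    (thetaFac (a ^ 2) (q ^ 2) p j / thetaFac (q ^ 2) (q ^ 2) p j) * (-a) ^ j

/-- The left-hand side of the quadratic summation, multiplied by `(a d, a q / d)_n`. -/
noncomputable def quadSum (n : ℕ) (a d q p : ℂ) : ℂ :=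
  ∑ j ∈ Finset.range (n + 1), quadWeight a q p j *
      (thetaFac (q ^ (n + 1)) q p j * thetaFac (q ^ n)⁻¹ q p j /
        (thetaFac (a / q ^ n) q p j * thetaFac (a * q ^ (n + 1)) q p j)) *
    ((thetaFac (1 * d) q p j * thetaFac (1 * q / d) q p j) *
      (thetaFac (a * q ^ j * d) q p (n - j) * thetaFac (a * q ^ j * q / d) q p (n - j)))

/-- The right-hand side of the quadratic summation, multiplied by `(a d, a q / d)_n`. -/
noncomputable def quadProd (n : ℕ) (a d q p : ℂ) : ℂ :=
  thetaFac (a * q) q p n / thetaFac (a / q ^ n) q p n *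
    (thetaFac (a / q ^ n * d) (q ^ 2) p n * thetaFac (a / q ^ n * q / d) (q ^ 2) p n)

theorem quadSum_sub_quadProd_mem {a q : ℂ} (p : ℂ) (ha : a ≠ 0) (hq : q ≠ 0) (n : ℕ) :
    (fun d => quadSum n a d q p - quadProd n a d q p) ∈ thetaSpan p q n := by
  refine Submodule.sub_mem _ (sum_mem_thetaSpan _ _ fun j hj => ?_) (Submodule.smul_mem _ _
    (thetaFac_mul_thetaFac_mem_thetaSpan p q (div_ne_zero ha (pow_ne_zero n hq))
      (pow_ne_zero 2 hq) n))
  have hjn : j ≤ n := Nat.lt_succ_iff.1 (Finset.mem_range.1 hj)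
  have := mul_mem_thetaSpan (thetaFac_mul_thetaFac_mem_thetaSpan p q one_ne_zero hq j)
    (thetaFac_mul_thetaFac_mem_thetaSpan p q (mul_ne_zero ha (pow_ne_zero j hq)) hq (n - j))
  rwa [Nat.add_sub_cancel' hjn] at this

/-- At `d = q ^ (-m)` the sum with `n` and the sum with `n` and `m` interchanged are
proportional. -/
theorem quadSum_swap {p : ℂ} (hp : ‖p‖ < 1) {a q : ℂ} (hq : q ≠ 0) (ha : Generic q p a) {m n : ℕ}
    (hmn : m < n) :
    quadSum n a (q ^ m)⁻¹ q p * (thetaFac (a / q ^ n) q p m * thetaFac (a * q ^ (n + 1)) q p m) =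
      quadSum m a (q ^ n)⁻¹ q p *
        (thetaFac (a / q ^ m) q p n * thetaFac (a * q ^ (m + 1)) q p n) := by
  have hneg : ∀ k l, thetaFac (a / q ^ k) q p l ≠ 0 := fun k l =>
    (ha.of_eq_mul_zpow hq (-k) (by rw [zpow_neg, zpow_natCast]; field_simp)).thetaFac_ne_zero l
  have hpos : ∀ k l, thetaFac (a * q ^ k) q p l ≠ 0 := fun k l =>
    (ha.of_eq_mul_zpow hq k (by rw [zpow_natCast])).thetaFac_ne_zero l
  have htrunc : quadSum n a (q ^ m)⁻¹ q p = ∑ j ∈ Finset.range (m + 1), quadWeight a q p j *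
      (thetaFac (q ^ (n + 1)) q p j * thetaFac (q ^ n)⁻¹ q p j /
        (thetaFac (a / q ^ n) q p j * thetaFac (a * q ^ (n + 1)) q p j)) *
      ((thetaFac (1 * (q ^ m)⁻¹) q p j * thetaFac (1 * q / (q ^ m)⁻¹) q p j) *
        (thetaFac (a * q ^ j * (q ^ m)⁻¹) q p (n - j) *
          thetaFac (a * q ^ j * q / (q ^ m)⁻¹) q p (n - j))) := by
    refine (Finset.sum_subset (Finset.range_subset_range.2 (by omega)) fun j _ hj => ?_).symm
    rw [Finset.mem_range, not_lt] at hj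
    rw [thetaFac_eq_zero hp (x := 1 * (q ^ m)⁻¹) (show m < j by omega) (by field_simp)]
    ring
  rw [htrunc, quadSum, Finset.sum_mul, Finset.sum_mul]
  refine Finset.sum_congr rfl fun j hj => ?_
  have hjm : j ≤ m := Nat.lt_succ_iff.1 (Finset.mem_range.1 hj)
  have hs : ∀ k l, j ≤ l → thetaFac (a * q ^ j * (q ^ k)⁻¹) q p (l - j) =
      thetaFac (a / q ^ k) q p l / thetaFac (a / q ^ k) q p j := by
    intro k l hl
    rw [eq_div_iff (hneg _ _), mul_comm, ← thetaFac_mul_shift (a / q ^ k) p hl]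
    congr 2
    field_simp
  have hs' : ∀ k l, j ≤ l → thetaFac (a * q ^ j * q / (q ^ k)⁻¹) q p (l - j) =
      thetaFac (a * q ^ (k + 1)) q p l / thetaFac (a * q ^ (k + 1)) q p j := by
    intro k l hl
    rw [eq_div_iff (hpos _ _), mul_comm, ← thetaFac_mul_shift (a * q ^ (k + 1)) p hl]
    congr 2
    field_simp
    ring
  have hq1 : ∀ k, 1 * q / (q ^ k)⁻¹ = q ^ (k + 1) := fun k => by field_simp; ring
  rw [hs m n (by omega), hs' m n (by omega), hs n m hjm, hs' n m hjm, hq1, hq1, one_mul, one_mul]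
  have := hneg n j
  have := hneg m j
  have := hpos (n + 1) j
  have := hpos (m + 1) j
  field_simp

/-- The counterpart of `quadSum_swap` for the product side, with the same factors. -/
theorem quadProd_swap {p : ℂ} {a q : ℂ} (hq : q ≠ 0) (ha : Generic q p a) {m n : ℕ}
    (hmn : m < n) :
    quadProd n a (q ^ m)⁻¹ q p * (thetaFac (a / q ^ n) q p m * thetaFac (a * q ^ (n + 1)) q p m) =
      quadProd m a (q ^ n)⁻¹ q p *
        (thetaFac (a / q ^ m) q p n * thetaFac (a * q ^ (m + 1)) q p n) := by
  have hneg : ∀ k l, thetaFac (a / q ^ k) q p l ≠ 0 := fun k l =>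
    (ha.of_eq_mul_zpow hq (-k) (by rw [zpow_neg, zpow_natCast]; field_simp)).thetaFac_ne_zero l
  obtain ⟨r, rfl⟩ : ∃ r, n = m + r := ⟨n - m, by omega⟩
  have e1 : thetaFac (a / q ^ (m + r) * (q ^ m)⁻¹) (q ^ 2) p (m + r) =
      thetaFac (a / q ^ (m + r) * (q ^ m)⁻¹) (q ^ 2) p m * thetaFac (a / q ^ r) (q ^ 2) p r := by
    rw [thetaFac_add]
    congr 2
    rw [pow_add, ← pow_mul]; field_simp; ring
  have e2 : thetaFac (a / q ^ (m + r) * q / (q ^ m)⁻¹) (q ^ 2) p (m + r) =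
      thetaFac (a / q ^ r * q) (q ^ 2) p r * thetaFac (a * q * q ^ r) (q ^ 2) p m := by
    rw [add_comm m r, thetaFac_add]
    congr 2
    · rw [pow_add]; field_simp
    · rw [pow_add, ← pow_mul]; field_simp; ring
  have e3 : thetaFac (a / q ^ r) (q ^ 2) p r * thetaFac (a / q ^ r * q) (q ^ 2) p r =
      thetaFac (a / q ^ r) q p r * thetaFac a q p r := by
    rw [← thetaFac_two_mul, two_mul, thetaFac_add]
    congr 2
    field_simp
  have e4 : thetaFac (a * q) q p (m + r) * thetaFac (a * q ^ (m + r + 1)) q p m =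
      thetaFac (a * q) q p m * thetaFac (a * q ^ (m + 1)) q p (m + r) := by
    have := thetaFac_mul_comm (a * q) q p (m + r) m
    rwa [show a * q * q ^ (m + r) = a * q ^ (m + r + 1) by ring,
      show a * q * q ^ m = a * q ^ (m + 1) by ring] at this
  have e5 : thetaFac (a / q ^ (m + r)) q p (m + r) =
      thetaFac (a / q ^ (m + r)) q p m * thetaFac (a / q ^ r) q p r := by
    rw [thetaFac_add]
    congr 2
    rw [pow_add]; field_simp
  have e6 : thetaFac (a / q ^ m) q p (m + r) =
      thetaFac (a / q ^ m) q p m * thetaFac a q p r := by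
    rw [thetaFac_add]
    congr 2
    field_simp
  have e7 : a / q ^ m * (q ^ (m + r))⁻¹ = a / q ^ (m + r) * (q ^ m)⁻¹ := by field_simp
  have e8 : a / q ^ m * q / (q ^ (m + r))⁻¹ = a * q * q ^ r := by rw [pow_add]; field_simp
  rw [quadProd, quadProd, e1, e2, e5, e6, e7, e8]
  have h1 := hneg (m + r) m
  have h2 := hneg r r
  have h3 := hneg m m
  generalize thetaFac (a / q ^ (m + r) * (q ^ m)⁻¹) (q ^ 2) p m = A
  generalize thetaFac (a * q * q ^ r) (q ^ 2) p m = B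
  generalize thetaFac (a / q ^ r) (q ^ 2) p r = F at e3 ⊢
  generalize thetaFac (a / q ^ r * q) (q ^ 2) p r = G at e3 ⊢
  generalize thetaFac (a / q ^ r) q p r = H at e3 h2 ⊢
  generalize thetaFac (a / q ^ (m + r)) q p m = I at h1 ⊢
  generalize thetaFac (a / q ^ m) q p m = J at h3 ⊢
  field_simp
  linear_combination A * B * thetaFac (a * q) q p (m + r) *
    thetaFac (a * q ^ (m + r + 1)) q p m * e3 + A * B * H * thetaFac a q p r * e4

/-- At `d = q ^ (1 - n) / a` only the last term of the sum survives. -/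
theorem quadSum_eq_quadProd_of_eq {p : ℂ} (hp : ‖p‖ < 1) {a q : ℂ} (hq : q ≠ 0)
    (ha : Generic q p a) {n : ℕ} (hQ : GenericBase q p (2 * n + 1)) :
    quadSum n a (q / (q ^ n * a)) q p = quadProd n a (q / (q ^ n * a)) q p := by
  have ha0 := ha.1
  have hneg : ∀ k l, thetaFac (a / q ^ k) q p l ≠ 0 := fun k l =>
    (ha.of_eq_mul_zpow hq (-k) (by rw [zpow_neg, zpow_natCast]; field_simp)).thetaFac_ne_zero l
  have hpos : ∀ k l, thetaFac (a * q ^ k) q p l ≠ 0 := fun k l =>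
    (ha.of_eq_mul_zpow hq k (by rw [zpow_natCast])).thetaFac_ne_zero l
  have hθ := ha.theta_ne_zero
  have hq2 := hQ.thetaFac_sq_ne_zero (k := n) (by omega)
  rw [quadSum, Finset.sum_range_succ, Finset.sum_eq_zero, zero_add, quadProd, quadWeight,
    Nat.sub_self, thetaFac_zero, thetaFac_zero, one_mul, one_mul,
    show q / (q / (q ^ n * a)) = a * q ^ n by field_simp,
    show a / q ^ n * (q / (q ^ n * a)) = q / (q ^ n * q ^ n) by field_simp,
    show a / q ^ n * q / (q / (q ^ n * a)) = a ^ 2 by field_simp]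
  · have e1 : thetaFac (a * q ^ n) q p n * theta (a * q ^ (2 * n)) p =
        theta (a * q ^ n) p * thetaFac (a * q ^ (n + 1)) q p n := by
      have := thetaFac_succ' (a * q ^ n) q p n
      rwa [thetaFac_succ, show a * q ^ n * q ^ n = a * q ^ (2 * n) by ring,
        show a * q ^ n * q = a * q ^ (n + 1) by ring] at this
    have e2 : thetaFac a q p n * theta (a * q ^ n) p = theta a p * thetaFac (a * q) q p n := by
      rw [← thetaFac_succ, thetaFac_succ']
    have e3 := thetaFac_reverse hp (x := a) (y := q / (q ^ n * a)) ha0 hq (n := n) (by field_simp)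
    have e4 := thetaFac_reverse hp (x := q) (y := (q ^ n)⁻¹) hq hq (n := n) (by field_simp)
    have e5 := thetaFac_reverse hp (x := q) (y := q / (q ^ n * q ^ n)) hq (pow_ne_zero 2 hq)
      (n := n) (by rw [← pow_mul, mul_comm 2 n, pow_mul]; field_simp)
    have e6 : thetaFac q q p n * thetaFac (q ^ (n + 1)) q p n =
        thetaFac q (q ^ 2) p n * thetaFac (q ^ 2) (q ^ 2) p n := by
      have := thetaFac_two_mul q q p n
      rwa [two_mul, thetaFac_add, show q * q ^ n = q ^ (n + 1) by ring,
        show q * q = q ^ 2 by ring] at this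
    have h1 := hneg n n
    have h2 := hpos (n + 1) n
    have hqn : (-q) ^ n ≠ 0 := pow_ne_zero _ (neg_ne_zero.2 hq)
    have hqc : q ^ n.choose 2 ≠ 0 := pow_ne_zero _ hq
    rw [← pow_mul, mul_comm 2, pow_mul] at e5
    rw [← e4, ← e5] at e6
    rw [← e3] at e2
    obtain ⟨C, hC⟩ : ∃ C, C = q ^ n.choose 2 := ⟨_, rfl⟩
    obtain ⟨D, hD⟩ : ∃ D, D = (-q) ^ n := ⟨_, rfl⟩
    rw [← hC] at e2 e6 hqc
    rw [← hD] at e6 hqn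
    have e7 : thetaFac (q ^ n)⁻¹ q p n * thetaFac (q ^ (n + 1)) q p n =
        thetaFac (q / (q ^ n * q ^ n)) (q ^ 2) p n * C * thetaFac (q ^ 2) (q ^ 2) p n := by
      refine mul_right_cancel₀ (mul_ne_zero hqn hqc) ?_
      linear_combination e6
    generalize thetaFac (q / (q ^ n * q ^ n)) (q ^ 2) p n = V at e7 ⊢
    generalize thetaFac (q / (q ^ n * a)) q p n = Z at e2 ⊢
    generalize thetaFac (q ^ n)⁻¹ q p n = Y at e7 ⊢
    generalize thetaFac (a / q ^ n) q p n = N at h1 ⊢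
    generalize thetaFac (a * q ^ (n + 1)) q p n = M at e1 h2 ⊢
    generalize thetaFac (q ^ 2) (q ^ 2) p n = Q₂ at e7 hq2 ⊢
    generalize thetaFac (a ^ 2) (q ^ 2) p n = A₂
    field_simp
    linear_combination A₂ * (-a) ^ n * thetaFac (q ^ (n + 1)) q p n * Y * Z * e1 +
      theta (a * q ^ n) p * M * A₂ * (-a) ^ n * Z * e7 + A₂ * V * Q₂ * M * e2
  · intro j hj
    rw [Finset.mem_range] at hj
    obtain ⟨r, rfl⟩ : ∃ r, n = j + 1 + r := ⟨n - (j + 1), by omega⟩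
    rw [thetaFac_eq_zero hp (x := a * q ^ j * (q / (q ^ (j + 1 + r) * a))) (i := r) (by omega)
      (by rw [pow_add, pow_succ]; field_simp)]
    ring

/-- An elliptic quadratic summation, with the denominators depending on `d` cleared, by
interpolation in `d`. -/
theorem quadSum_eq_quadProd {p : ℂ} (hp : ‖p‖ < 1) {a q : ℂ} (hq : q ≠ 0)
    (ha : Generic q p a) {n : ℕ} (hQ : GenericBase q p (2 * n + 1)) {d : ℂ} (hd : d ≠ 0) :
    quadSum n a d q p = quadProd n a d q p := by
  induction n using Nat.strong_induction_on generalizing d with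
  | _ n ih =>
    have ha0 := ha.1
    rw [← sub_eq_zero]
    refine eq_zero_of_mem_thetaSpan_of_points hp hq (quadSum_sub_quadProd_mem p ha0 hq n)
      (fun i => (q ^ i)⁻¹) (q / (q ^ n * a)) (fun i _ => inv_ne_zero (pow_ne_zero i hq))
      (div_ne_zero hq (mul_ne_zero (pow_ne_zero n hq) ha0)) ?_ ?_ ?_
      (sub_eq_zero.2 (quadSum_eq_quadProd_of_eq hp hq ha hQ)) d hd
    · intro j hj i hi
      obtain ⟨r, rfl⟩ : ∃ r, j = i + (r + 1) := ⟨j - i - 1, by omega⟩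
      constructor
      · rw [show (q ^ i)⁻¹ / (q ^ (i + (r + 1)))⁻¹ = q ^ (r + 1) by rw [pow_add]; field_simp]
        exact hQ _ (by omega) (by omega)
      · rw [show q / ((q ^ i)⁻¹ * (q ^ (i + (r + 1)))⁻¹) = q ^ (i + i + r + 1 + 1) by
          field_simp; ring]
        exact hQ _ (by omega) (by omega)
    · intro i hi
      obtain ⟨r, rfl⟩ : ∃ r, n = i + (r + 1) := ⟨n - i - 1, by omega⟩
      constructor
      · rw [show (q ^ i)⁻¹ / (q / (q ^ (i + (r + 1)) * a)) = a * q ^ (r : ℤ) by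
          rw [zpow_natCast, pow_add, pow_succ]; field_simp]
        exact ha.2 _
      · rw [show q / ((q ^ i)⁻¹ * (q / (q ^ (i + (r + 1)) * a))) =
          a * q ^ ((i + i + (r + 1) : ℕ) : ℤ) by
          rw [zpow_natCast, pow_add, pow_add, pow_add]; field_simp; ring]
        exact ha.2 _
    · intro i hi
      have h1 := quadSum_swap hp hq ha hi
      have h2 := quadProd_swap hq ha hi
      rw [ih i hi (hQ.mono (by omega)) (inv_ne_zero (pow_ne_zero n hq)), ← h2] at h1
      refine sub_eq_zero.2 (mul_right_cancel₀ (mul_ne_zero ?_ ?_) h1)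
      · exact (ha.of_eq_mul_zpow hq (-n) (by
          rw [zpow_neg, zpow_natCast]; field_simp)).thetaFac_ne_zero _
      · exact (ha.of_eq_mul_zpow hq (n + 1 : ℕ) (by rw [zpow_natCast])).thetaFac_ne_zero _

/-! ### The change of base parameter -/

/-- The sum over `u`, multiplied by the denominators `(b c / q, a q / c)_n` depending on `c`. -/
noncomputable def baileyLeft (n : ℕ) (a b c q p : ℂ) (u : ℕ → ℂ) : ℂ :=
  ∑ j ∈ Finset.range (n + 1), u j *
      (thetaFac (b * q ^ n) q p j * thetaFac (q ^ n)⁻¹ q p j /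
        (thetaFac (a * q / (q ^ n * b)) q p j * thetaFac (a * q ^ (n + 1)) q p j)) *
    ((thetaFac (1 * c) q p j * thetaFac (1 * (a * q ^ 2 / b) / c) q p j) *
      (thetaFac (b / q * q ^ j * c) q p (n - j) *
        thetaFac (b / q * q ^ j * (a * q ^ 2 / b) / c) q p (n - j)))

/-- The part of the factor in front of the sum over `v` that does not depend on `c`. -/
noncomputable def baileyFactor (n : ℕ) (a b q p : ℂ) : ℂ :=
  thetaFac (a * q) q p n * thetaFac (b / q) q p n /
    (thetaFac (q ^ 2) q p n * thetaFac (b / a) q p n)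

/-- The sum over `v`, multiplied by the denominators `(q² / c, b c / a)_n` depending on `c`. -/
noncomputable def baileyRight (n : ℕ) (a b c q p : ℂ) (v : ℕ → ℂ) : ℂ :=
  ∑ k ∈ Finset.range (n + 1), v k * (theta (q ^ (2 * k + 1)) p / theta q p *
      (thetaFac (b * q ^ n) q p k * thetaFac (q ^ n)⁻¹ q p k /
        (thetaFac (q ^ 2 / (q ^ n * b)) q p k * thetaFac (q ^ (n + 2)) q p k)) * (-(q / a)) ^ k) *
    ((thetaFac (1 * c) q p k * thetaFac (1 * (a * q ^ 2 / b) / c) q p k) *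
      (thetaFac (b / a * q ^ k * c) q p (n - k) *
        thetaFac (b / a * q ^ k * (a * q ^ 2 / b) / c) q p (n - k)))

/-- Up to explicit factors, `v m` is the very-well-poised sum of `u` with upper index `m` and
`b = q`, in which the factors depending on `c` cancel. -/
def IsBaileyPair (n : ℕ) (a q p : ℂ) (u v : ℕ → ℂ) : Prop :=
  ∀ m ≤ n, ∑ j ∈ Finset.range (m + 1), u j *
      (thetaFac (q ^ (m + 1)) q p j * thetaFac (q ^ m)⁻¹ q p j /
        (thetaFac (a / q ^ m) q p j * thetaFac (a * q ^ (m + 1)) q p j)) =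
    thetaFac (a * q) q p m / (thetaFac (a / q ^ m) q p m * q ^ (m + 1).choose 2) * v m

theorem baileyLeft_sub_baileyRight_mem {a b q : ℂ} (p : ℂ) (ha : a ≠ 0) (hb : b ≠ 0) (hq : q ≠ 0)
    (n : ℕ) (u v : ℕ → ℂ) :
    (fun c => baileyLeft n a b c q p u - baileyFactor n a b q p * baileyRight n a b c q p v) ∈
      thetaSpan p (a * q ^ 2 / b) n := by
  have hmem : ∀ (x : ℂ), x ≠ 0 → ∀ j ∈ Finset.range (n + 1),
      (fun c => (thetaFac (1 * c) q p j * thetaFac (1 * (a * q ^ 2 / b) / c) q p j) *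
        (thetaFac (x * q ^ j * c) q p (n - j) *
          thetaFac (x * q ^ j * (a * q ^ 2 / b) / c) q p (n - j))) ∈
      thetaSpan p (a * q ^ 2 / b) n := by
    intro x hx j hj
    have hjn : j ≤ n := Nat.lt_succ_iff.1 (Finset.mem_range.1 hj)
    have := mul_mem_thetaSpan
      (thetaFac_mul_thetaFac_mem_thetaSpan p (a * q ^ 2 / b) one_ne_zero hq j)
      (thetaFac_mul_thetaFac_mem_thetaSpan p (a * q ^ 2 / b)
        (mul_ne_zero hx (pow_ne_zero j hq)) hq (n - j))
    rwa [Nat.add_sub_cancel' hjn] at this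
  exact Submodule.sub_mem _ (sum_mem_thetaSpan _ _ (hmem _ (div_ne_zero hb hq)))
    (Submodule.smul_mem _ _ (sum_mem_thetaSpan _ _ (hmem _ (div_ne_zero hb ha))))

/-- At `c = q ^ (-m)` the sum over `u` is proportional to the one with `n` and `m` interchanged and
`b` replaced by `a q² / b`. -/
theorem baileyLeft_swap {p : ℂ} (hp : ‖p‖ < 1) {a b q : ℂ} (hq : q ≠ 0) (ha : Generic q p a)
    (hb : Generic q p b) (hba : Generic q p (b / a)) {m n : ℕ} (hmn : m < n) (u : ℕ → ℂ) :
    baileyLeft n a b (q ^ m)⁻¹ q p u *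
        (thetaFac (a * q / (q ^ n * b)) q p m * thetaFac (a * q ^ (n + 1)) q p m) =
      baileyLeft m a (a * q ^ 2 / b) (q ^ n)⁻¹ q p u *
        (thetaFac (b / (q * q ^ m)) q p n * thetaFac (a * q ^ (m + 1)) q p n) := by
  have ha0 := ha.1
  have hb0 := hb.1
  have hpos : ∀ k l, thetaFac (a * q ^ k) q p l ≠ 0 := fun k l =>
    (ha.of_eq_mul_zpow hq k (by rw [zpow_natCast])).thetaFac_ne_zero l
  have hbneg : ∀ k l, thetaFac (b / (q * q ^ k)) q p l ≠ 0 := fun k l =>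
    (hb.of_eq_mul_zpow hq (-(k + 1 : ℕ)) (by
      rw [zpow_neg, zpow_natCast]; field_simp; ring)).thetaFac_ne_zero l
  have hab : ∀ k l, thetaFac (a * q / (q ^ k * b)) q p l ≠ 0 := fun k l =>
    ((hba.inv hp hq).of_eq_mul_zpow hq (1 - k) (by
      rw [zpow_sub₀ hq, zpow_natCast, zpow_one]; field_simp)).thetaFac_ne_zero l
  have htrunc : baileyLeft n a b (q ^ m)⁻¹ q p u = ∑ j ∈ Finset.range (m + 1), u j *
      (thetaFac (b * q ^ n) q p j * thetaFac (q ^ n)⁻¹ q p j /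
        (thetaFac (a * q / (q ^ n * b)) q p j * thetaFac (a * q ^ (n + 1)) q p j)) *
      ((thetaFac (1 * (q ^ m)⁻¹) q p j * thetaFac (1 * (a * q ^ 2 / b) / (q ^ m)⁻¹) q p j) *
        (thetaFac (b / q * q ^ j * (q ^ m)⁻¹) q p (n - j) *
          thetaFac (b / q * q ^ j * (a * q ^ 2 / b) / (q ^ m)⁻¹) q p (n - j))) := by
    refine (Finset.sum_subset (Finset.range_subset_range.2 (by omega)) fun j _ hj => ?_).symm
    rw [Finset.mem_range, not_lt] at hj
    rw [thetaFac_eq_zero hp (x := 1 * (q ^ m)⁻¹) (show m < j by omega) (by field_simp)]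
    ring
  rw [htrunc, baileyLeft, Finset.sum_mul, Finset.sum_mul]
  refine Finset.sum_congr rfl fun j hj => ?_
  have hjm : j ≤ m := Nat.lt_succ_iff.1 (Finset.mem_range.1 hj)
  have h1 : thetaFac (b / q * q ^ j * (q ^ m)⁻¹) q p (n - j) =
      thetaFac (b / (q * q ^ m)) q p n / thetaFac (b / (q * q ^ m)) q p j := by
    rw [eq_div_iff (hbneg _ _), mul_comm,
      ← thetaFac_mul_shift (b / (q * q ^ m)) p (show j ≤ n by omega)]
    congr 2
    field_simp
  have h2 : thetaFac (a * q ^ 2 / b / q * q ^ j * (q ^ n)⁻¹) q p (m - j) =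
      thetaFac (a * q / (q ^ n * b)) q p m / thetaFac (a * q / (q ^ n * b)) q p j := by
    rw [eq_div_iff (hab _ _), mul_comm, ← thetaFac_mul_shift (a * q / (q ^ n * b)) p hjm]
    congr 2
    field_simp
  have h3 : ∀ k l, ∀ B : ℂ, B ≠ 0 → j ≤ l →
      thetaFac (B / q * q ^ j * (a * q ^ 2 / B) / (q ^ k)⁻¹) q p (l - j) =
      thetaFac (a * q ^ (k + 1)) q p l / thetaFac (a * q ^ (k + 1)) q p j := by
    intro k l B hB hl
    rw [eq_div_iff (hpos _ _), mul_comm, ← thetaFac_mul_shift (a * q ^ (k + 1)) p hl]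
    congr 2
    field_simp
    ring
  rw [h1, h2, h3 m n b hb0 (by omega), h3 n m _ (by positivity) hjm]
  simp only [one_mul]
  rw [show a * q ^ 2 / b / (q ^ m)⁻¹ = a * q ^ 2 / b * q ^ m by field_simp,
    show a * q ^ 2 / (a * q ^ 2 / b) / (q ^ n)⁻¹ = b * q ^ n by field_simp,
    show a * q / (q ^ m * (a * q ^ 2 / b)) = b / (q * q ^ m) by field_simp]
  have g1 := hab n j
  have g2 := hbneg m j
  have g3 := hpos (n + 1) j
  have g4 := hpos (m + 1) j
  generalize thetaFac (a * q / (q ^ n * b)) q p j = A at *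
  generalize thetaFac (b / (q * q ^ m)) q p j = B at *
  generalize thetaFac (a * q ^ (n + 1)) q p j = C at *
  generalize thetaFac (a * q ^ (m + 1)) q p j = D at *
  generalize thetaFac (a * q / (q ^ n * b)) q p m = A' at *
  generalize thetaFac (b / (q * q ^ m)) q p n = B' at *
  generalize thetaFac (q ^ m)⁻¹ q p j = E at *
  generalize thetaFac (q ^ n)⁻¹ q p j = E' at *
  generalize thetaFac (a * q ^ 2 / b * q ^ m) q p j = F at *
  field_simp

/-- The counterpart of `baileyLeft_swap` for the sum over `v`. -/
theorem baileyRight_swap {p : ℂ} (hp : ‖p‖ < 1) {a b q : ℂ} (hq : q ≠ 0) (ha : Generic q p a)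
    (hb : Generic q p b) (hba : Generic q p (b / a)) {m n : ℕ} (hmn : m < n)
    (hQ : GenericBase q p (2 * n + 1)) (v : ℕ → ℂ) :
    baileyRight n a b (q ^ m)⁻¹ q p v *
        (thetaFac (q ^ 2 / (q ^ n * b)) q p m * thetaFac (q ^ (n + 2)) q p m) =
      baileyRight m a (a * q ^ 2 / b) (q ^ n)⁻¹ q p v *
        (thetaFac (b / (a * q ^ m)) q p n * thetaFac (q ^ (m + 2)) q p n) := by
  have ha0 := ha.1
  have hb0 := hb.1
  have hbneg : ∀ k l, thetaFac (b / (a * q ^ k)) q p l ≠ 0 := fun k l =>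
    (hba.of_eq_mul_zpow hq (-k) (by
      rw [zpow_neg, zpow_natCast]; field_simp)).thetaFac_ne_zero l
  have hab : ∀ k l, thetaFac (q ^ 2 / (q ^ k * b)) q p l ≠ 0 := fun k l =>
    ((hb.inv hp hq).of_eq_mul_zpow hq (2 - k) (by
      rw [zpow_sub₀ hq, zpow_natCast]; norm_cast; field_simp)).thetaFac_ne_zero l
  have htrunc : baileyRight n a b (q ^ m)⁻¹ q p v = ∑ k ∈ Finset.range (m + 1), v k *
      (theta (q ^ (2 * k + 1)) p / theta q p *
      (thetaFac (b * q ^ n) q p k * thetaFac (q ^ n)⁻¹ q p k /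
        (thetaFac (q ^ 2 / (q ^ n * b)) q p k * thetaFac (q ^ (n + 2)) q p k)) * (-(q / a)) ^ k) *
      ((thetaFac (1 * (q ^ m)⁻¹) q p k * thetaFac (1 * (a * q ^ 2 / b) / (q ^ m)⁻¹) q p k) *
        (thetaFac (b / a * q ^ k * (q ^ m)⁻¹) q p (n - k) *
          thetaFac (b / a * q ^ k * (a * q ^ 2 / b) / (q ^ m)⁻¹) q p (n - k))) := by
    refine (Finset.sum_subset (Finset.range_subset_range.2 (by omega)) fun j _ hj => ?_).symm
    rw [Finset.mem_range, not_lt] at hj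
    rw [thetaFac_eq_zero hp (x := 1 * (q ^ m)⁻¹) (show m < j by omega) (by field_simp)]
    ring
  rw [htrunc, baileyRight, Finset.sum_mul, Finset.sum_mul]
  refine Finset.sum_congr rfl fun j hj => ?_
  have hjm : j ≤ m := Nat.lt_succ_iff.1 (Finset.mem_range.1 hj)
  have g3 : thetaFac (q ^ (n + 2)) q p j ≠ 0 := hQ.thetaFac_ne_zero (by omega) (by omega)
  have g4 : thetaFac (q ^ (m + 2)) q p j ≠ 0 := hQ.thetaFac_ne_zero (by omega) (by omega)
  have h1 : thetaFac (b / a * q ^ j * (q ^ m)⁻¹) q p (n - j) =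
      thetaFac (b / (a * q ^ m)) q p n / thetaFac (b / (a * q ^ m)) q p j := by
    rw [eq_div_iff (hbneg _ _), mul_comm,
      ← thetaFac_mul_shift (b / (a * q ^ m)) p (show j ≤ n by omega)]
    congr 2
    field_simp
  have h2 : thetaFac (a * q ^ 2 / b / a * q ^ j * (q ^ n)⁻¹) q p (m - j) =
      thetaFac (q ^ 2 / (q ^ n * b)) q p m / thetaFac (q ^ 2 / (q ^ n * b)) q p j := by
    rw [eq_div_iff (hab _ _), mul_comm, ← thetaFac_mul_shift (q ^ 2 / (q ^ n * b)) p hjm]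
    congr 2
    field_simp
  have h3 : ∀ k l, ∀ B : ℂ, B ≠ 0 → j ≤ l → thetaFac (q ^ (k + 2)) q p j ≠ 0 →
      thetaFac (B / a * q ^ j * (a * q ^ 2 / B) / (q ^ k)⁻¹) q p (l - j) =
      thetaFac (q ^ (k + 2)) q p l / thetaFac (q ^ (k + 2)) q p j := by
    intro k l B hB hl h0
    rw [eq_div_iff h0, mul_comm, ← thetaFac_mul_shift (q ^ (k + 2)) p hl]
    congr 2
    field_simp
    ring
  rw [h1, h2, h3 m n b hb0 (by omega) g4, h3 n m _ (by positivity) hjm g3]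
  simp only [one_mul]
  rw [show a * q ^ 2 / b / (q ^ m)⁻¹ = a * q ^ 2 / b * q ^ m by field_simp,
    show a * q ^ 2 / (a * q ^ 2 / b) / (q ^ n)⁻¹ = b * q ^ n by field_simp,
    show q ^ 2 / (q ^ m * (a * q ^ 2 / b)) = b / (a * q ^ m) by field_simp]
  have g1 := hab n j
  have g2 := hbneg m j
  generalize thetaFac (q ^ 2 / (q ^ n * b)) q p j = A at *
  generalize thetaFac (b / (a * q ^ m)) q p j = B at *
  generalize thetaFac (q ^ (n + 2)) q p j = C at *
  generalize thetaFac (q ^ (m + 2)) q p j = D at *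
  generalize thetaFac (q ^ 2 / (q ^ n * b)) q p m = A' at *
  generalize thetaFac (b / (a * q ^ m)) q p n = B' at *
  generalize thetaFac (q ^ m)⁻¹ q p j = E at *
  generalize thetaFac (q ^ n)⁻¹ q p j = E' at *
  generalize thetaFac (a * q ^ 2 / b * q ^ m) q p j = F at *
  generalize theta q p = T at *
  generalize (-(q / a)) ^ j = Z at *
  ring

theorem thetaFac_mul_thetaFac_reflect {p : ℂ} (hp : ‖p‖ < 1) {x q : ℂ} (hx : x ≠ 0) (hq : q ≠ 0)
    (m n : ℕ) :
    thetaFac x q p n * thetaFac (q / x) q p m =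
      q ^ (n * m) * (thetaFac (x / q ^ m) q p n * thetaFac (q / (x * q ^ n)) q p m) := by
  have e1 := thetaFac_reverse hp (x := x / q ^ m) (y := q / x) (div_ne_zero hx (pow_ne_zero m hq))
    hq (n := m) (by field_simp)
  have e2 := thetaFac_reverse hp (x := x / q ^ m * q ^ n) (y := q / (x * q ^ n))
    (mul_ne_zero (div_ne_zero hx (pow_ne_zero m hq)) (pow_ne_zero n hq)) hq (n := m)
    (by field_simp)
  have e3 := thetaFac_mul_comm (x / q ^ m) q p m n
  rw [show x / q ^ m * q ^ m = x by field_simp, ← e1, ← e2, neg_mul_eq_neg_mul, mul_pow,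
    ← pow_mul] at e3
  have h1 : (-(x / q ^ m)) ^ m * q ^ m.choose 2 ≠ 0 :=
    mul_ne_zero (pow_ne_zero _ (neg_ne_zero.2 (div_ne_zero hx (pow_ne_zero m hq))))
      (pow_ne_zero _ hq)
  refine mul_right_cancel₀ h1 ?_
  linear_combination e3

/-- The factors in `baileyLeft_swap` and `baileyRight_swap` are compatible with the factor in front
of the sum over `v`. -/
theorem baileyFactor_swap {p : ℂ} (hp : ‖p‖ < 1) {a b q : ℂ} (hq : q ≠ 0) (ha : Generic q p a)
    (hb : Generic q p b) (hba : Generic q p (b / a)) {m n : ℕ} (hmn : m < n)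
    (hQ : GenericBase q p (2 * n + 1)) :
    baileyFactor n a b q p *
        (thetaFac (a * q / (q ^ n * b)) q p m * thetaFac (a * q ^ (n + 1)) q p m) *
        (thetaFac (b / (a * q ^ m)) q p n * thetaFac (q ^ (m + 2)) q p n) =
      baileyFactor m a (a * q ^ 2 / b) q p *
        (thetaFac (b / (q * q ^ m)) q p n * thetaFac (a * q ^ (m + 1)) q p n) *
        (thetaFac (q ^ 2 / (q ^ n * b)) q p m * thetaFac (q ^ (n + 2)) q p m) := by
  have ha0 := ha.1
  have hb0 := hb.1
  have e1 := thetaFac_mul_comm (a * q) q p n m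
  have e2 := thetaFac_mul_comm (q ^ 2) q p n m
  have e3 := thetaFac_mul_thetaFac_reflect hp (div_ne_zero hb0 hq) hq m n
  have e4 := thetaFac_mul_thetaFac_reflect hp hba.1 hq m n
  rw [show a * q * q ^ n = a * q ^ (n + 1) by ring,
    show a * q * q ^ m = a * q ^ (m + 1) by ring] at e1
  rw [← pow_add, ← pow_add, add_comm 2 n, add_comm 2 m] at e2
  rw [show q / (b / q) = q ^ 2 / b by field_simp, show b / q / q ^ m = b / (q * q ^ m) by field_simp,
    show q / (b / q * q ^ n) = q ^ 2 / (q ^ n * b) by field_simp] at e3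
  rw [show q / (b / a) = a * q / b by field_simp, show b / a / q ^ m = b / (a * q ^ m) by field_simp,
    show q / (b / a * q ^ n) = a * q / (q ^ n * b) by field_simp] at e4
  have h1 : thetaFac (q ^ 2) q p n ≠ 0 := hQ.thetaFac_ne_zero (by omega) (by omega)
  have h2 : thetaFac (q ^ 2) q p m ≠ 0 := hQ.thetaFac_ne_zero (by omega) (by omega)
  have h3 := hba.thetaFac_ne_zero n
  have h4 : thetaFac (q ^ 2 / b) q p m ≠ 0 :=
    ((hb.inv hp hq).of_eq_mul_zpow hq 2 (by norm_cast; field_simp)).thetaFac_ne_zero m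
  have h5 : q ^ (n * m) ≠ 0 := pow_ne_zero _ hq
  rw [baileyFactor, baileyFactor, show a * q ^ 2 / b / q = a * q / b by field_simp,
    show a * q ^ 2 / b / a = q ^ 2 / b by field_simp]
  generalize thetaFac (q ^ 2) q p n = Qn at *
  generalize thetaFac (q ^ 2) q p m = Qm at *
  generalize thetaFac (b / a) q p n = A at *
  generalize thetaFac (q ^ 2 / b) q p m = B at *
  generalize thetaFac (b / q) q p n = C at *
  generalize thetaFac (a * q / b) q p m = D at *
  generalize thetaFac (a * q / (q ^ n * b)) q p m = E at *
  generalize thetaFac (b / (a * q ^ m)) q p n = F at *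
  generalize thetaFac (b / (q * q ^ m)) q p n = G at *
  generalize thetaFac (q ^ 2 / (q ^ n * b)) q p m = H at *
  generalize thetaFac (q ^ (m + 2)) q p n = I at *
  generalize thetaFac (q ^ (n + 2)) q p m = J at *
  generalize thetaFac (a * q) q p n = U at *
  generalize thetaFac (a * q) q p m = V at *
  generalize thetaFac (a * q ^ (n + 1)) q p m = U' at *
  generalize thetaFac (a * q ^ (m + 1)) q p n = V' at *
  generalize q ^ (n * m) = w at *
  have e5 : C * B * E * F = A * D * G * H := by
    refine mul_left_cancel₀ h5 ?_
    linear_combination w * E * F * e3 - w * G * H * e4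
  field_simp
  linear_combination C * E * F * I * Qm * B * e1 + V * V' * I * Qm * e5 - V * V' * A * D * G * H * e2

/-- At `c = q ^ (n + 1)` the sum over `u` is the one defining a Bailey pair, and only the last
term of the sum over `v` survives. -/
theorem baileyLeft_eq_of_eq {p : ℂ} (hp : ‖p‖ < 1) {a b q : ℂ} (hq : q ≠ 0) (ha : Generic q p a)
    (hb : Generic q p b) (hba : Generic q p (b / a)) {n : ℕ}
    (hQ : GenericBase q p (2 * n + 1)) {u v : ℕ → ℂ} (huv : IsBaileyPair n a q p u v) :
    baileyLeft n a b (q ^ (n + 1)) q p u =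
      baileyFactor n a b q p * baileyRight n a b (q ^ (n + 1)) q p v := by
  have ha0 := ha.1
  have hb0 := hb.1
  have hS3 : ∀ l, thetaFac (q ^ 2 / (q ^ n * b)) q p l ≠ 0 := fun l =>
    ((hb.inv hp hq).of_eq_mul_zpow hq (2 - n) (by
      rw [zpow_sub₀ hq, zpow_natCast]; norm_cast; field_simp)).thetaFac_ne_zero l
  have hS4 : ∀ l, thetaFac (a * q / (q ^ n * b)) q p l ≠ 0 := fun l =>
    ((hba.inv hp hq).of_eq_mul_zpow hq (1 - n) (by
      rw [zpow_sub₀ hq, zpow_natCast, zpow_one]; field_simp)).thetaFac_ne_zero l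
  have hneg : ∀ l, thetaFac (a / q ^ n) q p l ≠ 0 := fun l =>
    (ha.of_eq_mul_zpow hq (-n) (by rw [zpow_neg, zpow_natCast]; field_simp)).thetaFac_ne_zero l
  have hbn : ∀ l, thetaFac (b * q ^ n) q p l ≠ 0 := fun l =>
    (hb.of_eq_mul_zpow hq n (by rw [zpow_natCast])).thetaFac_ne_zero l
  have hL : baileyLeft n a b (q ^ (n + 1)) q p u =
      thetaFac (b * q ^ n) q p n * thetaFac (a / q ^ n) q p n *
        (thetaFac (a * q) q p n / (thetaFac (a / q ^ n) q p n * q ^ (n + 1).choose 2) * v n) := by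
    rw [← huv n le_rfl, baileyLeft, Finset.mul_sum]
    refine Finset.sum_congr rfl fun j hj => ?_
    have hjn : j ≤ n := Nat.lt_succ_iff.1 (Finset.mem_range.1 hj)
    have h1 : thetaFac (b / q * q ^ j * q ^ (n + 1)) q p (n - j) =
        thetaFac (b * q ^ n) q p n / thetaFac (b * q ^ n) q p j := by
      rw [eq_div_iff (hbn _), mul_comm, ← thetaFac_mul_shift (b * q ^ n) p hjn]
      congr 2
      field_simp
      ring
    have h2 : thetaFac (b / q * q ^ j * (a * q ^ 2 / b) / q ^ (n + 1)) q p (n - j) =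
        thetaFac (a / q ^ n) q p n / thetaFac (a / q ^ n) q p j := by
      rw [eq_div_iff (hneg _), mul_comm, ← thetaFac_mul_shift (a / q ^ n) p hjn]
      congr 2
      field_simp
      ring
    rw [h1, h2, one_mul, show 1 * (a * q ^ 2 / b) / q ^ (n + 1) = a * q / (q ^ n * b) by
      field_simp; ring]
    have g1 := hS4 j
    have g2 := hneg j
    have g3 := hbn j
    generalize thetaFac (a * q / (q ^ n * b)) q p j = A at *
    generalize thetaFac (a / q ^ n) q p j = B at *
    generalize thetaFac (b * q ^ n) q p j = C at *
    generalize thetaFac (q ^ n)⁻¹ q p j = D at *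
    generalize thetaFac (a / q ^ n) q p n = E at *
    field_simp
  rw [hL, baileyRight, Finset.sum_range_succ, Finset.sum_eq_zero, zero_add, Nat.sub_self,
    thetaFac_zero, thetaFac_zero, one_mul, one_mul, mul_one, mul_one, baileyFactor,
    show a * q ^ 2 / b / q ^ (n + 1) = a * q / (q ^ n * b) by field_simp; ring]
  · have f1 : thetaFac (q ^ (n + 1)) q p n * theta (q ^ (2 * n + 1)) p =
        theta (q ^ (n + 1)) p * thetaFac (q ^ (n + 2)) q p n := by
      have := thetaFac_succ' (q ^ (n + 1)) q p n
      rwa [thetaFac_succ, ← pow_add, ← pow_succ, show n + 1 + n = 2 * n + 1 by ring] at this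
    have f2 : thetaFac q q p n * theta (q ^ (n + 1)) p =
        theta q p * thetaFac (q ^ 2) q p n := by
      have := thetaFac_succ' q q p n
      rwa [thetaFac_succ, ← pow_succ', ← pow_two] at this
    have f3 := thetaFac_reverse hp (x := q) (y := (q ^ n)⁻¹) hq hq (n := n) (by field_simp)
    have f4 := thetaFac_reverse hp (x := b / q) (y := q ^ 2 / (q ^ n * b))
      (div_ne_zero hb0 hq) hq (n := n) (by field_simp)
    have f5 := thetaFac_reverse hp (x := b / a) (y := a * q / (q ^ n * b)) hba.1 hq (n := n)
      (by field_simp)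
    have f6 : (-(b / q)) ^ n * (-(q / a)) ^ n * q ^ n = (-(b / a)) ^ n * (-q) ^ n := by
      rw [← mul_pow, ← mul_pow, ← mul_pow]
      congr 1
      field_simp
    have f7 : q ^ (n + 1).choose 2 = q ^ n * q ^ n.choose 2 := by
      rw [Nat.choose_succ_succ', Nat.choose_one_right, pow_add]
    rw [← f3] at f2
    rw [← f4, ← f5, f7]
    have g1 := hS3 n
    have g2 := hS4 n
    have g3 := hneg n
    have g4 : thetaFac (q ^ 2) q p n ≠ 0 := hQ.thetaFac_ne_zero (by omega) (by omega)
    have g5 : thetaFac (q ^ (n + 2)) q p n ≠ 0 := hQ.thetaFac_ne_zero (by omega) (by omega)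
    have g6 : theta q p ≠ 0 := by simpa using hQ 1 le_rfl (by omega)
    have g7 : (-(b / a)) ^ n ≠ 0 := pow_ne_zero _ (neg_ne_zero.2 hba.1)
    have g8 : q ^ n.choose 2 ≠ 0 := pow_ne_zero _ hq
    have g9 : q ^ n ≠ 0 := pow_ne_zero _ hq
    generalize thetaFac (a * q / (q ^ n * b)) q p n = S4 at *
    generalize thetaFac (q ^ 2 / (q ^ n * b)) q p n = S3 at *
    generalize thetaFac (a / q ^ n) q p n = N at *
    generalize thetaFac (q ^ 2) q p n = Q₂ at *
    generalize thetaFac (q ^ (n + 2)) q p n = M at *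
    generalize theta (q ^ (2 * n + 1)) p = t at *
    generalize theta (q ^ (n + 1)) p = t' at *
    generalize theta q p = t₀ at *
    generalize thetaFac (b * q ^ n) q p n = W at *
    generalize thetaFac (q ^ n)⁻¹ q p n = Y at *
    generalize thetaFac (q ^ (n + 1)) q p n = X at *
    generalize thetaFac (a * q) q p n = U at *
    generalize (-(b / a)) ^ n = B at *
    generalize (-(b / q)) ^ n = E at *
    generalize (-(q / a)) ^ n = F at *
    generalize (-q) ^ n = D at *
    generalize q ^ n.choose 2 = C at *
    generalize q ^ n = G at *
    have f8 : E * C * t * Y * F * X * G = Q₂ * B * t₀ * M := by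
      linear_combination C * t * Y * X * f6 + B * D * C * Y * f1 + B * M * f2
    field_simp
    linear_combination -(W * U * v n) * f8
  · intro k hk
    rw [Finset.mem_range] at hk
    obtain ⟨r, rfl⟩ : ∃ r, n = k + 1 + r := ⟨n - (k + 1), by omega⟩
    rw [thetaFac_eq_zero hp (x := b / a * q ^ k * (a * q ^ 2 / b) / q ^ (k + 1 + r + 1)) (i := r)
      (by omega) (by rw [pow_add, pow_add, pow_succ]; field_simp; ring)]
    ring

/-- The transformation with base parameter `a` replaced by `q`, for generic `a` and `b` and with
the denominators depending on `c` cleared. -/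
theorem baileyLeft_eq {p : ℂ} (hp : ‖p‖ < 1) {a b q : ℂ} (hq : q ≠ 0) (ha : Generic q p a)
    (hb : Generic q p b) (hba : Generic q p (b / a)) {n : ℕ}
    (hQ : GenericBase q p (2 * n + 1)) {u v : ℕ → ℂ} (huv : IsBaileyPair n a q p u v)
    {c : ℂ} (hc : c ≠ 0) :
    baileyLeft n a b c q p u = baileyFactor n a b q p * baileyRight n a b c q p v := by
  induction n using Nat.strong_induction_on generalizing b c with
  | _ n ih =>
    have ha0 := ha.1
    have hb0 := hb.1
    have hab := hba.inv hp hq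
    rw [← sub_eq_zero]
    refine eq_zero_of_mem_thetaSpan_of_points hp (K := a * q ^ 2 / b) (by positivity)
      (baileyLeft_sub_baileyRight_mem p ha0 hb0 hq n u v)
      (fun i => (q ^ i)⁻¹) (q ^ (n + 1)) (fun i _ => inv_ne_zero (pow_ne_zero i hq))
      (pow_ne_zero _ hq) ?_ ?_ ?_
      (sub_eq_zero.2 (baileyLeft_eq_of_eq hp hq ha hb hba hQ huv)) c hc
    · intro j hj i hi
      obtain ⟨r, rfl⟩ : ∃ r, j = i + (r + 1) := ⟨j - i - 1, by omega⟩
      constructor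
      · rw [show (q ^ i)⁻¹ / (q ^ (i + (r + 1)))⁻¹ = q ^ (r + 1) by rw [pow_add]; field_simp]
        exact hQ _ (by omega) (by omega)
      · rw [show a * q ^ 2 / b / ((q ^ i)⁻¹ * (q ^ (i + (r + 1)))⁻¹) =
          (b / a)⁻¹ * q ^ ((i + i + r + 3 : ℕ) : ℤ) by
          rw [zpow_natCast]; field_simp; ring]
        exact hab.2 _
    · intro i hi
      constructor
      · rw [show (q ^ i)⁻¹ / q ^ (n + 1) = (q ^ (n + 1 + i))⁻¹ by field_simp; ring]
        exact theta_inv_ne_zero (pow_ne_zero _ hq) hp (hQ _ (by omega) (by omega))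
      · rw [show a * q ^ 2 / b / ((q ^ i)⁻¹ * q ^ (n + 1)) =
          (b / a)⁻¹ * q ^ ((i + 2 : ℕ) - (n + 1 : ℕ) : ℤ) by
          rw [zpow_sub₀ hq, zpow_natCast, zpow_natCast]; field_simp; ring]
        exact hab.2 _
    · intro i hi
      have hK : Generic q p (a * q ^ 2 / b) :=
        hab.of_eq_mul_zpow hq 2 (by norm_cast; field_simp)
      have hKa : Generic q p (a * q ^ 2 / b / a) :=
        (hb.inv hp hq).of_eq_mul_zpow hq 2 (by norm_cast; field_simp)
      have h1 := baileyLeft_swap hp hq ha hb hba hi u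
      have h2 := baileyRight_swap hp hq ha hb hba hi hQ v
      have h3 := baileyFactor_swap hp hq ha hb hba hi hQ
      have h4 := ih i hi hK hKa (hQ.mono (by omega)) (fun m hm => huv m (hm.trans hi.le))
        (inv_ne_zero (pow_ne_zero n hq))
      have g1 : thetaFac (a * q / (q ^ n * b)) q p i ≠ 0 :=
        (hab.of_eq_mul_zpow hq (1 - n) (by
          rw [zpow_sub₀ hq, zpow_natCast, zpow_one]; field_simp)).thetaFac_ne_zero _
      have g2 : thetaFac (a * q ^ (n + 1)) q p i ≠ 0 :=
        (ha.of_eq_mul_zpow hq (n + 1 : ℕ) (by rw [zpow_natCast])).thetaFac_ne_zero _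
      have g3 : thetaFac (b / (a * q ^ i)) q p n ≠ 0 :=
        (hba.of_eq_mul_zpow hq (-i) (by
          rw [zpow_neg, zpow_natCast]; field_simp)).thetaFac_ne_zero _
      have g4 : thetaFac (q ^ (i + 2)) q p n ≠ 0 := hQ.thetaFac_ne_zero (by omega) (by omega)
      rw [h4] at h1
      refine sub_eq_zero.2 (mul_right_cancel₀ (mul_ne_zero (mul_ne_zero g1 g2)
        (mul_ne_zero g3 g4)) ?_)
      linear_combination (thetaFac (b / (a * q ^ i)) q p n * thetaFac (q ^ (i + 2)) q p n) * h1
        - baileyRight n a b (q ^ i)⁻¹ q p v * h3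
        - baileyFactor i a (a * q ^ 2 / b) q p *
          (thetaFac (b / (q * q ^ i)) q p n * thetaFac (a * q ^ (i + 1)) q p n) * h2

/-! ### The transformation for generic parameters -/

/-- The factors of the `j`-th term of the left-hand side that do not depend on `b`, `c`, `n`. -/
noncomputable def leftCoeff (a d q p : ℂ) (j : ℕ) : ℂ :=
  quadWeight a q p j * (thetaFac d q p j * thetaFac (q / d) q p j /
    (thetaFac (a * d) q p j * thetaFac (a * q / d) q p j))

/-- The factors of the `k`-th term of the right-hand side that depend on `d`. -/
noncomputable def rightCoeff (a d q p : ℂ) (k : ℕ) : ℂ :=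
  thetaFac (a * d / q ^ k) (q ^ 2) p k / thetaFac (d / (a * q ^ k)) (q ^ 2) p k *
    (thetaFac (d / a) q p k / thetaFac (a * d) q p k)

/-- The `j`-th term of `leftSum`. -/
noncomputable def leftTerm (n : ℕ) (a b c d q p : ℂ) (j : ℕ) : ℂ :=
  leftCoeff a d q p j *
    (thetaFac (b * q ^ n) q p j * thetaFac (q ^ n)⁻¹ q p j /
      (thetaFac (a * q / (q ^ n * b)) q p j * thetaFac (a * q ^ (n + 1)) q p j)) *
    (thetaFac c q p j * thetaFac (a * q ^ 2 / b / c) q p j /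
      (thetaFac (b * c / q) q p j * thetaFac (a * q / c) q p j))

/-- The `k`-th term of `rightSum`. -/
noncomputable def rightTerm (n : ℕ) (a b c d q p : ℂ) (k : ℕ) : ℂ :=
  rightCoeff a d q p k * (theta (q ^ (2 * k + 1)) p / theta q p *
    (thetaFac (b * q ^ n) q p k * thetaFac (q ^ n)⁻¹ q p k /
      (thetaFac (q ^ 2 / (q ^ n * b)) q p k * thetaFac (q ^ (n + 2)) q p k)) * (-(q / a)) ^ k) *
    (thetaFac c q p k * thetaFac (a * q ^ 2 / b / c) q p k /
      (thetaFac (b * c / a) q p k * thetaFac (q ^ 2 / c) q p k))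

theorem leftSum_eq_sum_leftTerm {q : ℂ} (hq : q ≠ 0) (n : ℕ) (a b c d p : ℂ) :
    leftSum n a b c d q p = ∑ j ∈ Finset.range (n + 1), leftTerm n a b c d q p j := by
  refine Finset.sum_congr rfl fun j _ => ?_
  rw [leftTerm, leftCoeff, quadWeight, zpow_sub₀ hq, zpow_one, zpow_neg, zpow_natCast,
    show a * (q / q ^ n) / b = a * q / (q ^ n * b) by ring,
    show a * q ^ 2 / (b * c) = a * q ^ 2 / b / c by ring, add_comm 1 n]
  simp only [thetaFacs, List.map_cons, List.map_nil, List.prod_cons, List.prod_nil]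
  ring

theorem rightSum_eq_sum_rightTerm {q : ℂ} (hq : q ≠ 0) (n : ℕ) (a b c d p : ℂ) :
    rightSum n a b c d q p = ∑ k ∈ Finset.range (n + 1), rightTerm n a b c d q p k := by
  refine Finset.sum_congr rfl fun k _ => ?_
  rw [rightTerm, rightCoeff, zpow_sub₀ hq, zpow_neg, zpow_neg, zpow_natCast, zpow_natCast,
    show (q ^ (2 : ℤ)) = q ^ 2 by norm_cast,
    show q ^ 2 / q ^ n / b = q ^ 2 / (q ^ n * b) by ring,
    show a * q ^ 2 / (b * c) = a * q ^ 2 / b / c by ring, add_comm 1 (2 * k), add_comm 2 n,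
    show a * d * (q ^ k)⁻¹ = a * d / q ^ k by ring,
    show d * (q ^ k)⁻¹ / a = d / (a * q ^ k) by ring]
  simp only [thetaFacs, List.map_cons, List.map_nil, List.prod_cons, List.prod_nil]
  ring

theorem prefactor_eq (n : ℕ) (a b c q p : ℂ) :
    prefactor n a b c q p = baileyFactor n a b q p *
      (thetaFac (q ^ 2 / c) q p n * thetaFac (b * c / a) q p n /
        (thetaFac (b * c / q) q p n * thetaFac (a * q / c) q p n)) := by
  simp only [prefactor, baileyFactor, thetaFacs, List.map_cons, List.map_nil, List.prod_cons,
    List.prod_nil]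
  ring

theorem baileyLeft_leftCoeff {a b c q : ℂ} (hb : b ≠ 0) (hc : c ≠ 0) (hq : q ≠ 0) {n : ℕ}
    {d p : ℂ} (h1 : thetaFac (b * c / q) q p n ≠ 0) (h2 : thetaFac (a * q / c) q p n ≠ 0) :
    baileyLeft n a b c q p (leftCoeff a d q p) = leftSum n a b c d q p *
      (thetaFac (b * c / q) q p n * thetaFac (a * q / c) q p n) := by
  rw [leftSum_eq_sum_leftTerm hq, baileyLeft, Finset.sum_mul]
  refine Finset.sum_congr rfl fun j hj => ?_
  have hjn : j ≤ n := Nat.lt_succ_iff.1 (Finset.mem_range.1 hj)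
  have g1 := thetaFac_ne_zero_of_le hjn h1
  have g2 := thetaFac_ne_zero_of_le hjn h2
  rw [leftTerm, ← thetaFac_mul_shift (b * c / q) p hjn, ← thetaFac_mul_shift (a * q / c) p hjn,
    one_mul, one_mul, show b / q * q ^ j * c = b * c / q * q ^ j by ring,
    show b / q * q ^ j * (a * q ^ 2 / b) / c = a * q / c * q ^ j by field_simp]
  generalize thetaFac (b * c / q) q p j = A at *
  generalize thetaFac (a * q / c) q p j = B at *
  generalize leftCoeff a d q p j = L
  generalize thetaFac (b * q ^ n) q p j * thetaFac (q ^ n)⁻¹ q p j /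
        (thetaFac (a * q / (q ^ n * b)) q p j * thetaFac (a * q ^ (n + 1)) q p j) = M
  generalize thetaFac (a * q ^ 2 / b / c) q p j = D
  generalize thetaFac (b * c / q * q ^ j) q p (n - j) = E
  generalize thetaFac (a * q / c * q ^ j) q p (n - j) = F
  field_simp

theorem baileyRight_rightCoeff {a b c q : ℂ} (ha : a ≠ 0) (hb : b ≠ 0) (hc : c ≠ 0) (hq : q ≠ 0)
    {n : ℕ} {d p : ℂ} (h1 : thetaFac (b * c / a) q p n ≠ 0)
    (h2 : thetaFac (q ^ 2 / c) q p n ≠ 0) :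
    baileyRight n a b c q p (rightCoeff a d q p) = rightSum n a b c d q p *
      (thetaFac (b * c / a) q p n * thetaFac (q ^ 2 / c) q p n) := by
  rw [rightSum_eq_sum_rightTerm hq, baileyRight, Finset.sum_mul]
  refine Finset.sum_congr rfl fun j hj => ?_
  have hjn : j ≤ n := Nat.lt_succ_iff.1 (Finset.mem_range.1 hj)
  have g1 := thetaFac_ne_zero_of_le hjn h1
  have g2 := thetaFac_ne_zero_of_le hjn h2
  rw [rightTerm, ← thetaFac_mul_shift (b * c / a) p hjn, ← thetaFac_mul_shift (q ^ 2 / c) p hjn,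
    one_mul, one_mul, show b / a * q ^ j * c = b * c / a * q ^ j by ring,
    show b / a * q ^ j * (a * q ^ 2 / b) / c = q ^ 2 / c * q ^ j by field_simp]
  generalize thetaFac (b * c / a) q p j = A at *
  generalize thetaFac (q ^ 2 / c) q p j = B at *
  generalize rightCoeff a d q p j = L
  generalize (theta (q ^ (2 * j + 1)) p / theta q p *
    (thetaFac (b * q ^ n) q p j * thetaFac (q ^ n)⁻¹ q p j /
      (thetaFac (q ^ 2 / (q ^ n * b)) q p j * thetaFac (q ^ (n + 2)) q p j)) * (-(q / a)) ^ j) = M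
  generalize thetaFac (a * q ^ 2 / b / c) q p j = D
  generalize thetaFac (b * c / a * q ^ j) q p (n - j) = E
  generalize thetaFac (q ^ 2 / c * q ^ j) q p (n - j) = F
  field_simp

/-- The quadratic summation, restated as a Bailey pair. -/
theorem isBaileyPair_leftCoeff_rightCoeff {p : ℂ} (hp : ‖p‖ < 1) {a d q : ℂ} (hq : q ≠ 0)
    (ha : Generic q p a) (hd : d ≠ 0) {n : ℕ} (hQ : GenericBase q p (2 * n + 1))
    (h1 : thetaFac (a * d) q p n ≠ 0) (h2 : thetaFac (a * q / d) q p n ≠ 0)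
    (h3 : ∀ k ≤ n, thetaFac (d / (a * q ^ k)) (q ^ 2) p k ≠ 0) :
    IsBaileyPair n a q p (leftCoeff a d q p) (rightCoeff a d q p) := by
  intro m hm
  have ha0 := ha.1
  have g1 := thetaFac_ne_zero_of_le hm h1
  have g2 := thetaFac_ne_zero_of_le hm h2
  have g3 := h3 m hm
  have hsum := quadSum_eq_quadProd hp hq ha (n := m) (hQ.mono (by omega)) hd
  have hL : quadSum m a d q p = (∑ j ∈ Finset.range (m + 1), leftCoeff a d q p j *
      (thetaFac (q ^ (m + 1)) q p j * thetaFac (q ^ m)⁻¹ q p j /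
        (thetaFac (a / q ^ m) q p j * thetaFac (a * q ^ (m + 1)) q p j))) *
      (thetaFac (a * d) q p m * thetaFac (a * q / d) q p m) := by
    rw [quadSum, Finset.sum_mul]
    refine Finset.sum_congr rfl fun j hj => ?_
    have hjm : j ≤ m := Nat.lt_succ_iff.1 (Finset.mem_range.1 hj)
    have f1 := thetaFac_ne_zero_of_le hjm g1
    have f2 := thetaFac_ne_zero_of_le hjm g2
    rw [leftCoeff, ← thetaFac_mul_shift (a * d) p hjm, ← thetaFac_mul_shift (a * q / d) p hjm,
      one_mul, one_mul, show a * q ^ j * d = a * d * q ^ j by ring,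
      show a * q ^ j * q / d = a * q / d * q ^ j by ring]
    generalize thetaFac (a * d) q p j = A at *
    generalize thetaFac (a * q / d) q p j = B at *
    generalize thetaFac (a * d * q ^ j) q p (m - j) = C
    generalize thetaFac (a * q / d * q ^ j) q p (m - j) = D
    generalize thetaFac (q ^ (m + 1)) q p j * thetaFac (q ^ m)⁻¹ q p j /
        (thetaFac (a / q ^ m) q p j * thetaFac (a * q ^ (m + 1)) q p j) = M
    generalize thetaFac (q / d) q p j = E
    field_simp
  refine mul_right_cancel₀ (mul_ne_zero g1 g2) ((hL.symm.trans hsum).trans ?_)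
  have e1 := thetaFac_reverse hp (x := d / (a * q ^ m)) (y := a * q / d)
    (div_ne_zero hd (mul_ne_zero ha0 (pow_ne_zero m hq))) hq (n := m) (by field_simp)
  have e2 := thetaFac_reverse hp (x := d / (a * q ^ m) * q) (y := a / q ^ m * q / d)
    (mul_ne_zero (div_ne_zero hd (mul_ne_zero ha0 (pow_ne_zero m hq))) hq) (pow_ne_zero 2 hq)
    (n := m) (by rw [← pow_mul, mul_comm 2 m, pow_mul]; field_simp)
  have e3 : thetaFac (d / (a * q ^ m)) q p m * thetaFac (d / a) q p m =
      thetaFac (d / (a * q ^ m)) (q ^ 2) p m * thetaFac (d / (a * q ^ m) * q) (q ^ 2) p m := by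
    rw [← thetaFac_two_mul, two_mul, thetaFac_add]
    congr 2
    field_simp
  rw [← e1, ← e2, ← pow_mul, mul_comm 2, pow_mul, neg_mul_eq_neg_mul, mul_pow] at e3
  have e4 : q ^ (m + 1).choose 2 = q ^ m * q ^ m.choose 2 := by
    rw [Nat.choose_succ_succ', Nat.choose_one_right, pow_add]
  have hx : (-(d / (a * q ^ m))) ^ m * q ^ m.choose 2 ≠ 0 :=
    mul_ne_zero (pow_ne_zero _ (neg_ne_zero.2
      (div_ne_zero hd (mul_ne_zero ha0 (pow_ne_zero m hq))))) (pow_ne_zero _ hq)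
  have f1 : thetaFac (a / q ^ m) q p m ≠ 0 :=
    (ha.of_eq_mul_zpow hq (-m) (by rw [zpow_neg, zpow_natCast]; field_simp)).thetaFac_ne_zero m
  have f2 : q ^ m ≠ 0 := pow_ne_zero _ hq
  have f3 : q ^ m.choose 2 ≠ 0 := pow_ne_zero _ hq
  rw [quadProd, rightCoeff, e4, show a / q ^ m * d = a * d / q ^ m by ring]
  generalize thetaFac (d / (a * q ^ m)) (q ^ 2) p m = X at *
  generalize thetaFac (a / q ^ m * q / d) (q ^ 2) p m = Y at *
  generalize thetaFac (a * q / d) q p m = B at *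
  generalize thetaFac (d / a) q p m = D at *
  generalize thetaFac (a / q ^ m) q p m = N at *
  generalize thetaFac (a * d) q p m = A at *
  generalize thetaFac (a * d / q ^ m) (q ^ 2) p m = Z at *
  generalize thetaFac (a * q) q p m = U at *
  generalize (-(d / (a * q ^ m))) ^ m = W at *
  generalize q ^ m.choose 2 = C at *
  generalize q ^ m = G at *
  have e5 : B * D = X * Y * (G * C) := by
    refine mul_left_cancel₀ hx ?_
    linear_combination e3
  field_simp
  linear_combination -(U * Z) * e5

/-- The transformation for generic `a`, `b` and `b / a`. -/
theorem leftSum_eq_of_generic {p : ℂ} (hp : ‖p‖ < 1) {a b c d q : ℂ} (hq : q ≠ 0)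
    (ha : Generic q p a) (hb : Generic q p b) (hba : Generic q p (b / a)) (hc : c ≠ 0)
    (hd : d ≠ 0) {n : ℕ} (hQ : GenericBase q p (2 * n + 1))
    (h1 : thetaFac (a * d) q p n ≠ 0) (h2 : thetaFac (a * q / d) q p n ≠ 0)
    (h3 : ∀ k ≤ n, thetaFac (d / (a * q ^ k)) (q ^ 2) p k ≠ 0)
    (h4 : thetaFac (b * c / q) q p n ≠ 0) (h5 : thetaFac (a * q / c) q p n ≠ 0)
    (h6 : thetaFac (q ^ 2 / c) q p n ≠ 0) (h7 : thetaFac (b * c / a) q p n ≠ 0) :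
    leftSum n a b c d q p = prefactor n a b c q p * rightSum n a b c d q p := by
  have h := baileyLeft_eq hp hq ha hb hba hQ
    (isBaileyPair_leftCoeff_rightCoeff hp hq ha hd hQ h1 h2 h3) hc
  rw [baileyLeft_leftCoeff hb.1 hc hq h4 h5, baileyRight_rightCoeff ha.1 hb.1 hc hq h7 h6] at h
  rw [prefactor_eq]
  refine mul_right_cancel₀ (mul_ne_zero h4 h5) (h.trans ?_)
  generalize thetaFac (b * c / q) q p n = A at *
  generalize thetaFac (a * q / c) q p n = B at *
  field_simp

/-! ### Density of generic parameters and continuity -/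

theorem countable_setOf_not_generic {p : ℂ} (hp : ‖p‖ < 1) {q x : ℂ} (hq : q ≠ 0) (hx : x ≠ 0)
    {k : ℕ} (hk : 0 < k) : {s : ℂ | s ≠ 0 ∧ ¬Generic q p (x * s ^ k)}.Countable := by
  have hsub : {s : ℂ | s ≠ 0 ∧ ¬Generic q p (x * s ^ k)} ⊆
      ⋃ i : ℤ, ⋃ z ∈ {z : ℂ | z ≠ 0 ∧ theta z p = 0},
        {s : ℂ | s ^ k = z / (x * q ^ i)} := by
    rintro s ⟨hs, h⟩
    have hxs : x * s ^ k ≠ 0 := mul_ne_zero hx (pow_ne_zero k hs)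
    obtain ⟨i, hi⟩ : ∃ i : ℤ, theta (x * s ^ k * q ^ i) p = 0 := by
      by_contra! hne
      exact h ⟨hxs, hne⟩
    have hqi : q ^ i ≠ 0 := zpow_ne_zero i hq
    refine Set.mem_iUnion.2 ⟨i, Set.mem_biUnion ⟨mul_ne_zero hxs hqi, hi⟩ ?_⟩
    change s ^ k = _
    field_simp
  refine Set.Countable.mono hsub (Set.countable_iUnion fun i =>
    (countable_setOf_theta_eq_zero hp).biUnion fun z _ => Set.Finite.countable ?_)
  refine (Polynomial.nthRoots k (z / (x * q ^ i))).toFinset.finite_toSet.subset fun s hs => ?_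
  simpa [Polynomial.mem_nthRoots hk] using hs

theorem neBot_nhdsWithin_of_countable {S : Set ℂ} (hS : {s : ℂ | s ≠ 0 ∧ s ∉ S}.Countable) (x : ℂ) :
    (𝓝[S] x).NeBot := by
  have h1 : ({s : ℂ | s ≠ 0 ∧ s ∉ S} ∪ {0}).Countable := hS.union (Set.countable_singleton 0)
  have h2 : ({s : ℂ | s ≠ 0 ∧ s ∉ S} ∪ {0})ᶜ ⊆ S := by
    intro s hs
    by_contra h
    refine hs ?_
    rcases eq_or_ne s 0 with h0 | h0
    · exact Or.inr h0
    · exact Or.inl ⟨h0, h⟩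
  exact mem_closure_iff_nhdsWithin_neBot.1 (((h1.dense_compl ℝ).mono h2) x)

@[fun_prop]
theorem continuousAt_theta_comp {p : ℂ} (hp : ‖p‖ < 1) {f : ℂ → ℂ} {s : ℂ}
    (hf : ContinuousAt f s) (h0 : f s ≠ 0) : ContinuousAt (fun s => theta (f s) p) s :=
  (continuousAt_theta h0 hp).comp (f := f) hf

@[fun_prop]
theorem continuousAt_thetaFac {p : ℂ} (hp : ‖p‖ < 1) {Q f : ℂ → ℂ} {s : ℂ}
    (hQ : ContinuousAt Q s) (hQ0 : Q s ≠ 0) (hf : ContinuousAt f s) (h0 : f s ≠ 0) (k : ℕ) :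
    ContinuousAt (fun s => thetaFac (f s) (Q s) p k) s := by
  unfold thetaFac
  exact tendsto_finsetProd _ fun i _ => continuousAt_theta_comp hp
    (hf.mul (hQ.pow i)) (mul_ne_zero h0 (pow_ne_zero i hQ0))

theorem continuousAt_leftTerm {p : ℂ} (hp : ‖p‖ < 1) {q c d : ℂ} (hq : q ≠ 0) (hc : c ≠ 0)
    (hd : d ≠ 0) {a b : ℂ → ℂ} {s : ℂ} (ha : ContinuousAt a s) (hb : ContinuousAt b s)
    (ha0 : a s ≠ 0) (hb0 : b s ≠ 0) {n j : ℕ} (h1 : theta (a s) p ≠ 0)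
    (h2 : thetaFac (q ^ 2) (q ^ 2) p j ≠ 0) (h3 : thetaFac (a s * d) q p j ≠ 0)
    (h4 : thetaFac (a s * q / d) q p j ≠ 0) (h5 : thetaFac (a s * q / (q ^ n * b s)) q p j ≠ 0)
    (h6 : thetaFac (a s * q ^ (n + 1)) q p j ≠ 0) (h7 : thetaFac (b s * c / q) q p j ≠ 0)
    (h8 : thetaFac (a s * q / c) q p j ≠ 0) :
    ContinuousAt (fun s => leftTerm n (a s) (b s) c d q p j) s := by
  unfold leftTerm leftCoeff quadWeight
  fun_prop (disch := first | assumption | positivity)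

theorem continuousAt_rightTerm {p : ℂ} (hp : ‖p‖ < 1) {q c d : ℂ} (hq : q ≠ 0) (hc : c ≠ 0)
    (hd : d ≠ 0) {a b : ℂ → ℂ} {s : ℂ} (ha : ContinuousAt a s) (hb : ContinuousAt b s)
    (ha0 : a s ≠ 0) (hb0 : b s ≠ 0) {n k : ℕ}
    (h2 : thetaFac (d / (a s * q ^ k)) (q ^ 2) p k ≠ 0) (h3 : thetaFac (a s * d) q p k ≠ 0)
    (h4 : thetaFac (q ^ 2 / (q ^ n * b s)) q p k ≠ 0) (h5 : thetaFac (q ^ (n + 2)) q p k ≠ 0)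
    (h6 : thetaFac (b s * c / a s) q p k ≠ 0) (h7 : thetaFac (q ^ 2 / c) q p k ≠ 0) :
    ContinuousAt (fun s => rightTerm n (a s) (b s) c d q p k) s := by
  unfold rightTerm rightCoeff
  fun_prop (disch := first | assumption | positivity)

theorem continuousAt_leftSum {p : ℂ} (hp : ‖p‖ < 1) {q c d : ℂ} (hq : q ≠ 0) (hc : c ≠ 0)
    (hd : d ≠ 0) {a b : ℂ → ℂ} {s : ℂ} (ha : ContinuousAt a s) (hb : ContinuousAt b s)
    (ha0 : a s ≠ 0) (hb0 : b s ≠ 0) {n : ℕ} (h1 : theta (a s) p ≠ 0)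
    (h2 : thetaFac (q ^ 2) (q ^ 2) p n ≠ 0) (h3 : thetaFac (a s * d) q p n ≠ 0)
    (h4 : thetaFac (a s * q / d) q p n ≠ 0) (h5 : thetaFac (a s * q / (q ^ n * b s)) q p n ≠ 0)
    (h6 : thetaFac (a s * q ^ (n + 1)) q p n ≠ 0) (h7 : thetaFac (b s * c / q) q p n ≠ 0)
    (h8 : thetaFac (a s * q / c) q p n ≠ 0) :
    ContinuousAt (fun s => leftSum n (a s) (b s) c d q p) s := by
  simp only [leftSum_eq_sum_leftTerm hq]
  refine tendsto_finsetSum _ fun j hj => ?_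
  have hjn : j ≤ n := Nat.lt_succ_iff.1 (Finset.mem_range.1 hj)
  exact continuousAt_leftTerm hp hq hc hd ha hb ha0 hb0 h1 (thetaFac_ne_zero_of_le hjn h2)
    (thetaFac_ne_zero_of_le hjn h3) (thetaFac_ne_zero_of_le hjn h4)
    (thetaFac_ne_zero_of_le hjn h5) (thetaFac_ne_zero_of_le hjn h6)
    (thetaFac_ne_zero_of_le hjn h7) (thetaFac_ne_zero_of_le hjn h8)

theorem continuousAt_rightSum {p : ℂ} (hp : ‖p‖ < 1) {q c d : ℂ} (hq : q ≠ 0) (hc : c ≠ 0)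
    (hd : d ≠ 0) {a b : ℂ → ℂ} {s : ℂ} (ha : ContinuousAt a s) (hb : ContinuousAt b s)
    (ha0 : a s ≠ 0) (hb0 : b s ≠ 0) {n : ℕ}
    (h2 : ∀ k ≤ n, thetaFac (d / (a s * q ^ k)) (q ^ 2) p k ≠ 0)
    (h3 : thetaFac (a s * d) q p n ≠ 0)
    (h4 : thetaFac (q ^ 2 / (q ^ n * b s)) q p n ≠ 0) (h5 : thetaFac (q ^ (n + 2)) q p n ≠ 0)
    (h6 : thetaFac (b s * c / a s) q p n ≠ 0) (h7 : thetaFac (q ^ 2 / c) q p n ≠ 0) :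
    ContinuousAt (fun s => rightSum n (a s) (b s) c d q p) s := by
  simp only [rightSum_eq_sum_rightTerm hq]
  refine tendsto_finsetSum _ fun k hk => ?_
  have hkn : k ≤ n := Nat.lt_succ_iff.1 (Finset.mem_range.1 hk)
  exact continuousAt_rightTerm hp hq hc hd ha hb ha0 hb0 (h2 k hkn)
    (thetaFac_ne_zero_of_le hkn h3) (thetaFac_ne_zero_of_le hkn h4)
    (thetaFac_ne_zero_of_le hkn h5) (thetaFac_ne_zero_of_le hkn h6)
    (thetaFac_ne_zero_of_le hkn h7)

theorem continuousAt_prefactor {p : ℂ} (hp : ‖p‖ < 1) {q c : ℂ} (hq : q ≠ 0) (hc : c ≠ 0)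
    {a b : ℂ → ℂ} {s : ℂ} (ha : ContinuousAt a s) (hb : ContinuousAt b s)
    (ha0 : a s ≠ 0) (hb0 : b s ≠ 0) {n : ℕ} (h1 : thetaFac (q ^ 2) q p n ≠ 0)
    (h2 : thetaFac (b s / a s) q p n ≠ 0) (h3 : thetaFac (b s * c / q) q p n ≠ 0)
    (h4 : thetaFac (a s * q / c) q p n ≠ 0) :
    ContinuousAt (fun s => prefactor n (a s) (b s) c q p) s := by
  simp only [prefactor_eq, baileyFactor]
  fun_prop (disch := first | assumption | positivity)

theorem eventually_thetaFac_ne_zero {p : ℂ} (hp : ‖p‖ < 1) {Q : ℂ} (hQ : Q ≠ 0) {f : ℂ → ℂ}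
    {s : ℂ} (hf : ContinuousAt f s) (h0 : f s ≠ 0) {k : ℕ} (h : thetaFac (f s) Q p k ≠ 0) :
    ∀ᶠ s in 𝓝 s, thetaFac (f s) Q p k ≠ 0 :=
  (continuousAt_thetaFac hp continuousAt_const hQ hf h0 k).eventually_ne h

theorem genericBase_of_ne_zero {p q : ℂ} {n : ℕ} (h1 : theta q p ≠ 0)
    (h2 : thetaFac (q ^ 2) q p n ≠ 0) (h3 : thetaFac (q ^ (n + 2)) q p n ≠ 0) :
    GenericBase q p (2 * n + 1) := by
  intro i hi hi'
  rcases Nat.lt_or_ge i 2 with h | h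
  · obtain rfl : i = 1 := by omega
    simpa using h1
  · rcases Nat.lt_or_ge i (n + 2) with h' | h'
    · have := thetaFac_ne_zero_iff.1 h2 (i - 2) (by omega)
      rwa [← pow_add, Nat.add_sub_cancel' h] at this
    · have := thetaFac_ne_zero_iff.1 h3 (i - (n + 2)) (by omega)
      rwa [← pow_add, Nat.add_sub_cancel' h'] at this

/-- The transformation formula wherever no denominator vanishes: both sides are continuous in
`a` and `b`, and generic values are dense. -/
theorem leftSum_eq_prefactor_mul_rightSum {p : ℂ} (hp : ‖p‖ < 1) {a b c d q : ℂ} (hq : q ≠ 0)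
    (ha : a ≠ 0) (hb : b ≠ 0) (hc : c ≠ 0) (hd : d ≠ 0) {n : ℕ}
    (hQ : GenericBase q p (2 * n + 1)) (hθ : theta a p ≠ 0)
    (hab : thetaFac (a * q / (q ^ n * b)) q p n ≠ 0) (han : thetaFac (a * q ^ (n + 1)) q p n ≠ 0)
    (hba : thetaFac (b / a) q p n ≠ 0) (hqb : thetaFac (q ^ 2 / (q ^ n * b)) q p n ≠ 0)
    (h1 : thetaFac (a * d) q p n ≠ 0) (h2 : thetaFac (a * q / d) q p n ≠ 0)
    (h3 : ∀ k ≤ n, thetaFac (d / (a * q ^ k)) (q ^ 2) p k ≠ 0)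
    (h4 : thetaFac (b * c / q) q p n ≠ 0) (h5 : thetaFac (a * q / c) q p n ≠ 0)
    (h6 : thetaFac (q ^ 2 / c) q p n ≠ 0) (h7 : thetaFac (b * c / a) q p n ≠ 0) :
    leftSum n a b c d q p = prefactor n a b c q p * rightSum n a b c d q p := by
  have hq1 : theta q p ≠ 0 := by simpa using hQ 1 le_rfl (by omega)
  have hq2 : thetaFac (q ^ 2) q p n ≠ 0 := hQ.thetaFac_ne_zero (by omega) (by omega)
  have hq3 : thetaFac (q ^ (n + 2)) q p n ≠ 0 := hQ.thetaFac_ne_zero (by omega) (by omega)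
  have hq4 : thetaFac (q ^ 2) (q ^ 2) p n ≠ 0 := hQ.thetaFac_sq_ne_zero (by omega)
  -- the exponents are chosen so that `a`, `b` and `b / a` all move
  obtain ⟨A, hAs⟩ : ∃ A : ℂ → ℂ, ∀ s, A s = a * s ^ 1 := ⟨_, fun _ => rfl⟩
  obtain ⟨B, hBs⟩ : ∃ B : ℂ → ℂ, ∀ s, B s = b * s ^ 2 := ⟨_, fun _ => rfl⟩
  have hA : ContinuousAt A 1 := by rw [funext hAs]; fun_prop
  have hB : ContinuousAt B 1 := by rw [funext hBs]; fun_prop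
  have hA1 : A 1 = a := by simp [hAs]
  have hB1 : B 1 = b := by simp [hBs]
  have hA0 : A 1 ≠ 0 := by rwa [hA1]
  have hB0 : B 1 ≠ 0 := by rwa [hB1]
  let G : Set ℂ := {s | Generic q p (A s) ∧ Generic q p (B s) ∧ Generic q p (b / a * s ^ 1)}
  have hG : {s : ℂ | s ≠ 0 ∧ s ∉ G}.Countable := by
    refine (((countable_setOf_not_generic hp hq ha one_pos).union
      (countable_setOf_not_generic hp hq hb two_pos)).union
      (countable_setOf_not_generic hp hq (div_ne_zero hb ha) one_pos)).mono ?_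
    rintro s ⟨hs, h⟩
    by_contra hne
    refine h ⟨?_, ?_, ?_⟩ <;> by_contra hgen
    · exact hne (Or.inl (Or.inl ⟨hs, hAs s ▸ hgen⟩))
    · exact hne (Or.inl (Or.inr ⟨hs, hBs s ▸ hgen⟩))
    · exact hne (Or.inr ⟨hs, hgen⟩)
  have := neBot_nhdsWithin_of_countable hG 1
  have hL : ContinuousAt (fun s => leftSum n (A s) (B s) c d q p) 1 := by
    apply continuousAt_leftSum hp hq hc hd hA hB hA0 hB0 <;> simpa only [hA1, hB1]
  have hR : ContinuousAt (fun s => rightSum n (A s) (B s) c d q p) 1 := by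
    apply continuousAt_rightSum hp hq hc hd hA hB hA0 hB0 <;> simpa only [hA1, hB1]
  have g1 : thetaFac (B 1 / A 1) q p n ≠ 0 := by simpa only [hA1, hB1]
  have g2 : thetaFac (B 1 * c / q) q p n ≠ 0 := by simpa only [hA1, hB1]
  have g3 : thetaFac (A 1 * q / c) q p n ≠ 0 := by simpa only [hA1, hB1]
  have g4 : thetaFac (A 1 * d) q p n ≠ 0 := by simpa only [hA1, hB1]
  have g5 : thetaFac (A 1 * q / d) q p n ≠ 0 := by simpa only [hA1, hB1]
  have g6 : thetaFac (B 1 * c / A 1) q p n ≠ 0 := by simpa only [hA1, hB1]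
  have hP : ContinuousAt (fun s => prefactor n (A s) (B s) c q p) 1 :=
    continuousAt_prefactor hp hq hc hA hB hA0 hB0 hq2 g1 g2 g3
  have c1 : ∀ᶠ s in 𝓝 1, thetaFac (A s * d) q p n ≠ 0 := eventually_thetaFac_ne_zero
    hp hq (by fun_prop (disch := assumption)) (by positivity) g4
  have c2 : ∀ᶠ s in 𝓝 1, thetaFac (A s * q / d) q p n ≠ 0 := eventually_thetaFac_ne_zero
    hp hq (by fun_prop (disch := assumption)) (by positivity) g5
  have c3 : ∀ᶠ s in 𝓝 1, ∀ k ∈ Finset.range (n + 1),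
      thetaFac (d / (A s * q ^ k)) (q ^ 2) p k ≠ 0 := by
    refine (Finset.eventually_all _).2 fun k hk => eventually_thetaFac_ne_zero
      hp (pow_ne_zero 2 hq) (by fun_prop (disch := positivity)) (by positivity) ?_
    rw [hA1]
    exact h3 k (Nat.lt_succ_iff.1 (Finset.mem_range.1 hk))
  have c4 : ∀ᶠ s in 𝓝 1, thetaFac (B s * c / q) q p n ≠ 0 := eventually_thetaFac_ne_zero
    hp hq (by fun_prop (disch := assumption)) (by positivity) g2
  have c5 : ∀ᶠ s in 𝓝 1, thetaFac (A s * q / c) q p n ≠ 0 := eventually_thetaFac_ne_zero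
    hp hq (by fun_prop (disch := assumption)) (by positivity) g3
  have c6 : ∀ᶠ s in 𝓝 1, thetaFac (B s * c / A s) q p n ≠ 0 := eventually_thetaFac_ne_zero
    hp hq (by fun_prop (disch := assumption)) (by positivity) g6
  have t1 := hL.tendsto.mono_left (nhdsWithin_le_nhds (s := G))
  have t2 := (hP.mul hR).tendsto.mono_left (nhdsWithin_le_nhds (s := G))
  have key := tendsto_nhds_unique_of_eventuallyEq t1 t2 (by
    filter_upwards [self_mem_nhdsWithin, nhdsWithin_le_nhds c1, nhdsWithin_le_nhds c2,
      nhdsWithin_le_nhds c3, nhdsWithin_le_nhds c4, nhdsWithin_le_nhds c5,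
      nhdsWithin_le_nhds c6] with s hs d1 d2 d3 d4 d5 d6
    have hgen : Generic q p (B s / A s) := by
      have hs0 : s ≠ 0 := fun h => hs.1.1 (by simp [hAs, h])
      have : B s / A s = b / a * s ^ 1 := by
        rw [hAs, hBs]
        field_simp
      rw [this]
      exact hs.2.2
    exact leftSum_eq_of_generic hp hq hs.1 hs.2.1 hgen hc hd hQ d1 d2
      (fun k hk => d3 k (Finset.mem_range.2 (Nat.lt_succ_iff.2 hk))) d4 d5 h6 d6)
  simpa only [Pi.mul_apply, hA1, hB1] using key

/-! ### The limit `b → a` -/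

theorem eventually_thetaFac_div_ne_zero {p : ℂ} (hp : ‖p‖ < 1) {q : ℂ} (hq : q ≠ 0) {n : ℕ}
    (hQ : GenericBase q p (2 * n + 1)) {α : ℂ} (hα : α ≠ 0) :
    ∀ᶠ t in 𝓝[≠] α, thetaFac (t / α) q p n ≠ 0 := by
  cases n with
  | zero => simp [thetaFac]
  | succ m =>
    have h1 : ∀ᶠ t in 𝓝 α, thetaFac (t / α * q) q p m ≠ 0 := by
      refine eventually_thetaFac_ne_zero hp hq (by fun_prop (disch := assumption))
        (by positivity) ?_
      rw [div_self hα, one_mul]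
      simpa using hQ.thetaFac_ne_zero (m := 1) (k := m) le_rfl (by omega)
    have h2 : ∀ᶠ t in 𝓝 α, qInf (p * (t / α)) p * qInf (p / (t / α)) p ≠ 0 := by
      refine ContinuousAt.eventually_ne (ContinuousAt.mul ?_ ?_) ?_
      · exact (continuous_qInf hp).continuousAt.comp (f := fun t => p * (t / α))
          (by fun_prop (disch := assumption))
      · exact (continuous_qInf hp).continuousAt.comp (f := fun t => p / (t / α))
          (by fun_prop (disch := positivity))
      · rw [div_self hα, mul_one, div_one]
        exact mul_ne_zero (qInf_self_ne_zero hp) (qInf_self_ne_zero hp)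
    filter_upwards [self_mem_nhdsWithin, nhdsWithin_le_nhds h1, nhdsWithin_le_nhds h2]
      with t ht ht1 ht2
    have h3 : 1 - t / α ≠ 0 := fun h => ht ((div_eq_one_iff_eq hα).1 (sub_eq_zero.1 h).symm)
    rw [thetaFac_succ', theta, qInf_eq_one_sub_mul _ hp, mul_assoc (1 - t / α)]
    exact mul_ne_zero (mul_ne_zero h3 ht2) ht1

theorem inv_prefactor_eq (n : ℕ) (a b c q p : ℂ) :
    (prefactor n a b c q p)⁻¹ = thetaFac (b / a) q p n *
      (thetaFac (q ^ 2) q p n * thetaFac (b * c / q) q p n * thetaFac (a * q / c) q p n /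
        (thetaFac (a * q) q p n * thetaFac (b / q) q p n * thetaFac (q ^ 2 / c) q p n *
          thetaFac (b * c / a) q p n)) := by
  simp only [prefactor, thetaFacs, List.map_cons, List.map_nil, List.prod_cons, List.prod_nil]
  rw [inv_div]
  ring

/-- As `b → a` the prefactor has a pole, which is matched by the last term of the left-hand side
only. -/
theorem tendsto_leftSum_div_prefactor {p : ℂ} (hp : ‖p‖ < 1) {α c d q : ℂ} (hq : q ≠ 0)
    (hα : α ≠ 0) (hc : c ≠ 0) (hd : d ≠ 0) {n : ℕ} (hQ : GenericBase q p (2 * n + 1))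
    (h1 : theta α p ≠ 0) (h2 : thetaFac (α * q ^ (n + 1)) q p n ≠ 0)
    (h3 : thetaFac (α * q / c) q p n ≠ 0) (h4 : thetaFac (α * d) q p n ≠ 0)
    (h5 : thetaFac (α * c / q) q p n ≠ 0) (h6 : thetaFac (α * q / d) q p n ≠ 0)
    (h7 : thetaFac (α * q) q p n ≠ 0) (h8 : thetaFac (α / q) q p n ≠ 0)
    (h9 : thetaFac (q ^ 2 / c) q p n ≠ 0) (h10 : thetaFac c q p n ≠ 0) :
    Tendsto (fun t => leftSum n α t c d q p / prefactor n α t c q p) (𝓝[≠] α)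
      (𝓝 (thetaFac q q p n * thetaFac (q ^ 2) q p n * thetaFac d q p n * thetaFac (q / d) q p n *
          thetaFac (α ^ 2) (q ^ 2) p n /
        (thetaFac α q p n * thetaFac (α / q) q p n * thetaFac (α * d) q p n *
          thetaFac (α * q / d) q p n * thetaFac (q ^ 2) (q ^ 2) p n) * (-(α / q)) ^ n)) := by
  have hq2 : thetaFac (q ^ 2) (q ^ 2) p n ≠ 0 := hQ.thetaFac_sq_ne_zero (by omega)
  have hα1 : thetaFac (α * c / α) q p n ≠ 0 := by rwa [mul_div_cancel_left₀ c hα]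
  obtain ⟨H, hH⟩ : ∃ H : ℂ → ℂ, ∀ t, H t =
      thetaFac (q ^ 2) q p n * thetaFac (t * c / q) q p n * thetaFac (α * q / c) q p n /
        (thetaFac (α * q) q p n * thetaFac (t / q) q p n * thetaFac (q ^ 2 / c) q p n *
          thetaFac (t * c / α) q p n) := ⟨_, fun _ => rfl⟩
  have hHc : ContinuousAt H α := by
    rw [funext hH]
    fun_prop (disch := first | assumption | positivity)
  have hF : ContinuousAt (fun t => thetaFac (t / α) q p n) α := by
    fun_prop (disch := first | assumption | positivity)
  have hsplit : ∀ t, leftSum n α t c d q p / prefactor n α t c q p =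
      ∑ j ∈ Finset.range n, leftTerm n α t c d q p j * (thetaFac (t / α) q p n * H t) +
        leftTerm n α t c d q p n * (thetaFac (t / α) q p n * H t) := by
    intro t
    rw [leftSum_eq_sum_leftTerm hq, div_eq_mul_inv, inv_prefactor_eq, ← hH, Finset.sum_mul,
      Finset.sum_range_succ]
  simp only [hsplit]
  rw [← zero_add (_ * _ : ℂ)]
  refine Tendsto.add ?_ ?_
  · rw [← Finset.sum_const_zero (s := Finset.range n)]
    refine tendsto_finsetSum _ fun j hj => ?_
    have hjn : j < n := Finset.mem_range.1 hj
    have hrev : thetaFac (α * q / (q ^ n * α)) q p j ≠ 0 := by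
      obtain ⟨m, rfl⟩ : ∃ m, n = m + 1 := ⟨n - 1, by omega⟩
      rw [show α * q / (q ^ (m + 1) * α) = (q ^ m)⁻¹ by field_simp; ring]
      exact hQ.thetaFac_inv_ne_zero hp hq (by omega) (by omega)
    have ht : ContinuousAt (fun t => leftTerm n α t c d q p j) α :=
      continuousAt_leftTerm hp hq hc hd (a := fun _ => α) (b := fun t => t) continuousAt_const
        continuousAt_id hα hα h1 (thetaFac_ne_zero_of_le hjn.le hq2)
        (thetaFac_ne_zero_of_le hjn.le h4) (thetaFac_ne_zero_of_le hjn.le h6) hrev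
        (thetaFac_ne_zero_of_le hjn.le h2) (thetaFac_ne_zero_of_le hjn.le h5)
        (thetaFac_ne_zero_of_le hjn.le h3)
    have h0 : thetaFac (α / α) q p n = 0 :=
      thetaFac_eq_zero hp (i := 0) (by omega) (by rw [div_self hα, pow_zero, mul_one])
    have : Tendsto (fun t => leftTerm n α t c d q p j * (thetaFac (t / α) q p n * H t)) (𝓝[≠] α)
        (𝓝 (leftTerm n α α c d q p j * (thetaFac (α / α) q p n * H α))) :=
      (ht.mul (hF.mul hHc)).tendsto.mono_left nhdsWithin_le_nhds
    rwa [h0, zero_mul, mul_zero] at this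
  · have hrev : ∀ t, t ≠ 0 → thetaFac (α * q / (q ^ n * t)) q p n *
        ((-(t / α)) ^ n * q ^ n.choose 2) = thetaFac (t / α) q p n := fun t ht =>
      thetaFac_reverse hp (div_ne_zero ht hα) hq (by field_simp)
    obtain ⟨M, hM⟩ : ∃ M : ℂ → ℂ, ∀ t, M t = leftCoeff α d q p n *
        (thetaFac (t * q ^ n) q p n * thetaFac (q ^ n)⁻¹ q p n /
          thetaFac (α * q ^ (n + 1)) q p n) *
        (thetaFac c q p n * thetaFac (α * q ^ 2 / t / c) q p n /
          (thetaFac (t * c / q) q p n * thetaFac (α * q / c) q p n)) *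
        ((-(t / α)) ^ n * q ^ n.choose 2) * H t := ⟨_, fun _ => rfl⟩
    have hMc : ContinuousAt M α := by
      rw [funext hM]
      fun_prop (disch := first | assumption | positivity)
    have hMα : M α = thetaFac q q p n * thetaFac (q ^ 2) q p n * thetaFac d q p n *
          thetaFac (q / d) q p n * thetaFac (α ^ 2) (q ^ 2) p n /
        (thetaFac α q p n * thetaFac (α / q) q p n * thetaFac (α * d) q p n *
          thetaFac (α * q / d) q p n * thetaFac (q ^ 2) (q ^ 2) p n) * (-(α / q)) ^ n := by
      have e1 : thetaFac (α * q ^ n) q p n * theta (α * q ^ (2 * n)) p =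
          theta (α * q ^ n) p * thetaFac (α * q ^ (n + 1)) q p n := by
        have := thetaFac_succ' (α * q ^ n) q p n
        rwa [thetaFac_succ, show α * q ^ n * q ^ n = α * q ^ (2 * n) by ring,
          show α * q ^ n * q = α * q ^ (n + 1) by ring] at this
      have e2 : thetaFac α q p n * theta (α * q ^ n) p =
          theta α p * thetaFac (α * q) q p n := by
        rw [← thetaFac_succ, thetaFac_succ']
      have e3 := thetaFac_reverse hp (x := q) (y := (q ^ n)⁻¹) hq hq (n := n) (by field_simp)
      have e4 : (-(α / q)) ^ n * (-q) ^ n = (-α) ^ n * (-1) ^ n := by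
        rw [← mul_pow, ← mul_pow]
        congr 1
        field_simp
      have g1 : thetaFac α q p n ≠ 0 := left_ne_zero_of_mul (e2 ▸ mul_ne_zero h1 h7)
      have g2 : (-q) ^ n ≠ 0 := pow_ne_zero _ (neg_ne_zero.2 hq)
      rw [hM, hH, ← e3, leftCoeff, quadWeight, div_self hα, mul_div_cancel_left₀ c hα,
        mul_div_cancel_left₀ (q ^ 2) hα]
      have g3 : thetaFac (q ^ 2) q p n ≠ 0 := hQ.thetaFac_ne_zero (by omega) (by omega)
      generalize thetaFac α q p n = x1 at *
      generalize thetaFac (α / q) q p n = x2 at *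
      generalize thetaFac (α * d) q p n = x3 at *
      generalize thetaFac (α * q / d) q p n = x4 at *
      generalize thetaFac (q ^ 2) (q ^ 2) p n = x5 at *
      generalize thetaFac (α ^ 2) (q ^ 2) p n = x6 at *
      generalize thetaFac (q / d) q p n = x7 at *
      generalize thetaFac (q ^ n)⁻¹ q p n = x8 at *
      generalize thetaFac (α * q ^ (n + 1)) q p n = x9 at *
      generalize thetaFac (α * q ^ n) q p n = x10 at *
      generalize theta (α * q ^ (2 * n)) p = x11 at *
      generalize theta (α * q ^ n) p = x12 at *
      generalize theta α p = x13 at *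
      generalize thetaFac (α * q) q p n = x14 at *
      generalize thetaFac (q ^ 2 / c) q p n = x15 at *
      generalize thetaFac (α * c / q) q p n = x16 at *
      generalize thetaFac (α * q / c) q p n = x17 at *
      generalize thetaFac c q p n = x18 at *
      generalize thetaFac (q ^ 2) q p n = x19 at *
      generalize thetaFac d q p n = x20 at *
      generalize q ^ n.choose 2 = x21 at *
      generalize (-(α / q)) ^ n = x22 at *
      generalize (-q) ^ n = x23 at *
      generalize (-α) ^ n = x24 at *
      generalize (-1 : ℂ) ^ n = x25 at *
      have e5 : x1 * x10 * x11 = x13 * x14 * x9 := by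
        linear_combination x1 * e1 + x9 * e2
      have e6 : x1 * x10 * x11 * x24 * x25 = x13 * x14 * x9 * x22 * x23 := by
        linear_combination x24 * x25 * e5 - x13 * x14 * x9 * e4
      field_simp
      linear_combination (x6 * x20 * x7 * x8 * x21) * e6
    rw [← hMα]
    refine (hMc.tendsto.mono_left nhdsWithin_le_nhds).congr' ?_
    filter_upwards [eventually_thetaFac_div_ne_zero hp hq hQ hα,
      nhdsWithin_le_nhds (eventually_ne_nhds hα)] with t ht ht0
    have hr := hrev t ht0
    have hr0 : thetaFac (α * q / (q ^ n * t)) q p n ≠ 0 :=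
      left_ne_zero_of_mul (hr.symm ▸ ht)
    rw [hM, leftTerm, ← hr]
    generalize thetaFac (α * q / (q ^ n * t)) q p n = x at *
    generalize (-(t / α)) ^ n * q ^ n.choose 2 = y at *
    generalize thetaFac (α * q ^ (n + 1)) q p n = z at *
    generalize thetaFac (t * q ^ n) q p n * thetaFac (q ^ n)⁻¹ q p n = w at *
    generalize (thetaFac c q p n * thetaFac (α * q ^ 2 / t / c) q p n /
          (thetaFac (t * c / q) q p n * thetaFac (α * q / c) q p n)) = v at *
    field_simp

theorem rightSum_self_eq_limitSum {q : ℂ} (hq : q ≠ 0) {a b c : ℂ} (ha : a ≠ 0) (hb : b ≠ 0)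
    {n : ℕ} {p : ℂ} (h1 : thetaFac c q p n ≠ 0) (h2 : thetaFac (q ^ 2 / c) q p n ≠ 0) :
    rightSum n (b / a) (b / a) c (a * b) q p = limitSum n a b q p := by
  rw [rightSum_eq_sum_rightTerm hq]
  refine Finset.sum_congr rfl fun k hk => ?_
  have hkn : k ≤ n := Nat.lt_succ_iff.1 (Finset.mem_range.1 hk)
  have g1 := thetaFac_ne_zero_of_le hkn h1
  have g2 := thetaFac_ne_zero_of_le hkn h2
  have hqn : q ^ n ≠ 0 := pow_ne_zero n hq
  have hqk : q ^ k ≠ 0 := pow_ne_zero k hq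
  rw [rightTerm, rightCoeff, zpow_sub₀ hq, zpow_neg, zpow_neg, zpow_natCast, zpow_natCast,
    show (q ^ (2 : ℤ)) = q ^ 2 by norm_cast, add_comm 1 (2 * k), add_comm 2 n,
    show b / a * q ^ 2 / (b / a) / c = q ^ 2 / c by field_simp,
    show b / a * c / (b / a) = c by field_simp,
    show b / a * (a * b) / q ^ k = b ^ 2 * (q ^ k)⁻¹ by field_simp,
    show a * b / (b / a * q ^ k) = a ^ 2 * (q ^ k)⁻¹ by field_simp,
    show a * b / (b / a) = a ^ 2 by field_simp,
    show b / a * (a * b) = b ^ 2 by field_simp,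
    show q / (b / a) = a * q / b by field_simp,
    show q ^ 2 / (q ^ n * (b / a)) = a * (q ^ 2 / q ^ n) / b by field_simp,
    show b / a * q ^ n = b * q ^ n / a by ring, div_self (mul_ne_zero g1 g2)]
  simp only [thetaFacs, List.map_cons, List.map_nil, List.prod_cons, List.prod_nil]
  ring

/-! ### The summation -/

theorem limitProduct_eq (n : ℕ) (a b q p : ℂ) :
    thetaFac q q p n * thetaFac (q ^ 2) q p n * thetaFac (a * b) q p n *
          thetaFac (q / (a * b)) q p n * thetaFac ((b / a) ^ 2) (q ^ 2) p n /
        (thetaFac (b / a) q p n * thetaFac (b / (a * q)) q p n * thetaFac (b ^ 2) q p n *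
          thetaFac (q / a ^ 2) q p n * thetaFac (q ^ 2) (q ^ 2) p n) * (-(b / (a * q))) ^ n =
      limitProduct n a b q p := by
  simp only [limitProduct, thetaFacs, List.map_cons, List.map_nil, List.prod_cons, List.prod_nil,
    div_pow]
  ring

theorem tendsto_leftSum_div_prefactor_limitProduct {p : ℂ} (hp : ‖p‖ < 1) {a b c q : ℂ}
    (hq : q ≠ 0) (ha : a ≠ 0) (hb : b ≠ 0) (hc : c ≠ 0) {n : ℕ}
    (hQ : GenericBase q p (2 * n + 1))
    (h1 : theta (b / a) p ≠ 0) (h2 : thetaFac (b / a * q ^ (n + 1)) q p n ≠ 0)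
    (h3 : thetaFac (b * q / (a * c)) q p n ≠ 0) (h4 : thetaFac (b ^ 2) q p n ≠ 0)
    (h5 : thetaFac (b * c / (a * q)) q p n ≠ 0) (h6 : thetaFac (q / a ^ 2) q p n ≠ 0)
    (h7 : thetaFac (b * q / a) q p n ≠ 0) (h8 : thetaFac (b / (a * q)) q p n ≠ 0)
    (h9 : thetaFac (q ^ 2 / c) q p n ≠ 0) (h10 : thetaFac c q p n ≠ 0) :
    Tendsto (fun t => leftSum n (b / a) t c (a * b) q p / prefactor n (b / a) t c q p)
      (𝓝[≠] (b / a)) (𝓝 (limitProduct n a b q p)) := by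
  have e3 : b / a * q / c = b * q / (a * c) := by field_simp
  have e4 : b / a * (a * b) = b ^ 2 := by field_simp
  have e5 : b / a * c / q = b * c / (a * q) := by field_simp
  have e6 : b / a * q / (a * b) = q / a ^ 2 := by field_simp
  have e7 : b / a * q = b * q / a := by ring
  have e8 : b / a / q = b / (a * q) := by field_simp
  have := tendsto_leftSum_div_prefactor hp hq (div_ne_zero hb ha) hc (mul_ne_zero ha hb) hQ h1 h2
    (e3 ▸ h3) (e4 ▸ h4) (e5 ▸ h5) (e6 ▸ h6) (e7 ▸ h7) (e8 ▸ h8) h9 h10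
  rwa [e4, e6, e8, limitProduct_eq] at this

theorem tendsto_rightSum_limitSum {p : ℂ} (hp : ‖p‖ < 1) {a b c q : ℂ}
    (hq : q ≠ 0) (ha : a ≠ 0) (hb : b ≠ 0) (hc : c ≠ 0) {n : ℕ}
    (h1 : ∀ k ≤ n, thetaFac (a ^ 2 / q ^ k) (q ^ 2) p k ≠ 0)
    (h2 : thetaFac (b ^ 2) q p n ≠ 0) (h3 : thetaFac (a * q ^ 2 / (q ^ n * b)) q p n ≠ 0)
    (h4 : thetaFac (q ^ (n + 2)) q p n ≠ 0)
    (h5 : thetaFac (q ^ 2 / c) q p n ≠ 0) (h6 : thetaFac c q p n ≠ 0) :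
    Tendsto (fun t => rightSum n (b / a) t c (a * b) q p) (𝓝[≠] (b / a))
      (𝓝 (limitSum n a b q p)) := by
  have hα : b / a ≠ 0 := div_ne_zero hb ha
  have : ContinuousAt (fun t => rightSum n (b / a) t c (a * b) q p) (b / a) := by
    refine continuousAt_rightSum hp hq hc (mul_ne_zero ha hb) (a := fun _ => b / a)
      (b := fun t => t) continuousAt_const continuousAt_id hα hα (fun k hk => ?_) ?_ ?_ h4 ?_ h5
    · rw [show a * b / (b / a * q ^ k) = a ^ 2 / q ^ k by field_simp]
      exact h1 k hk
    · rwa [show b / a * (a * b) = b ^ 2 by field_simp]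
    · rwa [show q ^ 2 / (q ^ n * (b / a)) = a * q ^ 2 / (q ^ n * b) by field_simp]
    · rwa [mul_div_cancel_left₀ c hα]
  have h := this.tendsto.mono_left (nhdsWithin_le_nhds (s := {b / a}ᶜ))
  rwa [rightSum_self_eq_limitSum hq ha hb h6 h5] at h

/-- The summation for generic `b / a`: compare the two limits along generic `t → b / a`, with an
auxiliary generic `c`. -/
theorem limitSum_eq_limitProduct_of_generic {p : ℂ} (hp : ‖p‖ < 1) {a b q : ℂ}
    (hq : q ≠ 0) (ha : a ≠ 0) (hb : b ≠ 0) {n : ℕ} (hQ : GenericBase q p (2 * n + 1))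
    (hα : Generic q p (b / a)) (h1 : ∀ k ≤ n, thetaFac (a ^ 2 / q ^ k) (q ^ 2) p k ≠ 0)
    (h2 : thetaFac (b ^ 2) q p n ≠ 0) (h3 : thetaFac (q / a ^ 2) q p n ≠ 0) :
    limitSum n a b q p = limitProduct n a b q p := by
  have hα0 := hα.1
  obtain ⟨c, hc, hcα, hαc⟩ : ∃ c, Generic q p c ∧ Generic q p (c / (b / a)) ∧
      Generic q p (b / a * c) := by
    let S : Set ℂ := {c | Generic q p (1 * c ^ 1) ∧ Generic q p ((b / a)⁻¹ * c ^ 1) ∧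
      Generic q p (b / a * c ^ 1)}
    have hS : {s : ℂ | s ≠ 0 ∧ s ∉ S}.Countable := by
      refine (((countable_setOf_not_generic hp hq one_ne_zero one_pos).union
        (countable_setOf_not_generic hp hq (inv_ne_zero hα0) one_pos)).union
        (countable_setOf_not_generic hp hq hα0 one_pos)).mono ?_
      rintro s ⟨hs, h⟩
      by_contra hne
      refine h ⟨?_, ?_, ?_⟩ <;> by_contra hgen
      · exact hne (Or.inl (Or.inl ⟨hs, hgen⟩))
      · exact hne (Or.inl (Or.inr ⟨hs, hgen⟩))
      · exact hne (Or.inr ⟨hs, hgen⟩)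
    have := neBot_nhdsWithin_of_countable hS 1
    obtain ⟨c, h1, h2, h3⟩ := (self_mem_nhdsWithin : S ∈ 𝓝[S] 1) |> Filter.nonempty_of_mem
    refine ⟨c, by simpa using h1, ?_, by simpa using h3⟩
    rwa [pow_one, inv_mul_eq_div] at h2
  have hc0 := hc.1
  let T : Set ℂ := {t | (Generic q p (1 * t ^ 1) ∧ Generic q p ((b / a)⁻¹ * t ^ 1)) ∧
    Generic q p (c * t ^ 1) ∧ Generic q p (c / (b / a) * t ^ 1)}
  have hT : {s : ℂ | s ≠ 0 ∧ s ∉ T}.Countable := by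
    refine (((countable_setOf_not_generic hp hq one_ne_zero one_pos).union
      (countable_setOf_not_generic hp hq (inv_ne_zero hα0) one_pos)).union
      ((countable_setOf_not_generic hp hq hc0 one_pos).union
      (countable_setOf_not_generic hp hq hcα.1 one_pos))).mono ?_
    rintro s ⟨hs, h⟩
    by_contra hne
    refine h ⟨⟨?_, ?_⟩, ?_, ?_⟩ <;> by_contra hgen
    · exact hne (Or.inl (Or.inl ⟨hs, hgen⟩))
    · exact hne (Or.inl (Or.inr ⟨hs, hgen⟩))
    · exact hne (Or.inr (Or.inl ⟨hs, hgen⟩))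
    · exact hne (Or.inr (Or.inr ⟨hs, hgen⟩))
  have := neBot_nhdsWithin_of_countable hT (b / a)
  -- `t = b / a` itself is not generic
  have hTne : T ⊆ {b / a}ᶜ := by
    intro t ht h
    have h' := ht.1.2.theta_ne_zero
    rw [Set.mem_singleton_iff.1 h, pow_one, inv_mul_cancel₀ hα0, theta_one hp] at h'
    exact h' rfl
  have hnat : ∀ {x y : ℂ} (m : ℤ), Generic q p x → y = x * q ^ m → thetaFac y q p n ≠ 0 :=
    fun m hx hy => (hx.of_eq_mul_zpow hq m hy).thetaFac_ne_zero n
  have hci := hc.inv hp hq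
  have hcαi := hcα.inv hp hq
  have hαi := hα.inv hp hq
  have k1 : thetaFac (q ^ 2 / c) q p n ≠ 0 := hnat 2 hci (by norm_cast; field_simp)
  have k2 : thetaFac (q ^ (n + 2)) q p n ≠ 0 := hQ.thetaFac_ne_zero (by omega) (by omega)
  have t1 := (tendsto_leftSum_div_prefactor_limitProduct hp hq ha hb hc0 hQ hα.theta_ne_zero
    (hnat (n + 1 : ℕ) hα (by rw [zpow_natCast])) (hnat 1 hcαi (by rw [zpow_one]; field_simp)) h2
    (hnat (-1) hαc (by rw [zpow_neg_one]; field_simp)) h3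
    (hnat 1 hα (by rw [zpow_one]; field_simp)) (hnat (-1) hα (by rw [zpow_neg_one]; field_simp))
    k1 (hc.thetaFac_ne_zero n)).mono_left (nhdsWithin_mono _ hTne)
  have t2 := (tendsto_rightSum_limitSum hp hq ha hb hc0 h1 h2
    (hnat (2 - n) hαi (by rw [zpow_sub₀ hq, zpow_natCast]; norm_cast; field_simp)) k2 k1
    (hc.thetaFac_ne_zero n)).mono_left (nhdsWithin_mono _ hTne)
  refine tendsto_nhds_unique_of_eventuallyEq t2 t1 ?_
  filter_upwards [self_mem_nhdsWithin] with t ht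
  obtain ⟨⟨ht1, ht2⟩, ht3, ht4⟩ := ht
  rw [pow_one] at ht1 ht2 ht3 ht4
  rw [one_mul] at ht1
  have ht0 := ht1.1
  have hta : Generic q p (t / (b / a)) := by rwa [inv_mul_eq_div] at ht2
  have k3 : thetaFac (t * c / q) q p n ≠ 0 := hnat (-1) ht3 (by rw [zpow_neg_one]; field_simp)
  have k4 : thetaFac (b / a * q / c) q p n ≠ 0 := hnat 1 hcαi (by rw [zpow_one]; field_simp)
  have k5 : thetaFac (t * c / (b / a)) q p n ≠ 0 :=
    hnat 0 ht4 (by rw [zpow_zero]; field_simp)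
  have hP : prefactor n (b / a) t c q p ≠ 0 := by
    rw [prefactor_eq, baileyFactor]
    refine mul_ne_zero (div_ne_zero (mul_ne_zero ?_ ?_) (mul_ne_zero ?_ ?_))
      (div_ne_zero (mul_ne_zero k1 k5) (mul_ne_zero k3 k4))
    · exact hnat 1 hα (by rw [zpow_one])
    · exact hnat (-1) ht1 (by rw [zpow_neg_one]; field_simp)
    · exact hQ.thetaFac_ne_zero (by omega) (by omega)
    · exact hta.thetaFac_ne_zero n
  rw [eq_div_iff hP, mul_comm]
  refine (leftSum_eq_of_generic hp hq hα ht1 hta hc0 (mul_ne_zero ha hb) hQ ?_ ?_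
    (fun k hk => ?_) k3 k4 k1 k5).symm
  · rwa [show b / a * (a * b) = b ^ 2 by field_simp]
  · rwa [show b / a * q / (a * b) = q / a ^ 2 by field_simp]
  · rw [show a * b / (b / a * q ^ k) = a ^ 2 / q ^ k by field_simp]
    exact h1 k hk

theorem continuousAt_limitSum {p : ℂ} (hp : ‖p‖ < 1) {a : ℂ} {b q : ℂ → ℂ} {s : ℂ}
    (hbs : ContinuousAt b s) (hqs : ContinuousAt q s) (hq : q s ≠ 0) (ha : a ≠ 0)
    (hb : b s ≠ 0) {n : ℕ} (h1 : thetaFac (b s ^ 2) (q s) p n ≠ 0)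
    (h2 : thetaFac (a * q s ^ (2 - (n : ℤ)) / b s) (q s) p n ≠ 0)
    (h3 : thetaFac (q s ^ (2 + n)) (q s) p n ≠ 0) (h4 : theta (q s) p ≠ 0)
    (h5 : ∀ k ≤ n, thetaFac (a ^ 2 * q s ^ (-(k : ℤ))) (q s ^ 2) p k ≠ 0) :
    ContinuousAt (fun s => limitSum n a (b s) (q s) p) s := by
  unfold limitSum
  refine tendsto_finsetSum _ fun k hk => ?_
  have hkn : k ≤ n := Nat.lt_succ_iff.1 (Finset.mem_range.1 hk)
  have g1 := thetaFac_ne_zero_of_le hkn h1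
  have g2 := thetaFac_ne_zero_of_le hkn h2
  have g3 := thetaFac_ne_zero_of_le hkn h3
  have g5 := h5 k hkn
  have hz : ∀ i : ℤ, ContinuousAt (fun s => q s ^ i) s := fun i => hqs.zpow₀ i (Or.inl hq)
  have hz1 := hz (2 - n)
  have hz2 := hz (-n)
  have hz3 := hz (-k)
  have hz0 : q s ^ (2 - (n : ℤ)) ≠ 0 := zpow_ne_zero _ hq
  have hz0' : q s ^ (-(n : ℤ)) ≠ 0 := zpow_ne_zero _ hq
  have hz0'' : q s ^ (-(k : ℤ)) ≠ 0 := zpow_ne_zero _ hq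
  simp only [thetaFacs, List.map_cons, List.map_nil, List.prod_cons, List.prod_nil, mul_one]
  change ContinuousAt _ _
  fun_prop (disch := first | assumption | positivity | exact Or.inl hq)

theorem continuousAt_limitProduct {p : ℂ} (hp : ‖p‖ < 1) {a : ℂ} {b q : ℂ → ℂ} {s : ℂ}
    (hbs : ContinuousAt b s) (hqs : ContinuousAt q s) (hq : q s ≠ 0) (ha : a ≠ 0)
    (hb : b s ≠ 0) {n : ℕ} (h1 : thetaFac (b s / a) (q s) p n ≠ 0)
    (h2 : thetaFac (b s / (a * q s)) (q s) p n ≠ 0) (h3 : thetaFac (b s ^ 2) (q s) p n ≠ 0)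
    (h4 : thetaFac (q s / a ^ 2) (q s) p n ≠ 0)
    (h5 : thetaFac (q s ^ 2) (q s ^ 2) p n ≠ 0) :
    ContinuousAt (fun s => limitProduct n a (b s) (q s) p) s := by
  simp only [← limitProduct_eq]
  fun_prop (disch := first | assumption | positivity)

/-- The summation for generic base, by density of generic `b`. -/
theorem limitSum_eq_limitProduct_of_genericBase {p : ℂ} (hp : ‖p‖ < 1) {a b q : ℂ}
    (hq : q ≠ 0) (ha : a ≠ 0) (hb : b ≠ 0) {n : ℕ} (hQ : GenericBase q p (2 * n + 1))
    (h1 : ∀ k ≤ n, thetaFac (a ^ 2 * q ^ (-(k : ℤ))) (q ^ 2) p k ≠ 0)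
    (h2 : thetaFac (a * q ^ (2 - (n : ℤ)) / b) q p n ≠ 0) (h3 : thetaFac (b ^ 2) q p n ≠ 0)
    (h4 : thetaFac (b / a) q p n ≠ 0) (h5 : thetaFac (b / (a * q)) q p n ≠ 0)
    (h6 : thetaFac (q / a ^ 2) q p n ≠ 0) :
    limitSum n a b q p = limitProduct n a b q p := by
  have hG : {s : ℂ | s ≠ 0 ∧ s ∉ {s : ℂ | Generic q p (a⁻¹ * s ^ 1)}}.Countable :=
    countable_setOf_not_generic hp hq (inv_ne_zero ha) one_pos
  have := neBot_nhdsWithin_of_countable hG b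
  have t1 := (continuousAt_limitSum hp (b := fun s => s) (q := fun _ => q) continuousAt_id
    continuousAt_const hq ha hb h3 h2 (add_comm n 2 ▸ hQ.thetaFac_ne_zero (by omega) (by omega))
    (by simpa using hQ 1 le_rfl (by omega)) h1).tendsto.mono_left
      (nhdsWithin_le_nhds (s := {s : ℂ | Generic q p (a⁻¹ * s ^ 1)}))
  have t2 := (continuousAt_limitProduct hp (b := fun s => s) (q := fun _ => q) continuousAt_id
    continuousAt_const hq ha hb h4 h5 h3 h6 (hQ.thetaFac_sq_ne_zero (by omega))).tendsto.mono_left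
      (nhdsWithin_le_nhds (s := {s : ℂ | Generic q p (a⁻¹ * s ^ 1)}))
  have c1 : ∀ᶠ s in 𝓝 b, thetaFac (s ^ 2) q p n ≠ 0 :=
    eventually_thetaFac_ne_zero hp hq (by fun_prop) (by positivity) h3
  refine tendsto_nhds_unique_of_eventuallyEq t1 t2 ?_
  filter_upwards [self_mem_nhdsWithin, nhdsWithin_le_nhds c1,
    nhdsWithin_le_nhds (eventually_ne_nhds hb)] with s hs hs1 hs0
  have hsa : Generic q p (s / a) := by
    have : Generic q p (a⁻¹ * s ^ 1) := hs
    rwa [pow_one, inv_mul_eq_div] at this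
  refine limitSum_eq_limitProduct_of_generic hp hq ha hs0 hQ hsa (fun k hk => ?_) hs1 h6
  rw [show a ^ 2 / q ^ k = a ^ 2 * q ^ (-(k : ℤ)) by rw [zpow_neg, zpow_natCast, div_eq_mul_inv]]
  exact h1 k hk

theorem countable_setOf_not_genericBase {p : ℂ} (hp : ‖p‖ < 1) (N : ℕ) :
    {s : ℂ | s ≠ 0 ∧ ¬GenericBase s p N}.Countable := by
  have hsub : {s : ℂ | s ≠ 0 ∧ ¬GenericBase s p N} ⊆
      ⋃ i : ℕ, {s : ℂ | s ≠ 0 ∧ ¬Generic 1 p (1 * s ^ (i + 1))} := by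
    -- being generic with respect to the base `1` means not being a zero of `θ`
    rintro s ⟨hs, h⟩
    simp only [GenericBase, not_forall] at h
    obtain ⟨i, hi, -, h⟩ := h
    refine Set.mem_iUnion.2 ⟨i - 1, hs, fun hg => h ?_⟩
    rw [Nat.sub_add_cancel hi, one_mul] at hg
    exact hg.theta_ne_zero
  exact (Set.countable_iUnion fun i =>
    countable_setOf_not_generic hp one_ne_zero one_ne_zero i.succ_pos).mono hsub

/-- The summation wherever no denominator vanishes. The denominators do not control all the
values `θ(q ^ i)` with `1 ≤ i ≤ 2 n + 1`: for even `n` the factor `θ(q ^ (n + 1))` may vanish.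
Such `q` are reached by continuity in `q`. -/
theorem limitSum_eq_limitProduct {p : ℂ} (hp : ‖p‖ < 1) {a b q : ℂ}
    (hq : q ≠ 0) (ha : a ≠ 0) (hb : b ≠ 0) {n : ℕ} (hθ : theta q p ≠ 0)
    (h1 : ∀ k ≤ n, thetaFac (a ^ 2 * q ^ (-(k : ℤ))) (q ^ 2) p k ≠ 0)
    (h2 : thetaFac (a * q ^ (2 - (n : ℤ)) / b) q p n ≠ 0) (hqn : thetaFac (q ^ (2 + n)) q p n ≠ 0)
    (h3 : thetaFac (b ^ 2) q p n ≠ 0)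
    (h4 : thetaFac (b / a) q p n ≠ 0) (h5 : thetaFac (b / (a * q)) q p n ≠ 0)
    (h6 : thetaFac (q / a ^ 2) q p n ≠ 0) (h7 : thetaFac (q ^ 2) (q ^ 2) p n ≠ 0) :
    limitSum n a b q p = limitProduct n a b q p := by
  let G : Set ℂ := {s | GenericBase s p (2 * n + 1)}
  have := neBot_nhdsWithin_of_countable
    (show {s : ℂ | s ≠ 0 ∧ s ∉ G}.Countable from countable_setOf_not_genericBase hp _) q
  have t1 := (continuousAt_limitSum hp (b := fun _ => b) (q := fun s => s) continuousAt_const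
    continuousAt_id hq ha hb h3 h2 hqn hθ h1).tendsto.mono_left (nhdsWithin_le_nhds (s := G))
  have t2 := (continuousAt_limitProduct hp (b := fun _ => b) (q := fun s => s) continuousAt_const
    continuousAt_id hq ha hb h4 h5 h3 h6 h7).tendsto.mono_left (nhdsWithin_le_nhds (s := G))
  have hz : ∀ i : ℤ, ContinuousAt (fun s : ℂ => s ^ i) q := fun i =>
    continuousAt_zpow₀ q i (Or.inl hq)
  have hev : ∀ {f : ℂ → ℂ} {m k : ℕ}, ContinuousAt f q → f q ≠ 0 →
      thetaFac (f q) (q ^ (m + 1)) p k ≠ 0 → ∀ᶠ s in 𝓝[G] q, thetaFac (f s) (s ^ (m + 1)) p k ≠ 0 :=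
    fun {f m k} hf hf0 h => nhdsWithin_le_nhds ((continuousAt_thetaFac hp
      (Q := fun s => s ^ (m + 1)) (by fun_prop) (pow_ne_zero _ hq) hf hf0 k).eventually_ne h)
  have hev1 : ∀ {f : ℂ → ℂ} {k : ℕ}, ContinuousAt f q → f q ≠ 0 →
      thetaFac (f q) q p k ≠ 0 → ∀ᶠ s in 𝓝[G] q, thetaFac (f s) s p k ≠ 0 := fun hf hf0 h => by
    simpa using hev (m := 0) hf hf0 (by simpa using h)
  have c1 : ∀ᶠ s in 𝓝[G] q, ∀ k ∈ Finset.range (n + 1),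
      thetaFac (a ^ 2 * s ^ (-(k : ℤ))) (s ^ 2) p k ≠ 0 :=
    (Finset.eventually_all _).2 fun k hk => hev (m := 1) (continuousAt_const.mul (hz _))
      (mul_ne_zero (pow_ne_zero 2 ha) (zpow_ne_zero _ hq))
      (h1 k (Nat.lt_succ_iff.1 (Finset.mem_range.1 hk)))
  have c2 : ∀ᶠ s in 𝓝[G] q, thetaFac (a * s ^ (2 - (n : ℤ)) / b) s p n ≠ 0 :=
    hev1 ((continuousAt_const.mul (hz _)).div_const b)
      (div_ne_zero (mul_ne_zero ha (zpow_ne_zero _ hq)) hb) h2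
  have c3 : ∀ᶠ s in 𝓝[G] q, thetaFac (b ^ 2) s p n ≠ 0 :=
    hev1 continuousAt_const (pow_ne_zero 2 hb) h3
  have c4 : ∀ᶠ s in 𝓝[G] q, thetaFac (b / a) s p n ≠ 0 :=
    hev1 continuousAt_const (div_ne_zero hb ha) h4
  have c5 : ∀ᶠ s in 𝓝[G] q, thetaFac (b / (a * s)) s p n ≠ 0 :=
    hev1 (by fun_prop (disch := positivity)) (by positivity) h5
  have c6 : ∀ᶠ s in 𝓝[G] q, thetaFac (s / a ^ 2) s p n ≠ 0 :=
    hev1 (by fun_prop (disch := positivity)) (by positivity) h6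
  refine tendsto_nhds_unique_of_eventuallyEq t1 t2 ?_
  filter_upwards [self_mem_nhdsWithin, nhdsWithin_le_nhds (eventually_ne_nhds hq), c1, c2, c3, c4,
    c5, c6] with s hs hs0 d1 d2 d3 d4 d5 d6
  exact limitSum_eq_limitProduct_of_genericBase hp hs0 ha hb hs
    (fun k hk => d1 k (Finset.mem_range.2 (Nat.lt_succ_iff.2 hk))) d2 d3 d4 d5 d6

end EllipticTransformation

open EllipticTransformation in
theorem mainTheorem3 (p q : ℂ) (hp : ‖p‖ < 1) (hq : q ≠ 0) (n : ℕ) :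
    -- the transformation formula, wherever no denominator vanishes
    (∀ a b c d : ℂ, a ≠ 0 → b ≠ 0 → c ≠ 0 → d ≠ 0 →
      theta a p ≠ 0 →
      thetaFacs [a * q ^ (1 - (n : ℤ)) / b, a * q ^ (1 + n), a * q / c, a * d,
        b * c / q, a * q / d] q p n ≠ 0 →
      thetaFac (q ^ 2) (q ^ 2) p n ≠ 0 →
      thetaFacs [q ^ 2, b / a, b * c / q, a * q / c] q p n ≠ 0 →
      theta q p ≠ 0 →
      (∀ k ≤ n, thetaFac (d * q ^ (-(k : ℤ)) / a) (q ^ 2) p k ≠ 0) →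
      thetaFacs [q ^ (2 - (n : ℤ)) / b, q ^ (2 + n), q ^ 2 / c, b * c / a, a * d] q p n ≠ 0 →
      leftSum n a b c d q p = prefactor n a b c q p * rightSum n a b c d q p) ∧
    -- its limiting case: `b → a`, then `a ↦ b / a` and `d ↦ a * b`
    (∀ a b c : ℂ, a ≠ 0 → b ≠ 0 → c ≠ 0 →
      theta (b / a) p ≠ 0 →
      thetaFacs [b / a * q ^ (1 + n), b * q / (a * c), b ^ 2, b * c / (a * q),
        q / a ^ 2] q p n ≠ 0 →
      thetaFac (q ^ 2) (q ^ 2) p n ≠ 0 →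
      thetaFacs [q ^ 2, b * q / a, b / (a * q), q ^ 2 / c, c] q p n ≠ 0 →
      theta q p ≠ 0 →
      (∀ k ≤ n, thetaFac (a ^ 2 * q ^ (-(k : ℤ))) (q ^ 2) p k ≠ 0) →
      thetaFacs [a * q ^ (2 - (n : ℤ)) / b, q ^ (2 + n)] q p n ≠ 0 →
      Tendsto (fun t => leftSum n (b / a) t c (a * b) q p / prefactor n (b / a) t c q p)
        (𝓝[≠] (b / a)) (𝓝 (limitProduct n a b q p)) ∧
      Tendsto (fun t => rightSum n (b / a) t c (a * b) q p)
        (𝓝[≠] (b / a)) (𝓝 (limitSum n a b q p))) ∧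
    -- the resulting summation, wherever no denominator vanishes
    (∀ a b : ℂ, a ≠ 0 → b ≠ 0 →
      theta q p ≠ 0 →
      (∀ k ≤ n, thetaFac (a ^ 2 * q ^ (-(k : ℤ))) (q ^ 2) p k ≠ 0) →
      thetaFacs [a * q ^ (2 - (n : ℤ)) / b, q ^ (2 + n), b ^ 2] q p n ≠ 0 →
      thetaFacs [b / a, b / (a * q), b ^ 2, q / a ^ 2] q p n ≠ 0 →
      thetaFac (q ^ 2) (q ^ 2) p n ≠ 0 →
      limitSum n a b q p = limitProduct n a b q p) := by
  refine ⟨?_, ?_, ?_⟩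
  · intro a b c d ha hb hc hd hθ hL hq4 hP hq1 hX hR
    simp only [thetaFacs, List.map_cons, List.map_nil, List.prod_cons, List.prod_nil, mul_one,
      ne_eq, mul_eq_zero, not_or, zpow_sub₀ hq, zpow_neg, zpow_natCast, zpow_one] at hL hP hX hR
    obtain ⟨hL1, hL2, hL3, hL4, hL5, hL6⟩ := hL
    obtain ⟨hP1, hP2, -, -⟩ := hP
    obtain ⟨hR1, hR2, hR3, hR4, -⟩ := hR
    rw [add_comm 2 n] at hR2
    refine leftSum_eq_prefactor_mul_rightSum hp hq ha hb hc hd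
      (genericBase_of_ne_zero hq1 hP1 hR2) hθ ?_ (add_comm 1 n ▸ hL2) hP2 ?_ hL4 hL6
      (fun k hk => ?_) hL5 hL3 hR3 hR4
    · rwa [show a * q / (q ^ n * b) = a * (q / q ^ n) / b by ring]
    · rwa [show q ^ 2 / (q ^ n * b) = q ^ (2 : ℤ) / q ^ n / b by norm_cast; ring]
    · rw [show d / (a * q ^ k) = d * (q ^ k)⁻¹ / a by ring]
      exact hX k hk
  · intro a b c ha hb hc hθ hL hq4 hP hq1 hX hR
    simp only [thetaFacs, List.map_cons, List.map_nil, List.prod_cons, List.prod_nil, mul_one,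
      ne_eq, mul_eq_zero, not_or, zpow_sub₀ hq, zpow_neg, zpow_natCast] at hL hP hX hR
    obtain ⟨hL1, hL2, hL3, hL4, hL5⟩ := hL
    obtain ⟨hP1, hP2, hP3, hP4, hP5⟩ := hP
    obtain ⟨hR1, hR2⟩ := hR
    rw [add_comm 2 n] at hR2
    refine ⟨tendsto_leftSum_div_prefactor_limitProduct hp hq ha hb hc
      (genericBase_of_ne_zero hq1 hP1 hR2) hθ (add_comm 1 n ▸ hL1) hL2 hL3 hL4 hL5 hP2 hP3 hP4
      hP5, tendsto_rightSum_limitSum hp hq ha hb hc (fun k hk => ?_) hL3 ?_ hR2 hP4 hP5⟩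
    · rw [div_eq_mul_inv]
      exact hX k hk
    · rwa [show a * q ^ 2 / (q ^ n * b) = a * (q ^ (2 : ℤ) / q ^ n) / b by norm_cast; ring]
  · intro a b ha hb hq1 hX hR hT hq4
    simp only [thetaFacs, List.map_cons, List.map_nil, List.prod_cons, List.prod_nil, mul_one,
      ne_eq, mul_eq_zero, not_or] at hR hT
    obtain ⟨hR1, hR2, hR3⟩ := hR
    obtain ⟨hT1, hT2, -, hT4⟩ := hT
    exact limitSum_eq_limitProduct hp hq ha hb hq1 hX hR1 hR2 hR3 hT1 hT2 hT4 hq4
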